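/- Let $n\ge 1$ and $\nu>n$ ($\nu$ real). Let $dz$ be Lebesgue measure on the unit ball $\mathbb B^n\subset\mathbb C^n$ normalized to total mass $1$, let $c_\nu=\frac{\Gamma(\nu)}{n!\,\Gamma(\nu-n)}$, and let $d\mu_\nu(z)=c_\nu(1-|z|^2)^{\nu-n-1}\,dz$, a probability measure. Let $\mathcal A^2_\nu\subset L^2(\mu_\nu)$ be the Bergman space of square-integrable holomorphic functions on $\mathbb B^n$, with kernel $K_\nu(z,w)=(1-\langle z,w\rangle)^{-\nu}$, and for bounded measurable $f$ let $T_f$ be the Toeplitz operator $T_fg(z)=\int f(w)g(w)K_\nu(z,w)\,d\mu_\nu(w)$ on $\mathcal A^2_\nu$. Let $G=\mathrm{SU}(n,1)$ act on $\mathbb B^n$ by fractional linear maps and let $K\cong \mathrm U(n)$ be the stabilizer of $0$, with Haar probability measure $dk$. A bounded spherical function is a function $\phi$ on $\mathbb B^n=G/K$ which, regarded as a function on $G$, is continuous, bounded, not identically zero, and satisfies $\int_K\phi(xky)\,dk=\phi(x)\phi(y)$ for all $x,y\in G$. For $\lambda\in\mathbb C$ put $$\phi_\lambda(z)={}_2F_1\Big(\tfrac{n+i\lambda}2,\tfrac{n-i\lambda}2;n;\tfrac{-|z|^2}{1-|z|^2}\Big)=(1-|z|^2)^{\frac{n+i\lambda}{2}}\,{}_2F_1\Big(\tfrac{n+i\lambda}2,\tfrac{n+i\lambda}2;n;|z|^2\Big).$$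 Let $h_\nu(z)=(1-|z|^2)^\nu$ and let $$\widehat{h_\nu}(\phi)=\int_{\mathbb B^n}h_\nu\,\phi\;\frac{c_\nu\,dz}{(1-|z|^2)^{n+1}}$$ be its spherical transform, where the $G$-invariant measure is normalized so that $h_\nu$ has integral $1$. Write $\widehat{h_\nu}(\lambda)=\widehat{h_\nu}(\phi_\lambda)$. **Lemma.** For every $\lambda\in\mathbb C$ with $|\mathrm{Im}\,\lambda|\le n$ the function $\phi_\lambda$ is a bounded spherical function. For every bounded spherical function $\phi$ (in particular for every such $\phi_\lambda$), $\widehat{h_\nu}(\phi)\ne 0$, the Toeplitz operator $T_\phi$ is a well-defined bounded operator on $\mathcal A^2_\nu$, and for either choice of the square root $$\big\|\widehat{h_\nu}(\phi)^{-1/2}\,T_\phi\big\|\le 1 .$$ In particular $T^{\lambda,\nu}=\widehat{h_\nu}(\lambda)^{-1/2}T_{\phi_\lambda}$ has operator norm at most $1$. Hence $\|T_\phi\|\le|\widehat{h_\nu}(\phi)|^{1/2}$. This improves the trivial bound $\|T_\phi\|\le 1$: one has $|\widehat{h_\nu}(\phi)|^{1/2}\le 1$, with strict inequality unless $\phi\equiv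 1$. -/

import Mathlib

open MeasureTheory Set
open scoped Matrix ComplexConjugate

noncomputable section

namespace BallQHA

/-! ### The unit ball, the group `SU(n,1)` and its action -/

/-- `ℂⁿ` with its Euclidean norm. -/
abbrev Cn (n : ℕ) : Type := EuclideanSpace ℂ (Fin n)

/-- The open unit ball of `ℂⁿ`. -/
def unitBall (n : ℕ) : Set (Cn n) := Metric.ball 0 1

/-- The matrix `diag(-1, …, -1, 1)` of the Hermitian form of signature `(n,1)`. -/
def formJ (n : ℕ) : Matrix (Fin n ⊕ Unit) (Fin n ⊕ Unit) ℂ :=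
  Matrix.fromBlocks (-1) 0 0 1

/-- The group `SU(n,1)`: complex matrices of determinant one with `x* J x = J`. -/
def SU1 (n : ℕ) : Subgroup (Matrix.SpecialLinearGroup (Fin n ⊕ Unit) ℂ) where
  carrier := {x | (x.1)ᴴ * formJ n * x.1 = formJ n}
  one_mem' := by simp
  mul_mem' := by
    intro x y hx hy
    simp only [mem_ofPred_eq] at hx hy ⊢
    calc ((x * y).1)ᴴ * formJ n * (x * y).1
        = (y.1)ᴴ * ((x.1)ᴴ * formJ n * x.1) * y.1 := by
          simp [Matrix.conjTranspose_mul, Matrix.mul_assoc]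
      _ = formJ n := by rw [hx, hy]
  inv_mem' := by
    intro x hx
    simp only [mem_ofPred_eq] at hx ⊢
    have h1 : x.1 * (x⁻¹).1 = 1 := by
      have := congrArg Subtype.val (mul_inv_cancel x)
      simpa only [Matrix.SpecialLinearGroup.coe_mul, Matrix.SpecialLinearGroup.coe_one] using this
    have h2 : ((x⁻¹).1)ᴴ * (x.1)ᴴ = 1 := by
      rw [← Matrix.conjTranspose_mul, h1, Matrix.conjTranspose_one]
    calc ((x⁻¹).1)ᴴ * formJ n * (x⁻¹).1
        = ((x⁻¹).1)ᴴ * ((x.1)ᴴ * formJ n * x.1) * (x⁻¹).1 := by rw [hx]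
      _ = (((x⁻¹).1)ᴴ * (x.1)ᴴ) * formJ n * (x.1 * (x⁻¹).1) := by
          simp only [Matrix.mul_assoc]
      _ = formJ n := by rw [h1, h2, Matrix.one_mul, Matrix.mul_one]

/-- The fractional linear action `x · z = (A z + w) / (v · z + d)` of `x = (A w; v d)`. -/
def moebius {n : ℕ} (x : SU1 n) (z : Cn n) : Cn n :=
  WithLp.toLp 2 fun i =>
    ((∑ j, x.1.1 (Sum.inl i) (Sum.inl j) * z j) + x.1.1 (Sum.inl i) (Sum.inr ())) /
      ((∑ j, x.1.1 (Sum.inr ()) (Sum.inl j) * z j) + x.1.1 (Sum.inr ()) (Sum.inr ()))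

/-- The embedding `k ↦ diag(k, conj (det k))` of `U(n)` in `SU(n,1)`; its image is the stabilizer
`K` of the origin. -/
def embK {n : ℕ} (k : Matrix.unitaryGroup (Fin n) ℂ) : SU1 n :=
  ⟨⟨Matrix.fromBlocks k.1 0 0 (conj k.1.det • (1 : Matrix Unit Unit ℂ)), by
      have h : k.1.det * conj k.1.det = 1 := by
        have := (Matrix.det_of_mem_unitary k.2)
        exact (Unitary.mem_iff.1 this).2
      simpa [Matrix.det_fromBlocks_zero₂₁] using h⟩, by
    have hk : (k.1)ᴴ * k.1 = 1 := (Unitary.mem_iff.1 k.2).1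
    have h : k.1.det * conj k.1.det = 1 := by
      have := (Matrix.det_of_mem_unitary k.2)
      exact (Unitary.mem_iff.1 this).2
    change (Matrix.fromBlocks k.1 0 0 (conj k.1.det • (1 : Matrix Unit Unit ℂ)))ᴴ * formJ n *
      Matrix.fromBlocks k.1 0 0 (conj k.1.det • (1 : Matrix Unit Unit ℂ)) = formJ n
    simp [formJ, Matrix.fromBlocks_conjTranspose, Matrix.fromBlocks_multiply, hk, smul_smul]
    rw [mul_comm, h, one_smul]⟩

/-! ### The normalized Haar measure of `K ≃ U(n)` -/

instance instMeasurableSpaceU (n : ℕ) : MeasurableSpace (Matrix.unitaryGroup (Fin n) ℂ) :=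
  borel _

instance instBorelSpaceU (n : ℕ) : BorelSpace (Matrix.unitaryGroup (Fin n) ℂ) := ⟨rfl⟩

instance instCompactSpaceU (n : ℕ) : CompactSpace (Matrix.unitaryGroup (Fin n) ℂ) := by
  apply isCompact_iff_compactSpace.1
  have hK : IsCompact (Set.pi univ fun _ : Fin n => Set.pi univ fun _ : Fin n =>
      Metric.closedBall (0 : ℂ) 1) :=
    isCompact_univ_pi fun _ => isCompact_univ_pi fun _ => isCompact_closedBall _ _
  refine hK.of_isClosed_subset ?_ ?_
  · have : ((Matrix.unitaryGroup (Fin n) ℂ : Submonoid _) : Set (Matrix (Fin n) (Fin n) ℂ)) =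
        {A | star A * A = 1} ∩ {A | A * star A = 1} := by
      ext A; exact Unitary.mem_iff
    rw [this]
    exact (isClosed_eq (by fun_prop) continuous_const).inter
      (isClosed_eq (by fun_prop) continuous_const)
  · intro A hA i _ j _
    simpa using entry_norm_bound_of_unitary hA i j

/-- The Haar probability measure of `U(n)`. -/
def haarU (n : ℕ) : Measure (Matrix.unitaryGroup (Fin n) ℂ) :=
  Measure.haarMeasure ⊤

/-! ### Spherical functions -/

/-- Bounded spherical functions of the Gelfand pair `(SU(n,1), U(n))`, regarded as functions on the
ball `G/K`: with `Φ(x) = φ(x · 0)`, the function `Φ` is continuous, nonzero, bounded, and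
`∫_K Φ(x k y) dk = Φ(x) Φ(y)`. Values of `φ` outside the ball play no role. -/
structure IsBoundedSpherical (n : ℕ) (φ : Cn n → ℂ) : Prop where
  continuous : Continuous fun x : SU1 n => φ (moebius x 0)
  nonzero : ∃ x : SU1 n, φ (moebius x 0) ≠ 0
  bounded : ∃ C : ℝ, ∀ x : SU1 n, ‖φ (moebius x 0)‖ ≤ C
  functional_equation : ∀ x y : SU1 n,
    ∫ k, φ (moebius (x * embK k * y) 0) ∂(haarU n) = φ (moebius x 0) * φ (moebius y 0)

/-- The spherical function with parameter `lam`,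
`φ_lam(z) = (1-|z|²)^((n+i lam)/2) ₂F₁((n+i lam)/2, (n+i lam)/2; n; |z|²)`, which equals
`₂F₁((n+i lam)/2, (n-i lam)/2; n; -|z|²/(1-|z|²))` by Pfaff's transformation. -/
def sphericalFun (n : ℕ) (lam : ℂ) (z : Cn n) : ℂ :=
  ((1 - ‖z‖ ^ 2 : ℝ) : ℂ) ^ (((n : ℂ) + Complex.I * lam) / 2) *
    ₂F₁ (((n : ℂ) + Complex.I * lam) / 2) (((n : ℂ) + Complex.I * lam) / 2) (n : ℂ)
      ((‖z‖ ^ 2 : ℝ) : ℂ)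

/-! ### Measures on the ball -/

/-- Lebesgue measure on the ball, normalized to total mass one. -/
def lebBall (n : ℕ) : Measure (Cn n) :=
  (volume (unitBall n))⁻¹ • volume.restrict (unitBall n)

/-- `c_ν = Γ(ν) / (n! Γ(ν - n))`. -/
def cConst (n : ℕ) (ν : ℝ) : ℝ :=
  Real.Gamma ν / (n.factorial * Real.Gamma (ν - n))

/-- The probability measure `dμ_ν = c_ν (1-|z|²)^(ν-n-1) dz` on the ball (for `ν > n`). -/
def bergmanMeasure (n : ℕ) (ν : ℝ) : Measure (Cn n) :=
  (lebBall n).withDensity fun z =>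
    ENNReal.ofReal (cConst n ν * (1 - ‖z‖ ^ 2) ^ (ν - (n + 1)))

/-- The `SU(n,1)`-invariant measure `c_ν (1-|z|²)^(-(n+1)) dz` on the ball, in the normalization
for which `h_ν(z) = (1-|z|²)^ν` has integral one. -/
def invMeasure (n : ℕ) (ν : ℝ) : Measure (Cn n) :=
  (lebBall n).withDensity fun z =>
    ENNReal.ofReal (cConst n ν * (1 - ‖z‖ ^ 2) ^ (-((n : ℝ) + 1)))

/-- `h_ν(z) = (1-|z|²)^ν`. -/
def hFun (n : ℕ) (ν : ℝ) (z : Cn n) : ℂ := (((1 - ‖z‖ ^ 2) ^ ν : ℝ) : ℂ)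

/-- The spherical transform of `h_ν` at the spherical function `φ`. -/
def hHat (n : ℕ) (ν : ℝ) (φ : Cn n → ℂ) : ℂ :=
  ∫ z, hFun n ν z * φ z ∂(invMeasure n ν)

/-! ### Bergman space and Toeplitz operators -/

/-- The weighted Bergman space `A²_ν`: the classes in `L²(μ_ν)` of functions holomorphic on the
ball, with the `L²` norm. -/
def bergmanSpace (n : ℕ) (ν : ℝ) : Submodule ℂ (Lp ℂ 2 (bergmanMeasure n ν)) where
  carrier := {f | ∃ g : Cn n → ℂ, DifferentiableOn ℂ g (unitBall n) ∧
    f =ᵐ[bergmanMeasure n ν] g}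
  zero_mem' := ⟨0, differentiableOn_const 0, Lp.coeFn_zero _ _ _⟩
  add_mem' := by
    rintro f₁ f₂ ⟨g₁, hg₁, h₁⟩ ⟨g₂, hg₂, h₂⟩
    exact ⟨g₁ + g₂, hg₁.add hg₂, (Lp.coeFn_add f₁ f₂).trans (h₁.add h₂)⟩
  smul_mem' := by
    rintro c f ⟨g, hg, h⟩
    exact ⟨c • g, hg.const_smul c, (Lp.coeFn_smul c f).trans (h.const_smul c)⟩

/-- The reproducing kernel `K_ν(z,w) = (1 - ⟨z,w⟩)^(-ν)`, `⟨z,w⟩ = ∑ z_j conj(w_j)`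
(principal branch). -/
def bergmanKernel (n : ℕ) (ν : ℝ) (z w : Cn n) : ℂ :=
  (1 - ∑ j, z j * conj (w j)) ^ (-(ν : ℂ))

/-- `T` is the Toeplitz operator `T_f` on `A²_ν` with symbol `f`:
`(T g)(z) = ∫ f(w) g(w) K_ν(z,w) dμ_ν(w)` for all `g ∈ A²_ν`, the integrals being convergent. -/
def IsToeplitz (n : ℕ) (ν : ℝ) (f : Cn n → ℂ)
    (T : bergmanSpace n ν →L[ℂ] bergmanSpace n ν) : Prop :=
  ∀ g : bergmanSpace n ν,
    (∀ z ∈ unitBall n,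
      Integrable (fun w => f w * g.1 w * bergmanKernel n ν z w) (bergmanMeasure n ν)) ∧
    (T g).1 =ᵐ[bergmanMeasure n ν]
      fun z => ∫ w, f w * g.1 w * bergmanKernel n ν z w ∂(bergmanMeasure n ν)

end BallQHA

end

/-! Write ĥ for the spherical transform of h_ν at φ, and k(a,b) = ⟨T_φ K_b, K_a⟩ for the kernel of
the Toeplitz operator (`toepKer`). Let π be the projective unitary action of G on A²_ν, which sends
K_b to a multiple of K_{x·b}. The bound comes from a product formula for its matrix coefficients:
for all f, g, f', g' in the span of kernel functions based near 0, ĥ ∫_G φ(x) ⟨π(x)f, g⟩ conj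
⟨π(x)g', f'⟩ dx = ⟨T_φ f, g'⟩ ⟨T_φ f', g⟩.

For φ = 1 this is Schur orthogonality, with ∫ |⟨π(x)f, g⟩|² dx = ‖f‖²‖g‖². For general φ take f' = f
and g' = g: the right side is ⟨T_φ f, g⟩². Since |φ| ≤ 1, Cauchy–Schwarz and Schur orthogonality
bound the integral by ‖f‖²‖g‖², so |⟨T_φ f, g⟩|² ≤ |ĥ| ‖f‖²‖g‖². Density of the kernel functions
finishes the estimate (`norm_inner_toeplitz_le`, `norm_toeplitz_le`).

The product formula is proved on the diagonal and then polarized. A spherical function is an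
eigenfunction of convolution with radial functions (`IsBoundedSpherical.integral_comp_moebius_mul`).
One use gives k(a,a) = (1-|a|²)^(-ν) φ(a) ĥ. Another, after averaging over K, evaluates the integral
of φ |⟨π(x)K_b, K_a⟩|² (`IsBoundedSpherical.integral_mul_normSq_cross`). Both sides of the resulting
identity (`product_formula_diag`) extend holomorphically when the two copies of a and of b are made
independent, which gives `product_formula`.

No representation theory is needed in the formal argument. With x = boost z · k the coefficient
⟨π(x)K_b, K_a⟩ is, up to a phase, (1-|z|²)^(ν/2) times an explicit function `coeff`; the square of
the dropped factor turns the invariant measure into μ_ν, so integrals over G become integrals over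
μ_ν × dk. Only a and b in the ball of radius 1/4 are used, where `coeff` is a principal power of a
number in the right half plane.

Nonvanishing of ĥ follows from the bound itself: if ĥ = 0 then T_φ = 0, so φ is orthogonal to all p
· conj q, hence zero by Stone–Weierstrass, against φ(0) = 1. The strict inequality is the equality
case of |∫ φ dμ_ν| ≤ 1.

That φ_λ is spherical follows from writing it as the K-average of the power s = (n+iλ)/2 of the
Poisson kernel (`sphericalFun_eq_poisAvg`). The hypergeometric series arises from two binomial
series and the moments of a coordinate on the sphere, and these moments are read off from the
reproducing property of the Bergman kernel. The functional equation is the cocycle property of the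
Poisson kernel; boundedness holds because 0 ≤ Re s ≤ n. -/

noncomputable section
namespace BallQHA

variable {n : ℕ}

/-! ### The action of `SU(n,1)` on the closed ball -/

/-- The lift `(z, 1)` of a point of `ℂⁿ` to homogeneous coordinates. -/
def lift (z : Cn n) : Fin n ⊕ Unit → ℂ := Sum.elim z.ofLp fun _ => 1

/-- The numerator `A z + w` of the fractional linear action. -/
def num (x : SU1 n) (z : Cn n) : Cn n :=
  WithLp.toLp 2 fun i =>
    (∑ j, x.1.1 (Sum.inl i) (Sum.inl j) * z j) + x.1.1 (Sum.inl i) (Sum.inr ())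

/-- The denominator `v · z + d` of the fractional linear action. -/
def den (x : SU1 n) (z : Cn n) : ℂ :=
  (∑ j, x.1.1 (Sum.inr ()) (Sum.inl j) * z j) + x.1.1 (Sum.inr ()) (Sum.inr ())

lemma moebius_eq (x : SU1 n) (z : Cn n) : moebius x z = (den x z)⁻¹ • num x z := by
  ext i
  simp [moebius, num, den, div_eq_inv_mul]

lemma mulVec_lift (x : SU1 n) (z : Cn n) :
    x.1.1 *ᵥ lift z = Sum.elim (num x z).ofLp fun _ => den x z := by
  funext i
  rcases i with i | i <;> simp [Matrix.mulVec, dotProduct, lift, num, den]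

lemma inner_eq_sum (z w : Cn n) : inner ℂ w z = ∑ j, z j * conj (w j) := by
  simp [PiLp.inner_apply]

lemma star_dotProduct_formJ (p q : Cn n) (s t : ℂ) :
    star (Sum.elim q.ofLp fun _ : Unit => t) ⬝ᵥ (formJ n *ᵥ Sum.elim p.ofLp fun _ : Unit => s) =
      s * conj t - inner ℂ q p := by
  rw [formJ, Matrix.fromBlocks_mulVec, inner_eq_sum]
  simp [dotProduct, Matrix.neg_mulVec, mul_comm]
  ring

lemma formJ_conj (x : SU1 n) : (x.1.1)ᴴ * formJ n * x.1.1 = formJ n := x.2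

/-- Invariance of the form of signature (n,1), evaluated on the lifts (a,1) and (b,1), whose images
are (num, den). The metric identities for the action all descend from it. -/
lemma den_mul_conj_sub (x : SU1 n) (a b : Cn n) :
    den x a * conj (den x b) - inner ℂ (num x b) (num x a) = 1 - inner ℂ b a := by
  have h1 := star_dotProduct_formJ (num x a) (num x b) (den x a) (den x b)
  have h2 := star_dotProduct_formJ a b 1 1
  rw [← h1, ← mulVec_lift, ← mulVec_lift, Matrix.star_mulVec, ← Matrix.dotProduct_mulVec,
    Matrix.mulVec_mulVec, Matrix.mulVec_mulVec, formJ_conj]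
  simpa [lift] using h2

lemma inner_self_eq_ofReal (z : Cn n) : inner ℂ z z = ((‖z‖ ^ 2 : ℝ) : ℂ) := by
  rw [inner_self_eq_norm_sq_to_K]; simp

lemma normSq_den_sub (x : SU1 n) (a : Cn n) :
    ‖den x a‖ ^ 2 - ‖num x a‖ ^ 2 = 1 - ‖a‖ ^ 2 := by
  have h := den_mul_conj_sub x a a
  rw [Complex.mul_conj, inner_self_eq_ofReal, inner_self_eq_ofReal,
    Complex.normSq_eq_norm_sq] at h
  exact_mod_cast h

/-- A vanishing denominator would force the numerator to vanish as well, and then the invertible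
matrix x would annihilate the nonzero vector (a,1). The closed ball is allowed because the Poisson
kernel needs the action on the sphere. -/
lemma den_ne_zero (x : SU1 n) {a : Cn n} (ha : ‖a‖ ≤ 1) : den x a ≠ 0 := by
  intro h
  have h1 := normSq_den_sub x a
  have h2 : num x a = 0 := by
    rw [h] at h1
    have : ‖num x a‖ ^ 2 ≤ 0 := by
      have : ‖a‖ ^ 2 ≤ 1 := by nlinarith [norm_nonneg a]
      simp at h1; linarith
    simpa using this
  have h3 : x.1.1 *ᵥ lift a = 0 := by
    rw [mulVec_lift, h, h2]
    funext i; rcases i with i | i <;> simp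
  have h4 : lift a = 0 := by
    have := congrArg ((x⁻¹).1.1 *ᵥ ·) h3
    simp only [Matrix.mulVec_mulVec, Matrix.mulVec_zero] at this
    have e : (x⁻¹).1.1 * x.1.1 = 1 := by
      have := congrArg (fun y : SU1 n => y.1.1) (inv_mul_cancel x)
      simpa only [Subgroup.coe_mul, Matrix.SpecialLinearGroup.coe_mul, Subgroup.coe_one,
        Matrix.SpecialLinearGroup.coe_one] using this
    rwa [e, Matrix.one_mulVec] at this
  have := congrFun h4 (Sum.inr ())
  simp [lift] at this

lemma one_sub_inner_moebius (x : SU1 n) {a b : Cn n} (ha : ‖a‖ ≤ 1) (hb : ‖b‖ ≤ 1) :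
    1 - inner ℂ (moebius x b) (moebius x a) =
      (1 - inner ℂ b a) / (den x a * conj (den x b)) := by
  have h1 := den_ne_zero x ha
  have h2 : conj (den x b) ≠ 0 := by simpa using den_ne_zero x hb
  rw [← den_mul_conj_sub x a b, moebius_eq, moebius_eq, inner_smul_left, inner_smul_right, map_inv₀]
  field_simp

lemma one_sub_normSq_moebius (x : SU1 n) {a : Cn n} (ha : ‖a‖ ≤ 1) :
    1 - ‖moebius x a‖ ^ 2 = (1 - ‖a‖ ^ 2) / ‖den x a‖ ^ 2 := by
  have h := one_sub_inner_moebius x ha ha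
  rw [Complex.mul_conj, inner_self_eq_ofReal, inner_self_eq_ofReal,
    Complex.normSq_eq_norm_sq] at h
  exact_mod_cast h

lemma norm_moebius_lt_one (x : SU1 n) {a : Cn n} (ha : ‖a‖ < 1) : ‖moebius x a‖ < 1 := by
  have h := one_sub_normSq_moebius x ha.le
  have h1 : 0 < (1 - ‖a‖ ^ 2) / ‖den x a‖ ^ 2 := by
    have := den_ne_zero x ha.le
    have : 0 < 1 - ‖a‖ ^ 2 := by nlinarith [norm_nonneg a]
    positivity
  nlinarith [norm_nonneg (moebius x a)]

lemma norm_moebius_eq_one (x : SU1 n) {a : Cn n} (ha : ‖a‖ = 1) : ‖moebius x a‖ = 1 := by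
  have h := one_sub_normSq_moebius x ha.le
  rw [ha] at h
  simp at h
  have h1 : ‖moebius x a‖ ^ 2 = 1 := by linarith
  exact (pow_eq_one_iff_of_nonneg (norm_nonneg _) two_ne_zero).1 h1

lemma norm_moebius_le_one (x : SU1 n) {a : Cn n} (ha : ‖a‖ ≤ 1) : ‖moebius x a‖ ≤ 1 := by
  rcases ha.lt_or_eq with h | h
  · exact (norm_moebius_lt_one x h).le
  · exact (norm_moebius_eq_one x h).le

lemma lift_moebius (y : SU1 n) {z : Cn n} (hz : ‖z‖ ≤ 1) :
    y.1.1 *ᵥ lift z = den y z • lift (moebius y z) := by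
  have h := den_ne_zero y hz
  rw [mulVec_lift, moebius_eq]
  funext i
  rcases i with i | i <;> simp [lift, h]

lemma coe_mul_SU1 (x y : SU1 n) : (x * y).1.1 = x.1.1 * y.1.1 := rfl

lemma mulVec_lift_mul (x y : SU1 n) {z : Cn n} (hz : ‖z‖ ≤ 1) :
    (x * y).1.1 *ᵥ lift z = den y z • (x.1.1 *ᵥ lift (moebius y z)) := by
  rw [coe_mul_SU1, ← Matrix.mulVec_mulVec, lift_moebius y hz, Matrix.mulVec_smul]

lemma den_mul (x y : SU1 n) {z : Cn n} (hz : ‖z‖ ≤ 1) :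
    den (x * y) z = den y z * den x (moebius y z) := by
  have := congrFun (mulVec_lift_mul x y hz) (Sum.inr ())
  rw [mulVec_lift] at this
  simpa [mulVec_lift] using this

lemma num_mul (x y : SU1 n) {z : Cn n} (hz : ‖z‖ ≤ 1) :
    num (x * y) z = den y z • num x (moebius y z) := by
  ext i
  have := congrFun (mulVec_lift_mul x y hz) (Sum.inl i)
  rw [mulVec_lift] at this
  simpa [mulVec_lift] using this

lemma moebius_mul (x y : SU1 n) {z : Cn n} (hz : ‖z‖ ≤ 1) :
    moebius (x * y) z = moebius x (moebius y z) := by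
  have h := den_ne_zero y hz
  rw [moebius_eq, den_mul x y hz, num_mul x y hz, moebius_eq x, smul_smul, mul_inv]
  congr 1
  field_simp

@[simp] lemma moebius_one (z : Cn n) : moebius 1 z = z := by
  ext i
  simp [moebius, Matrix.one_apply]

lemma moebius_inv_moebius (x : SU1 n) {z : Cn n} (hz : ‖z‖ ≤ 1) :
    moebius x⁻¹ (moebius x z) = z := by
  rw [← moebius_mul _ _ hz, inv_mul_cancel, moebius_one]

lemma moebius_moebius_inv (x : SU1 n) {z : Cn n} (hz : ‖z‖ ≤ 1) :
    moebius x (moebius x⁻¹ z) = z := by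
  rw [← moebius_mul _ _ hz, mul_inv_cancel, moebius_one]

lemma den_zero (x : SU1 n) : den x 0 = x.1.1 (Sum.inr ()) (Sum.inr ()) := by simp [den]

/-! ### The stabilizer of the origin -/

/-- The linear isometry of `ℂⁿ` by which `k ∈ U(n)` acts through `embK`: `z ↦ det k • k z`. -/
def rot (k : Matrix.unitaryGroup (Fin n) ℂ) (z : Cn n) : Cn n := moebius (embK k) z

lemma conj_det_mul_det (k : Matrix.unitaryGroup (Fin n) ℂ) : conj k.1.det * k.1.det = 1 :=
  (Unitary.mem_iff.1 (Matrix.det_of_mem_unitary k.2)).1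

lemma norm_det (k : Matrix.unitaryGroup (Fin n) ℂ) : ‖k.1.det‖ = 1 := by
  have h := conj_det_mul_det k
  rw [mul_comm, Complex.mul_conj, Complex.normSq_eq_norm_sq] at h
  have : ‖k.1.det‖ ^ 2 = 1 := by exact_mod_cast h
  exact (pow_eq_one_iff_of_nonneg (norm_nonneg _) two_ne_zero).1 this

lemma den_embK (k : Matrix.unitaryGroup (Fin n) ℂ) (z : Cn n) :
    den (embK k) z = conj k.1.det := by
  simp [den, embK]

lemma rot_apply (k : Matrix.unitaryGroup (Fin n) ℂ) (z : Cn n) :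
    rot k z = k.1.det • WithLp.toLp 2 (k.1 *ᵥ z.ofLp) := by
  ext i
  have h := conj_det_mul_det k
  have h0 : conj k.1.det ≠ 0 := left_ne_zero_of_mul_eq_one h
  simp [rot, moebius, embK, Matrix.mulVec, dotProduct, div_eq_iff h0]
  rw [mul_right_comm, mul_comm k.1.det, h, one_mul]

lemma rot_add (k : Matrix.unitaryGroup (Fin n) ℂ) (z w : Cn n) :
    rot k (z + w) = rot k z + rot k w := by
  simp [rot_apply, Matrix.mulVec_add]

lemma rot_smul (k : Matrix.unitaryGroup (Fin n) ℂ) (c : ℂ) (z : Cn n) :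
    rot k (c • z) = c • rot k z := by
  simp [rot_apply, Matrix.mulVec_smul, smul_comm c]

lemma norm_rot (k : Matrix.unitaryGroup (Fin n) ℂ) (z : Cn n) : ‖rot k z‖ = ‖z‖ := by
  have h : ‖rot k z‖ ^ 2 = ‖z‖ ^ 2 := by
    have h1 := den_mul_conj_sub (embK k) z z
    have h2 := normSq_den_sub (embK k) z
    have h3 : rot k z = (conj k.1.det)⁻¹ • num (embK k) z := by
      rw [rot, moebius_eq, den_embK]
    have h4 : ‖conj k.1.det‖ = 1 := by simp [norm_det]
    rw [h3, norm_smul, norm_inv, h4]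
    rw [den_embK, h4] at h2
    linarith
  exact (sq_eq_sq₀ (norm_nonneg _) (norm_nonneg _)).1 h

/-- `rot k` as a linear isometry. -/
def rotL (k : Matrix.unitaryGroup (Fin n) ℂ) : Cn n →ₗᵢ[ℂ] Cn n where
  toFun := rot k
  map_add' := rot_add k
  map_smul' := rot_smul k
  norm_map' := norm_rot k

lemma inner_rot (k : Matrix.unitaryGroup (Fin n) ℂ) (z w : Cn n) :
    inner ℂ (rot k z) (rot k w) = inner ℂ z w := (rotL k).inner_map_map z w

lemma rot_mul (k l : Matrix.unitaryGroup (Fin n) ℂ) (z : Cn n) :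
    rot (k * l) z = rot k (rot l z) := by
  simp [rot_apply, Matrix.mulVec_smul, smul_smul]

@[simp] lemma rot_one (z : Cn n) : rot 1 z = z := by simp [rot_apply]

@[simp] lemma rot_zero (k : Matrix.unitaryGroup (Fin n) ℂ) : rot k (0 : Cn n) = 0 := by
  simp [rot_apply]

lemma rot_inv_rot (k : Matrix.unitaryGroup (Fin n) ℂ) (z : Cn n) : rot k⁻¹ (rot k z) = z := by
  rw [← rot_mul, inv_mul_cancel, rot_one]

lemma rot_rot_inv (k : Matrix.unitaryGroup (Fin n) ℂ) (z : Cn n) : rot k (rot k⁻¹ z) = z := by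
  rw [← rot_mul, mul_inv_cancel, rot_one]

lemma inner_rot_left (k : Matrix.unitaryGroup (Fin n) ℂ) (z w : Cn n) :
    inner ℂ (rot k z) w = inner ℂ z (rot k⁻¹ w) := by
  rw [← inner_rot k z (rot k⁻¹ w), rot_rot_inv]

lemma continuous_rot : Continuous fun p : Matrix.unitaryGroup (Fin n) ℂ × Cn n => rot p.1 p.2 := by
  simp only [rot_apply]
  have h1 : Continuous fun p : Matrix.unitaryGroup (Fin n) ℂ × Cn n => p.1.1 :=
    continuous_subtype_val.comp continuous_fst
  have h2 : Continuous fun p : Matrix.unitaryGroup (Fin n) ℂ × Cn n => p.2.ofLp :=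
    (PiLp.continuous_ofLp 2 _).comp continuous_snd
  exact h1.matrix_det.smul ((PiLp.continuous_toLp 2 _).comp (h1.matrix_mulVec h2))

/-- Every unitary matrix is of the form `det k • k`. -/
lemma exists_det_smul_eq (u : Matrix.unitaryGroup (Fin n) ℂ) :
    ∃ k : Matrix.unitaryGroup (Fin n) ℂ, k.1.det • k.1 = u.1 := by
  -- With μ^(n+1) = det u, the matrix k = conj μ • u has determinant μ^(-n) μ^(n+1) = μ, so det k •
  -- k = u.
  obtain ⟨μ, hμ⟩ := IsAlgClosed.exists_pow_nat_eq u.1.det (n := n + 1) (Nat.succ_pos n)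
  have hn : ‖μ‖ = 1 := by
    have h := congrArg norm hμ
    rw [norm_pow, norm_det] at h
    exact (pow_eq_one_iff_of_nonneg (norm_nonneg _) n.succ_ne_zero).1 h
  have hμ0 : μ ≠ 0 := by rintro rfl; simp at hn
  have hc : conj μ * μ = 1 := by
    rw [mul_comm, Complex.mul_conj, Complex.normSq_eq_norm_sq, hn]; simp
  have hu := Unitary.mem_iff.1 u.2
  refine ⟨⟨conj μ • u.1, ?_⟩, ?_⟩
  · rw [Matrix.mem_unitaryGroup_iff', star_smul, smul_mul_smul_comm, hu.1]
    simp [mul_comm μ, hc]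
  · have : conj μ = μ⁻¹ := eq_inv_of_mul_eq_one_left hc
    simp only [Matrix.det_smul, Fintype.card_fin, smul_smul]
    rw [← hμ, this]
    rw [pow_succ, ← mul_assoc, inv_pow, inv_mul_cancel₀ (pow_ne_zero _ hμ0), one_mul,
      mul_inv_cancel₀ hμ0, one_smul]

lemma exists_rot_eq_mulVec (u : Matrix.unitaryGroup (Fin n) ℂ) :
    ∃ k : Matrix.unitaryGroup (Fin n) ℂ, ∀ z, rot k z = WithLp.toLp 2 (u.1 *ᵥ z.ofLp) := by
  obtain ⟨k, hk⟩ := exists_det_smul_eq u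
  refine ⟨k, fun z => ?_⟩
  rw [rot_apply, ← hk, Matrix.smul_mulVec]; rfl

/-- `K` contains the scalars of modulus one. -/
lemma exists_rot_eq_smul {c : ℂ} (hc : ‖c‖ = 1) :
    ∃ k : Matrix.unitaryGroup (Fin n) ℂ, ∀ z, rot k z = c • z := by
  obtain ⟨k, hk⟩ := exists_rot_eq_mulVec (n := n) ⟨c • 1, by
    rw [Matrix.mem_unitaryGroup_iff', star_smul, smul_mul_smul_comm]
    have : conj c * c = 1 := by
      rw [mul_comm, Complex.mul_conj, Complex.normSq_eq_norm_sq, hc]; simp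
    simp [this]⟩
  refine ⟨k, fun z => ?_⟩
  rw [hk]; ext i; simp [Matrix.smul_mulVec]

lemma exists_rot_single_eq (i : Fin n) {w : Cn n} (hw : ‖w‖ = 1) :
    ∃ k : Matrix.unitaryGroup (Fin n) ℂ, rot k (EuclideanSpace.single i 1) = w := by
  obtain ⟨b, hb⟩ := Orthonormal.exists_orthonormalBasis_extension_of_card_eq (𝕜 := ℂ)
    (E := Cn n) (ι := Fin n) (by simp) (v := fun _ => w) (s := {i}) (by
      constructor
      · intro j; simpa using hw
      · intro j k hjk; exact absurd (Subsingleton.elim j k) hjk)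
  obtain ⟨k, hk⟩ := exists_rot_eq_mulVec (n := n)
    ⟨(EuclideanSpace.basisFun (Fin n) ℂ).toBasis.toMatrix b,
      (EuclideanSpace.basisFun (Fin n) ℂ).toMatrix_orthonormalBasis_mem_unitary b⟩
  refine ⟨k, ?_⟩
  rw [hk, ← hb i rfl]
  ext j
  simp [Module.Basis.toMatrix_apply]

/-- Transitivity of K on spheres, obtained by sending a fixed basis vector to both directions. It is
the reason why averages over K are radial. -/
lemma exists_rot_eq (hn : 0 < n) {z w : Cn n} (h : ‖z‖ = ‖w‖) :
    ∃ k : Matrix.unitaryGroup (Fin n) ℂ, rot k z = w := by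
  have i : Fin n := ⟨0, hn⟩
  by_cases hz : z = 0
  · subst hz
    refine ⟨1, ?_⟩
    have : w = 0 := by simpa using h.symm
    simp [this]
  have hz' : ‖z‖ ≠ 0 := by simpa using hz
  have key : ∀ v : Cn n, ‖v‖ = ‖z‖ → ∃ k : Matrix.unitaryGroup (Fin n) ℂ,
      rot k (((‖z‖ : ℝ) : ℂ) • EuclideanSpace.single i 1) = v := by
    intro v hv
    have hv1 : ‖((‖z‖ : ℝ) : ℂ)⁻¹ • v‖ = 1 := by
      rw [norm_smul, norm_inv, hv]; simp [hz']
    obtain ⟨k, hk⟩ := exists_rot_single_eq i hv1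
    refine ⟨k, ?_⟩
    rw [rot_smul, hk, smul_smul, mul_inv_cancel₀ (by exact_mod_cast hz'), one_smul]
  obtain ⟨k, hk⟩ := key z rfl
  obtain ⟨l, hl⟩ := key w h.symm
  exact ⟨l * k⁻¹, by rw [rot_mul, ← hk, rot_inv_rot, hl]⟩

end BallQHA
end

noncomputable section
namespace BallQHA

variable {n : ℕ}

/-! ### Transvections along the ball -/

/-- The factor `√(1 - |z|²)`. -/
def del (z : Cn n) : ℝ := Real.sqrt (1 - ‖z‖ ^ 2)

lemma one_sub_normSq_pos {z : Cn n} (hz : ‖z‖ < 1) : 0 < 1 - ‖z‖ ^ 2 := by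
  nlinarith [norm_nonneg z]

lemma del_pos {z : Cn n} (hz : ‖z‖ < 1) : 0 < del z := Real.sqrt_pos.2 (one_sub_normSq_pos hz)

lemma del_nonneg (z : Cn n) : 0 ≤ del z := Real.sqrt_nonneg _

lemma del_sq {z : Cn n} (hz : ‖z‖ < 1) : del z ^ 2 = 1 - ‖z‖ ^ 2 :=
  Real.sq_sqrt (one_sub_normSq_pos hz).le

lemma del_neg (z : Cn n) : del (-z) = del z := by simp [del]

lemma del_le_one (z : Cn n) : del z ≤ 1 := by
  rw [del, Real.sqrt_le_left (by norm_num)]; nlinarith [sq_nonneg ‖z‖]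

lemma continuous_del : Continuous (del : Cn n → ℝ) := by unfold del; fun_prop

/-- The Hermitian matrix `(1 + zz*/(δ(1+δ)), z/δ; z*/δ, 1/δ)` with `δ = √(1-|z|²)`. -/
def boostMat (z : Cn n) : Matrix (Fin n ⊕ Unit) (Fin n ⊕ Unit) ℂ :=
  Matrix.fromBlocks
    (1 + ((del z : ℂ) * (1 + del z))⁻¹ • Matrix.vecMulVec z.ofLp (star z.ofLp))
    (Matrix.replicateCol Unit ((del z : ℂ)⁻¹ • z.ofLp))
    (Matrix.replicateRow Unit ((del z : ℂ)⁻¹ • star z.ofLp))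
    ((del z : ℂ)⁻¹ • 1)

lemma star_dotProduct_self (z : Cn n) : star z.ofLp ⬝ᵥ z.ofLp = ((‖z‖ ^ 2 : ℝ) : ℂ) := by
  rw [← inner_self_eq_ofReal, inner_eq_sum, dotProduct]; simp [mul_comm]

lemma boost_aux {z : Cn n} (hz : ‖z‖ < 1) :
    (del z : ℂ) ≠ 0 ∧ (1 + del z : ℂ) ≠ 0 ∧ star z.ofLp ⬝ᵥ z.ofLp = 1 - (del z : ℂ) ^ 2 := by
  have h := del_pos hz
  refine ⟨by exact_mod_cast h.ne', by exact_mod_cast (by positivity : (1 + del z) ≠ 0), ?_⟩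
  rw [star_dotProduct_self]
  have : ‖z‖ ^ 2 = 1 - del z ^ 2 := by rw [del_sq hz]; ring
  rw [this]; push_cast; ring

/-- The Schur complement of the corner 1/δ is 1 - zz*/(1+δ), whose determinant 1 - (1-δ²)/(1+δ) = δ
cancels the corner. -/
lemma det_boostMat {z : Cn n} (hz : ‖z‖ < 1) : (boostMat z).det = 1 := by
  obtain ⟨h0, h1, h2⟩ := boost_aux hz
  have hinv : ((del z : ℂ)⁻¹ • (1 : Matrix Unit Unit ℂ)) * ((del z : ℂ) • 1) = 1 := by
    rw [smul_mul_smul_comm, inv_mul_cancel₀ h0, one_mul, one_smul]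
  let _ : Invertible ((del z : ℂ)⁻¹ • (1 : Matrix Unit Unit ℂ)) :=
    ⟨(del z : ℂ) • 1, mul_eq_one_comm.1 hinv, hinv⟩
  have hinv' : ⅟((del z : ℂ)⁻¹ • (1 : Matrix Unit Unit ℂ)) = (del z : ℂ) • 1 :=
    invOf_eq_right_inv hinv
  rw [boostMat, Matrix.det_fromBlocks₂₂, hinv']
  have e : (1 + ((del z : ℂ) * (1 + del z))⁻¹ • Matrix.vecMulVec z.ofLp (star z.ofLp)) -
      (Matrix.replicateCol Unit ((del z : ℂ)⁻¹ • z.ofLp)) * ((del z : ℂ) • (1 : Matrix Unit Unit ℂ)) *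
        (Matrix.replicateRow Unit ((del z : ℂ)⁻¹ • star z.ofLp)) =
      1 + Matrix.replicateCol Unit ((-(1 + del z : ℂ)⁻¹) • z.ofLp) *
        Matrix.replicateRow Unit (star z.ofLp) := by
    ext i j
    simp [Matrix.mul_apply, Matrix.vecMulVec_apply]
    field_simp
    ring
  rw [e, Matrix.det_one_add_replicateCol_mul_replicateRow, dotProduct_smul, h2]
  simp
  field_simp
  ring

lemma boostMat_conj {z : Cn n} (hz : ‖z‖ < 1) :
    (boostMat z)ᴴ * formJ n * boostMat z = formJ n := by
  obtain ⟨h0, h1, h2⟩ := boost_aux hz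
  set d : ℂ := (del z : ℂ)⁻¹ with hd
  set c : ℂ := ((del z : ℂ) * (1 + del z))⁻¹ with hc
  set s : ℂ := 1 - (del z : ℂ) ^ 2 with hs
  -- The scalar identities, with s = |z|² = 1 - δ², to which the four blocks reduce.
  have e1 : d * d - d * d * s = 1 := by rw [hd, hs]; field_simp; ring
  have e2 : 1 + c * s = d := by rw [hd, hs, hc]; field_simp; ring
  have e3 : 2 * c + c * c * s = d * d := by rw [hd, hs, hc]; field_simp; ring
  have hdc : conj d = d := by simp [hd]
  have hcc : conj c = c := by simp [hc]
  have hr : (boostMat z)ᴴ = boostMat z := by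
    rw [boostMat, Matrix.fromBlocks_conjTranspose]
    simp [← hc, ← hd, hcc, hdc, Matrix.conjTranspose_vecMulVec]
  have h3 : (Matrix.replicateRow Unit (star z.ofLp) * Matrix.replicateCol Unit z.ofLp) = s • 1 := by
    ext i j; simp [Matrix.mul_apply, ← h2, dotProduct]
  have h4 : Matrix.replicateCol Unit z.ofLp * Matrix.replicateRow Unit (star z.ofLp) =
      Matrix.vecMulVec z.ofLp (star z.ofLp) := by
    ext i j; simp [Matrix.mul_apply, Matrix.vecMulVec_apply]
  have hvv : Matrix.vecMulVec z.ofLp (star z.ofLp) * Matrix.vecMulVec z.ofLp (star z.ofLp) =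
      s • Matrix.vecMulVec z.ofLp (star z.ofLp) := by
    rw [Matrix.vecMulVec_mul_vecMulVec, h2]; simp
  have h5 : Matrix.vecMulVec z.ofLp (star z.ofLp) * Matrix.replicateCol Unit z.ofLp =
      s • Matrix.replicateCol Unit z.ofLp := by
    rw [← h4, Matrix.mul_assoc, h3]; simp
  have h6 : Matrix.replicateRow Unit (star z.ofLp) * Matrix.vecMulVec z.ofLp (star z.ofLp) =
      s • Matrix.replicateRow Unit (star z.ofLp) := by
    rw [← h4, ← Matrix.mul_assoc, h3]; simp
  rw [hr, formJ, boostMat]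
  simp only [← hd, ← hc]
  simp only [Matrix.fromBlocks_multiply, Matrix.mul_neg, Matrix.mul_one, Matrix.mul_zero, add_zero,
    zero_add, Matrix.replicateCol_smul, Matrix.replicateRow_smul, Matrix.mul_add, Matrix.add_mul,
    Matrix.smul_mul, Matrix.mul_smul, Matrix.one_mul, h3, h4, h5, h6, hvv, Matrix.neg_mul,
    smul_smul]
  congr 1
  · linear_combination (norm := module) (-e3) • (Matrix.vecMulVec z.ofLp (star z.ofLp))
  · linear_combination (norm := module) (-d * e2) • (Matrix.replicateCol Unit z.ofLp)
  · linear_combination (norm := module) (-d * e2) • (Matrix.replicateRow Unit (star z.ofLp))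
  · linear_combination (norm := module) e1 • (1 : Matrix Unit Unit ℂ)

open Classical in
/-- The transvection of the ball taking `0` to `z`. -/
def boost (z : Cn n) : SU1 n :=
  if hz : ‖z‖ < 1 then ⟨⟨boostMat z, det_boostMat hz⟩, boostMat_conj hz⟩ else 1

lemma boost_val {z : Cn n} (hz : ‖z‖ < 1) : (boost z).1.1 = boostMat z := by
  rw [boost, dif_pos hz]

lemma den_boost {z : Cn n} (hz : ‖z‖ < 1) (u : Cn n) :
    den (boost z) u = (del z : ℂ)⁻¹ * (1 + inner ℂ z u) := by
  rw [den, boost_val hz, inner_eq_sum, mul_add, Finset.mul_sum]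
  simp [boostMat, mul_comm, mul_left_comm, add_comm]

lemma num_boost {z : Cn n} (hz : ‖z‖ < 1) (u : Cn n) :
    num (boost z) u =
      (del z : ℂ)⁻¹ • ((del z : ℂ) • u + ((1 + del z : ℂ)⁻¹ * inner ℂ z u) • z + z) := by
  obtain ⟨h0, h1, h2⟩ := boost_aux hz
  ext i
  rw [num, boost_val hz, inner_eq_sum]
  simp [boostMat, Matrix.one_apply, Matrix.vecMulVec_apply, add_mul, Finset.sum_add_distrib,
    Finset.mul_sum, Finset.sum_mul]
  field_simp
  congr 1
  exact Finset.sum_congr rfl fun x _ => by ring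

lemma moebius_boost_zero {z : Cn n} (hz : ‖z‖ < 1) : moebius (boost z) 0 = z := by
  obtain ⟨h0, h1, h2⟩ := boost_aux hz
  rw [moebius_eq, den_boost hz, num_boost hz]
  simp [smul_smul, h0]

lemma boost_neg {z : Cn n} (hz : ‖z‖ < 1) : boost (-z) = (boost z)⁻¹ := by
  obtain ⟨h0, h1, h2⟩ := boost_aux hz
  have hz' : ‖-z‖ < 1 := by rwa [norm_neg]
  rw [eq_inv_iff_mul_eq_one]
  apply Subtype.ext
  apply Subtype.ext
  change (boost (-z)).1.1 * (boost z).1.1 = 1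
  rw [boost_val hz', boost_val hz]
  have hJ : formJ n * formJ n = 1 := by simp [formJ, Matrix.fromBlocks_multiply]
  -- The inverse of a matrix preserving J is J x* J; for the Hermitian matrix of a transvection this
  -- only changes the sign of the off-diagonal blocks.
  have e : boostMat (-z) = formJ n * (boostMat z)ᴴ * formJ n := by
    rw [boostMat, boostMat, Matrix.fromBlocks_conjTranspose, formJ]
    simp [del_neg, Matrix.fromBlocks_multiply, Matrix.conjTranspose_vecMulVec]
    constructor <;> (ext i j; simp)
  rw [e, Matrix.mul_assoc, Matrix.mul_assoc, ← Matrix.mul_assoc (boostMat z)ᴴ, boostMat_conj hz, hJ]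

/-- A continuous section of x ↦ x · 0 over the ball: through it, continuity on the group becomes
continuity on the ball. -/
lemma continuousOn_boost : ContinuousOn (boost : Cn n → SU1 n) (unitBall n) := by
  rw [continuousOn_iff_continuous_domRestrict]
  refine Continuous.subtype_mk (f := fun z : unitBall n => (boost z.1).1) ?_ _
  refine Continuous.subtype_mk (f := fun z : unitBall n => (boost z.1).1.1) ?_ _
  have h : (fun z : unitBall n => (boost z.1).1.1) = fun z : unitBall n => boostMat z.1 :=
    funext fun z => boost_val (by simpa [unitBall] using z.2)
  change Continuous fun z : unitBall n => (boost z.1).1.1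
  rw [h]
  have hz : ∀ z : unitBall n, (del z.1 : ℂ) ≠ 0 := fun z =>
    (boost_aux (by simpa [unitBall] using z.2)).1
  have hz' : ∀ z : unitBall n, (1 + del z.1 : ℂ) ≠ 0 := fun z =>
    (boost_aux (by simpa [unitBall] using z.2)).2.1
  have hd : Continuous fun z : unitBall n => (del z.1 : ℂ) :=
    Complex.continuous_ofReal.comp (continuous_del.comp continuous_subtype_val)
  have hd1 : Continuous fun z : unitBall n => (del z.1 : ℂ)⁻¹ := hd.inv₀ hz
  have hd2 : Continuous fun z : unitBall n => ((del z.1 : ℂ) * (1 + del z.1))⁻¹ :=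
    (hd.mul (continuous_const.add hd)).inv₀ fun z => mul_ne_zero (hz z) (hz' z)
  refine Continuous.matrix_fromBlocks ?_ ?_ ?_ ?_
  · refine continuous_const.add (hd2.smul ?_)
    refine Continuous.matrix_vecMulVec ?_ ?_ <;> fun_prop
  · refine Continuous.matrix_replicateCol (hd1.smul ?_)
    fun_prop
  · refine Continuous.matrix_replicateRow (hd1.smul ?_)
    fun_prop
  · exact hd1.smul continuous_const

end BallQHA
end

noncomputable section
namespace BallQHA

variable {n : ℕ}

/-! ### The Jacobian of the action and the change of variables formula -/

/-- The linear part `A` of the numerator. -/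
def numLin (x : SU1 n) : Cn n →L[ℂ] Cn n :=
  (Matrix.toLpLin 2 2 (Matrix.of fun i j : Fin n => x.1.1 (Sum.inl i) (Sum.inl j))).toContinuousLinearMap

/-- The linear part `v` of the denominator. -/
def denLin (x : SU1 n) : Cn n →L[ℂ] ℂ :=
  LinearMap.toContinuousLinearMap
    ((dotProductBilin ℂ ℂ fun j => x.1.1 (Sum.inr ()) (Sum.inl j)) ∘ₗ
      (WithLp.linearEquiv 2 ℂ (Fin n → ℂ)).toLinearMap)

lemma num_eq_add (x : SU1 n) (z : Cn n) : num x z = numLin x z + num x 0 := by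
  ext i
  simp [num, numLin, Matrix.mulVec, dotProduct]

lemma denLin_apply (x : SU1 n) (z : Cn n) :
    denLin x z = ∑ j, x.1.1 (Sum.inr ()) (Sum.inl j) * z j := by
  simp [denLin, dotProduct]

lemma den_eq_add (x : SU1 n) (z : Cn n) : den x z = denLin x z + den x 0 := by
  simp [den, denLin_apply]

lemma hasFDerivAt_num (x : SU1 n) (z : Cn n) : HasFDerivAt (num x) (numLin x) z := by
  have : num x = fun z => numLin x z + num x 0 := funext (num_eq_add x)
  rw [this]
  exact (numLin x).hasFDerivAt.add_const _

lemma hasFDerivAt_den (x : SU1 n) (z : Cn n) : HasFDerivAt (den x) (denLin x) z := by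
  have : den x = fun z => denLin x z + den x 0 := funext (den_eq_add x)
  rw [this]
  exact (denLin x).hasFDerivAt.add_const _

/-- The complex derivative of the action. -/
def moebiusDeriv (x : SU1 n) (z : Cn n) : Cn n →L[ℂ] Cn n :=
  (den x z)⁻¹ • (numLin x - (denLin x).smulRight (moebius x z))

lemma hasFDerivAt_moebius (x : SU1 n) {z : Cn n} (hz : ‖z‖ ≤ 1) :
    HasFDerivAt (moebius x) (moebiusDeriv x z) z := by
  have h0 := den_ne_zero x hz
  have : moebius x = fun z => (den x z)⁻¹ • num x z := funext (moebius_eq x)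
  rw [this]
  have key := ((hasDerivAt_inv h0).comp_hasFDerivAt z (hasFDerivAt_den x z)).smul
    (hasFDerivAt_num x z)
  refine key.congr_fderiv (ContinuousLinearMap.ext fun h => ?_)
  ext i
  simp [moebiusDeriv, moebius_eq]
  field_simp
  ring

/-- Multiplying x by a unipotent matrix replaces its last column by (num x z, den x z) without
changing the determinant 1. The Schur complement of the corner den x z is, up to the scalar 1/den,
the derivative. The corner contributes one power of 1/den and the scalar n more. -/
lemma det_moebiusDeriv (x : SU1 n) {z : Cn n} (hz : ‖z‖ ≤ 1) :
    LinearMap.det (moebiusDeriv x z : Cn n →ₗ[ℂ] Cn n) = ((den x z) ^ (n + 1))⁻¹ := by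
  have h0 := den_ne_zero x hz
  set A : Matrix (Fin n) (Fin n) ℂ := Matrix.of fun i j => x.1.1 (Sum.inl i) (Sum.inl j) with hA
  set v : Fin n → ℂ := fun j => x.1.1 (Sum.inr ()) (Sum.inl j) with hv
  set d : ℂ := x.1.1 (Sum.inr ()) (Sum.inr ()) with hd
  set β : Fin n → ℂ := fun i => x.1.1 (Sum.inl i) (Sum.inr ()) with hβ
  have hx : x.1.1 = Matrix.fromBlocks A (Matrix.replicateCol Unit β) (Matrix.replicateRow Unit v)
      (Matrix.of fun _ _ => d) := by
    ext i j
    rcases i with i | i <;> rcases j with j | j <;> simp [hA, hv, hd, hβ]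
  have hprod : x.1.1 * Matrix.fromBlocks 1 (Matrix.replicateCol Unit z.ofLp) 0 1 =
      Matrix.fromBlocks A (Matrix.replicateCol Unit (num x z).ofLp) (Matrix.replicateRow Unit v)
        (den x z • 1) := by
    rw [hx, Matrix.fromBlocks_multiply]
    congr 1
    · simp
    · ext i j; simp [Matrix.mul_apply, num, hA, hβ]
    · simp
    · ext i j; simp [Matrix.mul_apply, den, hv, hd]
  have hdet : (Matrix.fromBlocks A (Matrix.replicateCol Unit (num x z).ofLp)
      (Matrix.replicateRow Unit v) (den x z • 1)).det = 1 := by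
    rw [← hprod, Matrix.det_mul, Matrix.det_fromBlocks_zero₂₁, x.1.2]; simp
  have hinv : (den x z • (1 : Matrix Unit Unit ℂ)) * ((den x z)⁻¹ • 1) = 1 := by
    rw [smul_mul_smul_comm, mul_inv_cancel₀ h0, one_mul, one_smul]
  let _ : Invertible (den x z • (1 : Matrix Unit Unit ℂ)) :=
    ⟨(den x z)⁻¹ • 1, mul_eq_one_comm.1 hinv, hinv⟩
  have hinv' : ⅟(den x z • (1 : Matrix Unit Unit ℂ)) = (den x z)⁻¹ • 1 :=
    invOf_eq_right_inv hinv
  rw [Matrix.det_fromBlocks₂₂, hinv'] at hdet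
  have hM : LinearMap.toMatrix (EuclideanSpace.basisFun (Fin n) ℂ).toBasis
      (EuclideanSpace.basisFun (Fin n) ℂ).toBasis (moebiusDeriv x z : Cn n →ₗ[ℂ] Cn n) =
      (den x z)⁻¹ • (A - (Matrix.replicateCol Unit (num x z).ofLp) *
        ((den x z)⁻¹ • (1 : Matrix Unit Unit ℂ)) * (Matrix.replicateRow Unit v)) := by
    ext i j
    simp [LinearMap.toMatrix_apply, moebiusDeriv, numLin, denLin_apply, Matrix.mul_apply,
      moebius_eq, hA, hv]
    ring_nf
    simp
  rw [← LinearMap.det_toMatrix (EuclideanSpace.basisFun (Fin n) ℂ).toBasis, hM, Matrix.det_smul]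
  simp only [Matrix.det_smul, Fintype.card_fin, Fintype.card_unit, pow_one, Matrix.det_one,
    mul_one] at hdet ⊢
  rw [eq_inv_of_mul_eq_one_right hdet, pow_succ, mul_inv, inv_pow]

lemma abs_det_moebiusDeriv (x : SU1 n) {z : Cn n} (hz : ‖z‖ ≤ 1) :
    |((moebiusDeriv x z).restrictScalars ℝ).det| = (‖den x z‖ ^ (2 * (n + 1)))⁻¹ := by
  have h : ((moebiusDeriv x z).restrictScalars ℝ).det =
      LinearMap.det ((moebiusDeriv x z : Cn n →ₗ[ℂ] Cn n).restrictScalars ℝ) := rfl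
  rw [h, LinearMap.det_restrictScalars, det_moebiusDeriv x hz, Algebra.norm_complex_apply,
    Complex.normSq_eq_norm_sq, abs_of_nonneg (by positivity), norm_inv, norm_pow, inv_pow,
    ← pow_mul, mul_comm]

lemma mem_unitBall {z : Cn n} : z ∈ unitBall n ↔ ‖z‖ < 1 := by simp [unitBall]

lemma isOpen_unitBall : IsOpen (unitBall n) := Metric.isOpen_ball

lemma measurableSet_unitBall : MeasurableSet (unitBall n) := isOpen_unitBall.measurableSet

lemma moebius_image_unitBall (x : SU1 n) : moebius x '' unitBall n = unitBall n := by
  ext z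
  simp only [mem_image, mem_unitBall]
  constructor
  · rintro ⟨w, hw, rfl⟩; exact norm_moebius_lt_one x hw
  · exact fun hz => ⟨moebius x⁻¹ z, norm_moebius_lt_one _ hz, moebius_moebius_inv x hz.le⟩

lemma injOn_moebius (x : SU1 n) : InjOn (moebius x) (unitBall n) := by
  intro z hz w hw h
  rw [← moebius_inv_moebius x (mem_unitBall.1 hz).le, h, moebius_inv_moebius x (mem_unitBall.1 hw).le]

lemma continuousOn_moebius (x : SU1 n) : ContinuousOn (moebius x) (unitBall n) := fun _ hz =>
  (hasFDerivAt_moebius x (mem_unitBall.1 hz).le).continuousAt.continuousWithinAt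

/-- The density of `bergmanMeasure` with respect to Lebesgue measure on the ball. -/
def dens (n : ℕ) (ν : ℝ) (z : Cn n) : ℝ := cConst n ν * (1 - ‖z‖ ^ 2) ^ (ν - (n + 1))

lemma cConst_pos {ν : ℝ} (hν : (n : ℝ) < ν) : 0 < cConst n ν := by
  have h1 : 0 < Real.Gamma ν := Real.Gamma_pos_of_pos (by have := Nat.cast_nonneg (α := ℝ) n; linarith)
  have h2 : 0 < Real.Gamma (ν - n) := Real.Gamma_pos_of_pos (by linarith)
  unfold cConst
  positivity

lemma measurable_dens (ν : ℝ) : Measurable (dens n ν) := by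
  unfold dens
  fun_prop

lemma integral_bergmanMeasure {E : Type*} [NormedAddCommGroup E] [NormedSpace ℝ E] {ν : ℝ}
    (hν : (n : ℝ) < ν) (F : Cn n → E) :
    ∫ z, F z ∂(bergmanMeasure n ν) =
      (volume (unitBall n)).toReal⁻¹ • ∫ z in unitBall n, dens n ν z • F z := by
  have h1 : bergmanMeasure n ν = (lebBall n).withDensity fun z => ENNReal.ofReal (dens n ν z) := rfl
  rw [h1, integral_withDensity_eq_integral_toReal_smul₀
    (measurable_dens ν).ennreal_ofReal.aemeasurable (by simp), lebBall, integral_smul_measure,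
    ENNReal.toReal_inv]
  congr 1
  refine setIntegral_congr_fun measurableSet_unitBall fun z hz => ?_
  have := one_sub_normSq_pos (mem_unitBall.1 hz)
  have hc := cConst_pos hν
  rw [ENNReal.toReal_ofReal]
  unfold dens; positivity

lemma dens_nonneg {ν : ℝ} (hν : (n : ℝ) < ν) {z : Cn n} (hz : z ∈ unitBall n) :
    0 ≤ dens n ν z := by
  have := one_sub_normSq_pos (mem_unitBall.1 hz)
  have hc := cConst_pos hν
  unfold dens; positivity

lemma volume_unitBall_ne_zero : volume (unitBall n) ≠ 0 :=
  (Metric.measure_ball_pos volume (0 : Cn n) one_pos).ne'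

lemma volume_unitBall_ne_top : volume (unitBall n) ≠ ⊤ := measure_ball_lt_top.ne

lemma integrable_bergmanMeasure_iff {E : Type*} [NormedAddCommGroup E] [NormedSpace ℝ E] {ν : ℝ}
    (hν : (n : ℝ) < ν) (F : Cn n → E) :
    Integrable F (bergmanMeasure n ν) ↔ IntegrableOn (fun z => dens n ν z • F z) (unitBall n) := by
  have h1 : bergmanMeasure n ν = (lebBall n).withDensity fun z => ENNReal.ofReal (dens n ν z) := rfl
  rw [h1, integrable_withDensity_iff_integrable_smul₀'
    (measurable_dens ν).ennreal_ofReal.aemeasurable (by simp), lebBall, integrable_smul_measure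
    (ENNReal.inv_ne_zero.2 volume_unitBall_ne_top) (ENNReal.inv_ne_top.2 volume_unitBall_ne_zero)]
  refine integrableOn_congr_fun (fun z hz => ?_) measurableSet_unitBall
  rw [ENNReal.toReal_ofReal (dens_nonneg hν hz)]

/-- The weight contributes the exponent -2(ν-n-1) of |den| and the real Jacobian, being the squared
modulus of the complex one, contributes -2(n+1); together they give -2ν. -/
lemma abs_det_smul_dens {E : Type*} [NormedAddCommGroup E] [NormedSpace ℝ E] {ν : ℝ}
    (x : SU1 n) {z : Cn n} (hz : z ∈ unitBall n) (e : E) :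
    |((moebiusDeriv x z).restrictScalars ℝ).det| • dens n ν (moebius x z) • e =
      dens n ν z • ‖den x z‖ ^ (-(2 * ν)) • e := by
  have hz' := mem_unitBall.1 hz
  have h0 : 0 < ‖den x z‖ := norm_pos_iff.2 (den_ne_zero x hz'.le)
  have h1 := one_sub_normSq_pos hz'
  simp only [smul_smul]
  congr 1
  rw [abs_det_moebiusDeriv x hz'.le, dens, dens, one_sub_normSq_moebius x hz'.le,
    Real.div_rpow h1.le (by positivity), ← Real.rpow_natCast (‖den x z‖) 2, ← Real.rpow_mul h0.le,
    ← Real.rpow_natCast (‖den x z‖) (2 * (n + 1)), ← Real.rpow_neg h0.le, div_eq_mul_inv,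
    ← Real.rpow_neg h0.le]
  have : ‖den x z‖ ^ (-(2 * ν)) =
      ‖den x z‖ ^ (-((2 : ℕ) * (ν - (n + 1))) : ℝ) * ‖den x z‖ ^ (-((2 * (n + 1) : ℕ) : ℝ)) := by
    rw [← Real.rpow_add h0]; congr 1; push_cast; ring
  rw [this]; ring

/-- The change of variables `w = x · z` in integrals over the ball. -/
lemma integral_comp_moebius {E : Type*} [NormedAddCommGroup E] [NormedSpace ℝ E] {ν : ℝ}
    (hν : (n : ℝ) < ν) (x : SU1 n) (F : Cn n → E) :
    ∫ z, (‖den x z‖ ^ (-(2 * ν))) • F (moebius x z) ∂(bergmanMeasure n ν) =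
      ∫ z, F z ∂(bergmanMeasure n ν) := by
  rw [integral_bergmanMeasure hν, integral_bergmanMeasure hν]
  congr 1
  have h := integral_image_eq_integral_abs_det_fderiv_smul volume (measurableSet_unitBall (n := n))
    (fun z hz => ((hasFDerivAt_moebius x (mem_unitBall.1 hz).le).restrictScalars
      ℝ).hasFDerivWithinAt) (injOn_moebius x) (fun z => dens n ν z • F z)
  rw [moebius_image_unitBall] at h
  rw [h]
  exact setIntegral_congr_fun measurableSet_unitBall fun z hz => (abs_det_smul_dens x hz _).symm

lemma integrable_comp_moebius_iff {E : Type*} [NormedAddCommGroup E] [NormedSpace ℝ E] {ν : ℝ}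
    (hν : (n : ℝ) < ν) (x : SU1 n) (F : Cn n → E) :
    Integrable (fun z => (‖den x z‖ ^ (-(2 * ν))) • F (moebius x z)) (bergmanMeasure n ν) ↔
      Integrable F (bergmanMeasure n ν) := by
  rw [integrable_bergmanMeasure_iff hν, integrable_bergmanMeasure_iff hν]
  have h := integrableOn_image_iff_integrableOn_abs_det_fderiv_smul volume
    (measurableSet_unitBall (n := n))
    (fun z hz => ((hasFDerivAt_moebius x (mem_unitBall.1 hz).le).restrictScalars
      ℝ).hasFDerivWithinAt) (injOn_moebius x) (fun z => dens n ν z • F z)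
  rw [moebius_image_unitBall] at h
  rw [h]
  exact integrableOn_congr_fun (fun z hz => (abs_det_smul_dens x hz _).symm) measurableSet_unitBall

end BallQHA
end

noncomputable section
namespace BallQHA

variable {n : ℕ}

/-! ### Haar measure on `U(n)` -/

instance instSecondCountableTopologyU : SecondCountableTopology (Matrix.unitaryGroup (Fin n) ℂ) :=
  haveI : SecondCountableTopology (Matrix (Fin n) (Fin n) ℂ) :=
    inferInstanceAs (SecondCountableTopology (Fin n → Fin n → ℂ))
  TopologicalSpace.Subtype.secondCountableTopology _

instance instIsHaarMeasureHaarU : (haarU n).IsHaarMeasure := by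
  unfold haarU; infer_instance

instance instIsProbabilityMeasureHaarU : IsProbabilityMeasure (haarU n) := by
  refine ⟨?_⟩
  simpa [haarU] using Measure.haarMeasure_self
    (K₀ := (⊤ : TopologicalSpace.PositiveCompacts (Matrix.unitaryGroup (Fin n) ℂ)))

/-- A right translate of the Haar probability measure is again a Haar probability measure, hence the
same by uniqueness. -/
instance instIsMulRightInvariantHaarU : (haarU n).IsMulRightInvariant := by
  refine ⟨fun g => ?_⟩
  have h1 : AEMeasurable (fun x => x * g) (haarU n) := (continuous_mul_const g).measurable.aemeasurable
  have : IsProbabilityMeasure ((haarU n).map (· * g)) := Measure.isProbabilityMeasure_map h1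
  have : ((haarU n).map (· * g)).IsHaarMeasure := by
    infer_instance
  exact Measure.isHaarMeasure_eq_of_isProbabilityMeasure _ _

lemma integral_rot_congr (hn : 0 < n) {E : Type*} [NormedAddCommGroup E] [NormedSpace ℝ E]
    (f : Cn n → E) {z w : Cn n} (h : ‖z‖ = ‖w‖) :
    ∫ k, f (rot k z) ∂(haarU n) = ∫ k, f (rot k w) ∂(haarU n) := by
  obtain ⟨l, rfl⟩ := exists_rot_eq hn h
  simp only [← rot_mul]
  exact (integral_mul_right_eq_self (fun k => f (rot k z)) l).symm

/-! ### The weighted measure on the ball -/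

lemma integral_comp_rot {E : Type*} [NormedAddCommGroup E] [NormedSpace ℝ E] {ν : ℝ}
    (hν : (n : ℝ) < ν) (k : Matrix.unitaryGroup (Fin n) ℂ) (F : Cn n → E) :
    ∫ z, F (rot k z) ∂(bergmanMeasure n ν) = ∫ z, F z ∂(bergmanMeasure n ν) := by
  rw [← integral_comp_moebius hν (embK k) F]
  simp [den_embK, norm_det, rot]

lemma integrable_comp_rot_iff {E : Type*} [NormedAddCommGroup E] [NormedSpace ℝ E] {ν : ℝ}
    (hν : (n : ℝ) < ν) (k : Matrix.unitaryGroup (Fin n) ℂ) (F : Cn n → E) :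
    Integrable (fun z => F (rot k z)) (bergmanMeasure n ν) ↔ Integrable F (bergmanMeasure n ν) := by
  rw [← integrable_comp_moebius_iff hν (embK k) F]
  simp [den_embK, norm_det, rot]

/-- The product of h_ν with the invariant density is the density of μ_ν. From here on the spherical
transform is simply the mean of φ. -/
lemma hHat_eq_integral {ν : ℝ} (hν : (n : ℝ) < ν) (φ : Cn n → ℂ) :
    hHat n ν φ = ∫ z, φ z ∂(bergmanMeasure n ν) := by
  have hm : Measurable fun z : Cn n => cConst n ν * (1 - ‖z‖ ^ 2) ^ (-((n : ℝ) + 1)) := by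
    fun_prop
  rw [hHat, invMeasure, integral_bergmanMeasure hν, integral_withDensity_eq_integral_toReal_smul₀
    hm.ennreal_ofReal.aemeasurable (by simp), lebBall, integral_smul_measure,
    ENNReal.toReal_inv]
  congr 1
  refine setIntegral_congr_fun measurableSet_unitBall fun z hz => ?_
  have h1 := one_sub_normSq_pos (mem_unitBall.1 hz)
  have hc := cConst_pos hν
  rw [ENNReal.toReal_ofReal (by positivity), dens, hFun, Complex.real_smul, Complex.real_smul,
    ← mul_assoc, ← Complex.ofReal_mul, mul_assoc, ← Real.rpow_add h1]
  congr 4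
  ring

/-- The Beta integral after the substitution x = y², taken from the fact that the Beta density has
mass one. -/
lemma integral_Ioi_rpow_mul {a b : ℝ} (ha : 0 < a) (hb : 0 < b) :
    ∫ y in Ioi (0 : ℝ), y ^ (2 * a - 1) * (if y < 1 then (1 - y ^ 2) ^ (b - 1) else 0) =
      ProbabilityTheory.beta a b / 2 := by
  have hB := ProbabilityTheory.beta_pos ha hb
  have h1 : ∫ x in Ioi (0 : ℝ), ProbabilityTheory.betaPDFReal a b x = 1 := by
    have h2 : ∫ x, ProbabilityTheory.betaPDFReal a b x = 1 := by
      rw [integral_eq_lintegral_of_nonneg_ae]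
      · have := ProbabilityTheory.lintegral_betaPDF_eq_one ha hb
        simp only [ProbabilityTheory.betaPDF] at this
        rw [this]; simp
      · refine Filter.Eventually.of_forall fun x => ?_
        simp only [ProbabilityTheory.betaPDFReal, Pi.zero_apply]
        split_ifs with hx
        · have := hx.1
          have : 0 < 1 - x := by linarith [hx.2]
          positivity
        · exact le_rfl
      · exact (ProbabilityTheory.measurable_betaPDFReal a b).aestronglyMeasurable
    rw [← h2, setIntegral_eq_integral_of_forall_compl_eq_zero]
    intro x hx
    simp only [ProbabilityTheory.betaPDFReal]
    rw [if_neg]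
    exact fun h => hx h.1
  rw [← integral_comp_rpow_Ioi_of_pos (p := 2) two_pos] at h1
  have h3 : ∀ y ∈ Ioi (0 : ℝ), (2 * y ^ ((2 : ℝ) - 1)) •
      ProbabilityTheory.betaPDFReal a b (y ^ (2 : ℝ)) = (2 / ProbabilityTheory.beta a b) *
        (y ^ (2 * a - 1) * (if y < 1 then (1 - y ^ 2) ^ (b - 1) else 0)) := by
    intro y hy
    have hy0 : 0 < y := hy
    rw [ProbabilityTheory.betaPDFReal]
    have e : y ^ (2 : ℝ) = y ^ 2 := by norm_cast
    by_cases h : y < 1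
    · have h4 : y ^ (2 : ℝ) < 1 := by rw [e]; nlinarith
      rw [if_pos ⟨by positivity, h4⟩, if_pos h, ← Real.rpow_mul hy0.le, e]
      have : y ^ (2 * a - 1) = y ^ ((2 : ℝ) - 1) * y ^ (2 * (a - 1)) := by
        rw [← Real.rpow_add hy0]; congr 1; ring
      rw [this, smul_eq_mul]; ring
    · have h4 : ¬ (y ^ (2 : ℝ) < 1) := by rw [e]; nlinarith
      rw [if_neg fun h' => h4 h'.2, if_neg h]; simp
  rw [setIntegral_congr_fun measurableSet_Ioi h3, integral_const_mul] at h1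
  field_simp at h1
  linarith

lemma volume_unitBall_toReal_pos : 0 < (volume (unitBall n)).toReal :=
  ENNReal.toReal_pos (Metric.measure_ball_pos _ _ one_pos).ne' measure_ball_lt_top.ne

lemma integral_dens (hn : 0 < n) {ν : ℝ} (hν : (n : ℝ) < ν) :
    ∫ z in unitBall n, dens n ν z = (volume (unitBall n)).toReal := by
  have : Nonempty (Fin n) := ⟨⟨0, hn⟩⟩
  have hn' : (0 : ℝ) < n := by exact_mod_cast hn
  have h := integral_fun_norm_addHaar (volume : Measure (Cn n))
    (fun r : ℝ => cConst n ν * (if r < 1 then (1 - r ^ 2) ^ ((ν - n) - 1) else 0))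
  have h1 : ∫ z in unitBall n, dens n ν z = ∫ z : Cn n,
      cConst n ν * (if ‖z‖ < 1 then (1 - ‖z‖ ^ 2) ^ ((ν - n) - 1) else 0) := by
    rw [← integral_indicator measurableSet_unitBall]
    congr 1
    funext z
    by_cases hz : ‖z‖ < 1
    · rw [indicator_of_mem (mem_unitBall.2 hz), if_pos hz, dens]
      congr 2; ring
    · rw [indicator_of_notMem (fun h => hz (mem_unitBall.1 h)), if_neg hz, mul_zero]
  rw [h1, h]
  have hf : Module.finrank ℝ (Cn n) = 2 * n := by
    rw [finrank_real_of_complex]; simp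
  have h2 := integral_Ioi_rpow_mul hn' (sub_pos.2 hν)
  have h3 : ∫ y in Ioi (0 : ℝ), y ^ (Module.finrank ℝ (Cn n) - 1) •
      (cConst n ν * (if y < 1 then (1 - y ^ 2) ^ ((ν - n) - 1) else 0)) =
      cConst n ν * (ProbabilityTheory.beta n (ν - n) / 2) := by
    rw [← h2, ← integral_const_mul]
    refine setIntegral_congr_fun measurableSet_Ioi fun y hy => ?_
    -- The exponent 2n - 1 is a truncated subtraction of naturals, so positivity of n matters here.
    have e : y ^ (Module.finrank ℝ (Cn n) - 1) = y ^ (2 * (n : ℝ) - 1) := by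
      rw [← Real.rpow_natCast, hf, Nat.cast_sub (by omega)]; simp
    simp only [smul_eq_mul]
    rw [e]; ring
  rw [h3, hf]
  have h4 : cConst n ν * (ProbabilityTheory.beta n (ν - n) / 2) * (2 * n) = 1 := by
    have g1 : Real.Gamma ν ≠ 0 := (Real.Gamma_pos_of_pos (by linarith)).ne'
    have g2 : Real.Gamma (ν - n) ≠ 0 := (Real.Gamma_pos_of_pos (by linarith)).ne'
    have g3 : (n.factorial : ℝ) = n * Real.Gamma n := by
      rw [← Real.Gamma_nat_eq_factorial, Real.Gamma_add_one hn'.ne']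
    have g4 : (n.factorial : ℝ) ≠ 0 := by positivity
    rw [cConst, ProbabilityTheory.beta]
    rw [add_sub_cancel]
    field_simp
    rw [g3]
  simp only [nsmul_eq_mul, smul_eq_mul]
  push_cast
  change _ * ((volume (unitBall n)).toReal * _) = _
  linear_combination (volume (unitBall n)).toReal * h4

lemma isProbabilityMeasure_bergmanMeasure (hn : 0 < n) {ν : ℝ} (hν : (n : ℝ) < ν) :
    IsProbabilityMeasure (bergmanMeasure n ν) := by
  have h0 := volume_unitBall_toReal_pos (n := n)
  have h := integral_bergmanMeasure hν (fun _ : Cn n => (1 : ℝ))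
  simp only [smul_eq_mul, mul_one, integral_dens hn hν, inv_mul_cancel₀ h0.ne'] at h
  rw [integral_const, smul_eq_mul, mul_one] at h
  refine ⟨?_⟩
  rw [← ENNReal.toReal_eq_one_iff]
  exact h

lemma ae_mem_unitBall (ν : ℝ) : ∀ᵐ z ∂(bergmanMeasure n ν), z ∈ unitBall n := by
  have h1 : bergmanMeasure n ν ≪ lebBall n := withDensity_absolutelyContinuous _ _
  have h2 : lebBall n ≪ volume.restrict (unitBall n) := Measure.smul_absolutelyContinuous
  exact (h1.trans h2).ae_le (ae_restrict_mem measurableSet_unitBall)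

lemma bergmanMeasure_absolutelyContinuous (ν : ℝ) :
    bergmanMeasure n ν ≪ volume.restrict (unitBall n) :=
  (withDensity_absolutelyContinuous _ _).trans Measure.smul_absolutelyContinuous

lemma aestronglyMeasurable_of_continuousOn {E : Type*} [NormedAddCommGroup E] {ν : ℝ}
    {f : Cn n → E} (hf : ContinuousOn f (unitBall n)) :
    AEStronglyMeasurable f (bergmanMeasure n ν) :=
  (hf.aestronglyMeasurable measurableSet_unitBall).mono_ac (bergmanMeasure_absolutelyContinuous ν)

/-- Every nonempty open subset of the ball has positive measure. -/
lemma bergmanMeasure_pos {ν : ℝ} (hν : (n : ℝ) < ν) {U : Set (Cn n)} (hU : IsOpen U)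
    (hne : (U ∩ unitBall n).Nonempty) : bergmanMeasure n ν U ≠ 0 := by
  intro h
  have h1 : bergmanMeasure n ν = (lebBall n).withDensity fun z => ENNReal.ofReal (dens n ν z) := rfl
  rw [h1, withDensity_apply_eq_zero (measurable_dens ν).ennreal_ofReal, lebBall,
    Measure.smul_apply, smul_eq_mul, mul_eq_zero, ENNReal.inv_eq_zero] at h
  have h2 := h.resolve_left measure_ball_lt_top.ne
  rw [Measure.restrict_apply' measurableSet_unitBall] at h2
  refine ((hU.inter isOpen_unitBall).measure_pos volume hne).ne' (measure_mono_null ?_ h2)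
  rintro z ⟨hz, hzb⟩
  refine ⟨⟨?_, hz⟩, hzb⟩
  have := one_sub_normSq_pos (mem_unitBall.1 hzb)
  have := cConst_pos hν
  simp only [mem_ofPred_eq, ne_eq, ENNReal.ofReal_eq_zero, not_le]
  unfold dens; positivity

end BallQHA
end

noncomputable section
namespace BallQHA

variable {n : ℕ}

/-! ### Powers of numbers in the right half plane -/

/-- Arguments in the right half plane lie strictly between -π/2 and π/2, so their sum stays in the
principal range. -/
lemma mul_cpow_of_re_pos {a b : ℂ} (ha : 0 < a.re) (hb : 0 < b.re) (s : ℂ) :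
    (a * b) ^ s = a ^ s * b ^ s := by
  have ha0 : a ≠ 0 := by rintro rfl; simp at ha
  have hb0 : b ≠ 0 := by rintro rfl; simp at hb
  have h1 := abs_lt.1 (Complex.abs_arg_lt_pi_div_two_iff.2 (Or.inl ha))
  have h2 := abs_lt.1 (Complex.abs_arg_lt_pi_div_two_iff.2 (Or.inl hb))
  rw [Complex.cpow_def_of_ne_zero (mul_ne_zero ha0 hb0), Complex.cpow_def_of_ne_zero ha0,
    Complex.cpow_def_of_ne_zero hb0, ← Complex.exp_add,
    Complex.log_mul ha0 hb0 ⟨by linarith [h1.1, h2.1], by linarith [h1.2, h2.2]⟩, add_mul]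

lemma arg_ne_pi_of_re_pos {a : ℂ} (ha : 0 < a.re) : a.arg ≠ Real.pi := by
  have h1 := abs_lt.1 (Complex.abs_arg_lt_pi_div_two_iff.2 (Or.inl ha))
  have := Real.pi_pos
  linarith [h1.2]

lemma conj_cpow_ofReal {a : ℂ} (ha : 0 < a.re) (s : ℝ) :
    conj (a ^ (s : ℂ)) = (conj a) ^ (s : ℂ) := by
  rw [Complex.conj_cpow _ _ (arg_ne_pi_of_re_pos ha)]; simp

lemma cpow_mul_conj_cpow {a : ℂ} (s : ℝ) :
    a ^ (s : ℂ) * conj (a ^ (s : ℂ)) = ((‖a‖ ^ (2 * s) : ℝ) : ℂ) := by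
  rw [Complex.mul_conj, Complex.normSq_eq_norm_sq, Complex.norm_cpow_real,
    ← Real.rpow_natCast, ← Real.rpow_mul (norm_nonneg _), mul_comm]
  simp

/-! ### The reproducing kernel -/

lemma bergmanKernel_eq (ν : ℝ) (z w : Cn n) :
    bergmanKernel n ν z w = (1 - inner ℂ w z) ^ (((-ν : ℝ)) : ℂ) := by
  rw [bergmanKernel, inner_eq_sum]; simp

lemma one_sub_norm_le_re {z w : Cn n} (hw : ‖w‖ ≤ 1) : 1 - ‖z‖ ≤ (1 - inner ℂ w z : ℂ).re := by
  have h1 : ‖(inner ℂ w z : ℂ)‖ ≤ ‖z‖ :=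
    (norm_inner_le_norm w z).trans (mul_le_of_le_one_left (norm_nonneg _) hw)
  have h2 := Complex.re_le_norm (inner ℂ w z : ℂ)
  simp only [Complex.sub_re, Complex.one_re]
  linarith

lemma re_one_sub_inner_pos {z w : Cn n} (hz : ‖z‖ < 1) (hw : ‖w‖ ≤ 1) :
    0 < (1 - inner ℂ w z : ℂ).re := by
  linarith [one_sub_norm_le_re (z := z) hw]

lemma re_one_add_inner_pos {z w : Cn n} (hz : ‖z‖ < 1) (hw : ‖w‖ ≤ 1) :
    0 < (1 + inner ℂ w z : ℂ).re := by
  have := re_one_sub_inner_pos (z := -z) (w := w) (by rwa [norm_neg]) hw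
  simpa using this

lemma re_one_sub_inner_pos' {z w : Cn n} (hz : ‖z‖ ≤ 1) (hw : ‖w‖ < 1) :
    0 < (1 - inner ℂ w z : ℂ).re := by
  have := re_one_sub_inner_pos hw hz
  rw [← inner_conj_symm] at this
  simpa only [Complex.sub_re, Complex.one_re, Complex.conj_re] using this

lemma norm_bergmanKernel (ν : ℝ) (z w : Cn n) :
    ‖bergmanKernel n ν z w‖ = ‖1 - inner ℂ w z‖ ^ (-ν) := by
  rw [bergmanKernel_eq, Complex.norm_cpow_real]

lemma rpow_neg_norm_le {ν r : ℝ} (hν : 0 ≤ ν) (hr : r < 1) {z w : Cn n} (hz : ‖z‖ ≤ r)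
    (hw : ‖w‖ ≤ 1) : ‖(1 - inner ℂ w z : ℂ)‖ ^ (-ν) ≤ (1 - r) ^ (-ν) := by
  have h1 : 1 - r ≤ ‖(1 - inner ℂ w z : ℂ)‖ :=
    ((by linarith : 1 - r ≤ 1 - ‖z‖).trans (one_sub_norm_le_re hw)).trans (Complex.re_le_norm _)
  exact Real.rpow_le_rpow_of_nonpos (by linarith) h1 (by linarith)

lemma norm_bergmanKernel_le {ν r : ℝ} (hν : 0 ≤ ν) (hr : r < 1) {z w : Cn n} (hz : ‖z‖ ≤ r)
    (hw : ‖w‖ ≤ 1) : ‖bergmanKernel n ν z w‖ ≤ (1 - r) ^ (-ν) := by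
  rw [norm_bergmanKernel]
  exact rpow_neg_norm_le hν hr hz hw

lemma conj_bergmanKernel (ν : ℝ) {z w : Cn n} (hz : ‖z‖ < 1) (hw : ‖w‖ ≤ 1) :
    conj (bergmanKernel n ν z w) = bergmanKernel n ν w z := by
  rw [bergmanKernel_eq, bergmanKernel_eq, conj_cpow_ofReal (re_one_sub_inner_pos hz hw)]
  simp

lemma continuousOn_bergmanKernel_right (ν : ℝ) {z : Cn n} (hz : ‖z‖ < 1) :
    ContinuousOn (fun w => bergmanKernel n ν z w) (unitBall n) := by
  simp only [bergmanKernel_eq]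
  refine ContinuousOn.cpow_const (by fun_prop) fun w hw => ?_
  exact Or.inl (re_one_sub_inner_pos hz (mem_unitBall.1 hw).le)

lemma hasFDerivAt_bergmanKernel (ν : ℝ) {z w : Cn n} (hz : ‖z‖ < 1) (hw : ‖w‖ ≤ 1) :
    HasFDerivAt (fun z => bergmanKernel n ν z w)
      ((ν * (1 - inner ℂ w z : ℂ) ^ (((-ν - 1 : ℝ)) : ℂ)) • innerSL ℂ w) z := by
  simp only [bergmanKernel_eq]
  have h1 : HasFDerivAt (fun z : Cn n => (1 - inner ℂ w z : ℂ)) (-(innerSL ℂ w)) z := by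
    have := ((innerSL ℂ w).hasFDerivAt (x := z)).const_sub 1
    simpa using this
  have h2 := (h1.cpow (hasFDerivAt_const (((-ν : ℝ)) : ℂ) z)
    (Or.inl (re_one_sub_inner_pos hz hw)))
  refine h2.congr_fderiv ?_
  ext h
  simp

lemma differentiableOn_bergmanKernel (ν : ℝ) {w : Cn n} (hw : ‖w‖ ≤ 1) :
    DifferentiableOn ℂ (fun z => bergmanKernel n ν z w) (unitBall n) := fun _ hz =>
  (hasFDerivAt_bergmanKernel ν (mem_unitBall.1 hz) hw).differentiableAt.differentiableWithinAt

/-- Differentiation under the integral sign: for y in a smaller ball of radius r, |1 - ⟨y,w⟩| ≥ 1 -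
r uniformly in w, which bounds the kernel and its derivative. -/
lemma differentiableOn_integral_bergmanKernel {ν : ℝ} (hν : 0 ≤ ν) {f : Cn n → ℂ}
    (hf : Integrable f (bergmanMeasure n ν)) :
    DifferentiableOn ℂ (fun z => ∫ w, f w * bergmanKernel n ν z w ∂(bergmanMeasure n ν))
      (unitBall n) := by
  intro z hz
  have hz' := mem_unitBall.1 hz
  obtain ⟨r, hzr, hr⟩ := exists_between hz'
  have hball : Metric.ball (0 : Cn n) r ∈ nhds z := Metric.isOpen_ball.mem_nhds (by simpa using hzr)
  have hmeas : ∀ y : Cn n, ‖y‖ < 1 → AEStronglyMeasurable (fun w => f w * bergmanKernel n ν y w)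
      (bergmanMeasure n ν) := fun y hy =>
    hf.1.mul (aestronglyMeasurable_of_continuousOn (continuousOn_bergmanKernel_right ν hy))
  refine (hasFDerivAt_integral_of_dominated_of_fderiv_le (𝕜 := ℂ) (s := Metric.ball (0 : Cn n) r)
    (F' := fun y w => f w • ((ν * (1 - inner ℂ w y : ℂ) ^ (((-ν - 1 : ℝ)) : ℂ)) • innerSL ℂ w))
    (bound := fun w => ‖f w‖ * (ν * (1 - r) ^ (-(ν + 1)))) hball ?_ ?_ ?_ ?_ ?_
    ?_).differentiableAt.differentiableWithinAt
  · filter_upwards [hball] with y hy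
    exact hmeas y ((by simpa using hy : ‖y‖ < r).trans hr)
  · refine (hf.norm.mul_const ((1 - r) ^ (-ν))).mono' (hmeas z hz') ?_
    filter_upwards [ae_mem_unitBall ν] with w hw
    rw [norm_mul]
    exact mul_le_mul_of_nonneg_left
      (norm_bergmanKernel_le hν hr hzr.le (mem_unitBall.1 hw).le) (norm_nonneg _)
  · refine hf.1.smul (aestronglyMeasurable_of_continuousOn ?_)
    refine ContinuousOn.smul (f := fun w => (ν : ℂ) * (1 - inner ℂ w z : ℂ) ^ (((-ν - 1 : ℝ)) : ℂ))
      (continuousOn_const.mul ?_) (innerSL ℂ (E := Cn n)).continuous.continuousOn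
    refine ContinuousOn.cpow_const (by fun_prop) fun w hw => ?_
    exact Or.inl (re_one_sub_inner_pos hz' (mem_unitBall.1 hw).le)
  · filter_upwards [ae_mem_unitBall ν] with w hw y hy
    have hw' := (mem_unitBall.1 hw).le
    have hy' : ‖y‖ ≤ r := (by simpa using hy : ‖y‖ < r).le
    rw [norm_smul, norm_smul, norm_mul, Complex.norm_cpow_real]
    refine mul_le_mul_of_nonneg_left ?_ (norm_nonneg _)
    have h1 := rpow_neg_norm_le (ν := ν + 1) (by linarith) hr hy' hw'
    have h2 : ‖innerSL ℂ w‖ ≤ 1 := by rwa [innerSL_apply_norm]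
    rw [show -ν - 1 = -(ν + 1) by ring]
    have h3 : ‖(ν : ℂ)‖ = ν := by simp [abs_of_nonneg hν]
    rw [h3]
    calc _ ≤ ν * (1 - r) ^ (-(ν + 1)) * 1 := by gcongr
      _ = _ := mul_one _
  · exact hf.norm.mul_const _
  · filter_upwards [ae_mem_unitBall ν] with w hw y hy
    have h := (hasFDerivAt_bergmanKernel ν ((by simpa using hy : ‖y‖ < r).trans hr)
      (mem_unitBall.1 hw).le).const_mul (f w)
    exact h

/-! ### The mean value property and the reproducing property -/

/-- Multiplication by unimodular scalars preserves μ_ν. Averaging over the circle and exchanging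
integrals reduces the claim to the one-variable mean value property on each disc c ↦ c • z. -/
lemma integral_eq_apply_zero (hn : 0 < n) {ν : ℝ} (hν : (n : ℝ) < ν) {F : Cn n → ℂ}
    (hF : DifferentiableOn ℂ F (unitBall n)) (hFi : Integrable F (bergmanMeasure n ν)) :
    ∫ z, F z ∂(bergmanMeasure n ν) = F 0 := by
  have := isProbabilityMeasure_bergmanMeasure hn hν
  -- F is arbitrary off the ball; extension by zero makes the integrand measurable on the whole
  -- product.
  set G : Cn n → ℂ := (unitBall n).indicator F with hG
  have hGm : Measurable G := by
    rw [hG]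
    classical
    rw [← Set.piecewise_eq_indicator]
    exact hF.continuousOn.measurable_piecewise continuousOn_const measurableSet_unitBall
  have hGF : G =ᵐ[bergmanMeasure n ν] F := by
    filter_upwards [ae_mem_unitBall ν] with z hz
    exact indicator_of_mem hz F
  have hGi : Integrable G (bergmanMeasure n ν) := hFi.congr hGF.symm
  have hk : ∀ θ : ℝ, ∃ k : Matrix.unitaryGroup (Fin n) ℂ, ∀ z, rot k z = circleMap 0 1 θ • z :=
    fun θ => exists_rot_eq_smul (by simp)
  have hprod : Integrable (fun p : ℝ × Cn n => G (circleMap 0 1 p.1 • p.2))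
      ((volume.restrict (Ioc 0 (2 * Real.pi))).prod (bergmanMeasure n ν)) := by
    have hm : Measurable fun p : ℝ × Cn n => G (circleMap 0 1 p.1 • p.2) := by
      refine hGm.comp (Continuous.measurable ?_)
      exact ((continuous_circleMap 0 1).comp continuous_fst).smul continuous_snd
    rw [integrable_prod_iff hm.aestronglyMeasurable]
    constructor
    · refine Filter.Eventually.of_forall fun θ => ?_
      obtain ⟨k, hk⟩ := hk θ
      simp only [← hk]
      exact (integrable_comp_rot_iff hν k G).2 hGi
    · have : ∀ θ : ℝ, ∫ z, ‖G (circleMap 0 1 θ • z)‖ ∂(bergmanMeasure n ν) =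
          ∫ z, ‖G z‖ ∂(bergmanMeasure n ν) := by
        intro θ
        obtain ⟨k, hk⟩ := hk θ
        simp only [← hk]
        exact integral_comp_rot hν k fun z => ‖G z‖
      simp only [this]
      exact integrable_const _
  have hswap := integral_integral_swap (f := fun (θ : ℝ) (z : Cn n) => G (circleMap 0 1 θ • z))
    hprod
  have h1 : ∀ θ : ℝ, ∫ z, G (circleMap 0 1 θ • z) ∂(bergmanMeasure n ν) =
      ∫ z, F z ∂(bergmanMeasure n ν) := by
    intro θ
    obtain ⟨k, hk⟩ := hk θ
    simp only [← hk]
    rw [integral_comp_rot hν k G]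
    exact integral_congr_ae hGF
  have h2 : ∀ᵐ z ∂(bergmanMeasure n ν),
      ∫ θ in Ioc 0 (2 * Real.pi), G (circleMap 0 1 θ • z) = (2 * Real.pi : ℝ) • F 0 := by
    filter_upwards [ae_mem_unitBall ν] with z hz
    have hz' := mem_unitBall.1 hz
    have hd : DiffContOnCl ℂ (fun c : ℂ => F (c • z)) (Metric.ball 0 |1|) := by
      apply DifferentiableOn.diffContOnCl
      rw [abs_one, closure_ball _ one_ne_zero]
      refine hF.comp (by fun_prop) fun c hc => mem_unitBall.2 ?_
      rw [norm_smul]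
      have : ‖c‖ ≤ 1 := by simpa using hc
      nlinarith [norm_nonneg z, norm_nonneg c]
    have h3 := hd.circleAverage
    rw [Real.circleAverage_def, zero_smul] at h3
    rw [← h3, smul_smul, mul_inv_cancel₀ (by positivity), one_smul,
      intervalIntegral.integral_of_le (by positivity)]
    refine setIntegral_congr_fun measurableSet_Ioc fun θ _ => ?_
    refine indicator_of_mem (mem_unitBall.2 ?_) F
    rw [norm_smul]; simpa using hz'
  simp only [h1] at hswap
  rw [integral_congr_ae h2] at hswap
  simp only [integral_const, probReal_univ, one_smul, measureReal_restrict_apply_univ,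
    Real.volume_real_Ioc, sub_zero] at hswap
  rw [max_eq_left (by positivity)] at hswap
  exact (smul_right_injective ℂ (by positivity : (2 * Real.pi) ≠ 0)) hswap

/-- The reproducing property of the Bergman kernel. -/
lemma integral_mul_bergmanKernel (hn : 0 < n) {ν : ℝ} (hν : (n : ℝ) < ν) {g : Cn n → ℂ}
    (hg : DifferentiableOn ℂ g (unitBall n)) (hgi : Integrable g (bergmanMeasure n ν))
    {z : Cn n} (hz : ‖z‖ < 1) :
    Integrable (fun w => g w * bergmanKernel n ν z w) (bergmanMeasure n ν) ∧
    ∫ w, g w * bergmanKernel n ν z w ∂(bergmanMeasure n ν) = g z := by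
  have hν0 : 0 ≤ ν := (Nat.cast_nonneg n).trans hν.le
  have hint : Integrable (fun w => g w * bergmanKernel n ν z w) (bergmanMeasure n ν) := by
    refine (hgi.norm.mul_const ((1 - ‖z‖) ^ (-ν))).mono' (hgi.1.mul
      (aestronglyMeasurable_of_continuousOn (continuousOn_bergmanKernel_right ν hz))) ?_
    filter_upwards [ae_mem_unitBall ν] with w hw
    rw [norm_mul]
    exact mul_le_mul_of_nonneg_left
      (norm_bergmanKernel_le hν0 hz le_rfl (mem_unitBall.1 hw).le) (norm_nonneg _)
  refine ⟨hint, ?_⟩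
  have hδ := del_pos hz
  -- With u = 1 + ⟨ζ,z⟩, the kernel at the moved point is δ^(-2ν) / conj(u^(-ν)) and the Jacobian
  -- factor is δ^(2ν) u^(-ν) conj(u^(-ν)). Their product u^(-ν) is holomorphic in ζ and equals 1 at
  -- ζ = 0, so the mean value property applies.
  have key : ∀ ζ ∈ unitBall n, (‖den (boost z) ζ‖ ^ (-(2 * ν))) •
      (g (moebius (boost z) ζ) * bergmanKernel n ν z (moebius (boost z) ζ)) =
      g (moebius (boost z) ζ) * (1 + inner ℂ z ζ) ^ (((-ν : ℝ)) : ℂ) := by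
    intro ζ hζ
    have hζ' := mem_unitBall.1 hζ
    have hu := re_one_add_inner_pos hζ' hz.le
    set u : ℂ := 1 + inner ℂ z ζ with hudef
    have hu0 : u ≠ 0 := fun h => by rw [h] at hu; simp at hu
    have hui : 0 < (u⁻¹).re := by
      rw [Complex.inv_re]
      exact div_pos hu (Complex.normSq_pos.2 hu0)
    have hui' : 0 < (conj u⁻¹ : ℂ).re := by rwa [Complex.conj_re]
    have hd0 := den_boost hz (0 : Cn n)
    have h1 := one_sub_inner_moebius (boost z) (a := 0) (b := ζ) (by simp) hζ'.le
    rw [moebius_boost_zero hz, hd0, den_boost hz, ← hudef] at h1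
    simp only [inner_zero_right, sub_zero, add_zero, mul_one, map_mul, map_inv₀,
      Complex.conj_ofReal] at h1
    have e : (1 - inner ℂ (moebius (boost z) ζ) z : ℂ) = ((del z ^ 2 : ℝ) : ℂ) * conj u⁻¹ := by
      rw [h1, map_inv₀]; push_cast; field_simp
    have h2 : bergmanKernel n ν z (moebius (boost z) ζ) =
        ((del z ^ (-(2 * ν)) : ℝ) : ℂ) * (conj (u ^ (((-ν : ℝ)) : ℂ)))⁻¹ := by
      rw [bergmanKernel_eq, e, mul_cpow_of_re_pos _ hui', ← conj_cpow_ofReal hui,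
        Complex.inv_cpow _ _ (arg_ne_pi_of_re_pos hu), map_inv₀, ← Complex.ofReal_cpow (by positivity),
        ← Real.rpow_natCast, ← Real.rpow_mul hδ.le]
      · congr 3; push_cast; ring
      · rw [Complex.ofReal_re]; positivity
    have h3 : ‖den (boost z) ζ‖ ^ (-(2 * ν)) = (del z ^ (-(2 * ν)))⁻¹ * ‖u‖ ^ (2 * (-ν)) := by
      rw [den_boost hz, norm_mul, Real.mul_rpow (norm_nonneg _) (norm_nonneg _), norm_inv,
        Complex.norm_real, Real.norm_of_nonneg hδ.le, Real.inv_rpow hδ.le]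
      congr 2; ring
    have h4 := cpow_mul_conj_cpow (a := u) (-ν)
    have h5 : ((del z ^ (-(2 * ν)) : ℝ) : ℂ) ≠ 0 := by
      exact_mod_cast (Real.rpow_pos_of_pos hδ _).ne'
    have h6 : (conj (u ^ (((-ν : ℝ)) : ℂ)) : ℂ) ≠ 0 := by
      rw [map_ne_zero, Complex.cpow_ne_zero_iff]; exact Or.inl hu0
    rw [h3, h2, Complex.real_smul, Complex.ofReal_mul, ← h4, Complex.ofReal_inv]
    field_simp
  have hae : (fun ζ => (‖den (boost z) ζ‖ ^ (-(2 * ν))) •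
      (g (moebius (boost z) ζ) * bergmanKernel n ν z (moebius (boost z) ζ))) =ᵐ[bergmanMeasure n ν]
      fun ζ => g (moebius (boost z) ζ) * (1 + inner ℂ z ζ) ^ (((-ν : ℝ)) : ℂ) := by
    filter_upwards [ae_mem_unitBall ν] with ζ hζ using key ζ hζ
  rw [← integral_comp_moebius hν (boost z), integral_congr_ae hae, integral_eq_apply_zero hn hν]
  · simp [moebius_boost_zero hz]
  · refine DifferentiableOn.mul (hg.comp (fun ζ hζ => (hasFDerivAt_moebius (boost z)
      (mem_unitBall.1 hζ).le).differentiableAt.differentiableWithinAt)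
      fun ζ hζ => mem_unitBall.2 (norm_moebius_lt_one _ (mem_unitBall.1 hζ))) ?_
    intro ζ hζ
    refine (DifferentiableAt.cpow_const ?_ ?_).differentiableWithinAt
    · exact ((innerSL ℂ z).differentiableAt (x := ζ)).const_add 1
    · exact Or.inl (re_one_add_inner_pos (mem_unitBall.1 hζ) hz.le)
  · exact ((integrable_comp_moebius_iff hν (boost z) _).2 hint).congr hae

end BallQHA
end

noncomputable section
namespace BallQHA

variable {n : ℕ} {ν : ℝ}

/-! ### The Bergman space is a reproducing kernel Hilbert space -/

lemma memLp_bergmanKernel (hn : 0 < n) (hν : (n : ℝ) < ν) {a : Cn n} (ha : ‖a‖ < 1) :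
    MemLp (fun w => bergmanKernel n ν w a) 2 (bergmanMeasure n ν) := by
  have := isProbabilityMeasure_bergmanMeasure hn hν
  have hν0 : 0 ≤ ν := (Nat.cast_nonneg n).trans hν.le
  refine MemLp.of_bound (aestronglyMeasurable_of_continuousOn
    (differentiableOn_bergmanKernel ν ha.le).continuousOn) ((1 - ‖a‖) ^ (-ν)) ?_
  filter_upwards [ae_mem_unitBall ν] with w hw
  rw [← conj_bergmanKernel ν ha (mem_unitBall.1 hw).le, RCLike.norm_conj]
  exact norm_bergmanKernel_le hν0 ha le_rfl (mem_unitBall.1 hw).le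

open Classical in
/-- The kernel function `K_ν(·, a)` as an element of the Bergman space. -/
def kerB (n : ℕ) (ν : ℝ) (a : Cn n) : bergmanSpace n ν :=
  if h : 0 < n ∧ (n : ℝ) < ν ∧ ‖a‖ < 1 then
    ⟨(memLp_bergmanKernel h.1 h.2.1 h.2.2).toLp, _, differentiableOn_bergmanKernel ν h.2.2.le,
      MemLp.coeFn_toLp _⟩
  else 0

lemma coeFn_kerB (hn : 0 < n) (hν : (n : ℝ) < ν) {a : Cn n} (ha : ‖a‖ < 1) :
    (kerB n ν a).1 =ᵐ[bergmanMeasure n ν] fun w => bergmanKernel n ν w a := by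
  rw [kerB, dif_pos ⟨hn, hν, ha⟩]
  exact MemLp.coeFn_toLp (memLp_bergmanKernel hn hν ha)

lemma inner_kerB (hn : 0 < n) (hν : (n : ℝ) < ν) {a : Cn n} (ha : ‖a‖ < 1)
    (f : Lp ℂ 2 (bergmanMeasure n ν)) :
    inner ℂ (kerB n ν a).1 f = ∫ w, f w * bergmanKernel n ν a w ∂(bergmanMeasure n ν) := by
  rw [L2.inner_def]
  refine integral_congr_ae ?_
  filter_upwards [coeFn_kerB hn hν ha, ae_mem_unitBall ν] with w hw hwb
  rw [hw, RCLike.inner_apply, conj_bergmanKernel ν (mem_unitBall.1 hwb) ha.le]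

lemma integrable_coeFn (hn : 0 < n) (hν : (n : ℝ) < ν) (f : Lp ℂ 2 (bergmanMeasure n ν)) :
    Integrable f (bergmanMeasure n ν) := by
  have := isProbabilityMeasure_bergmanMeasure hn hν
  exact (Lp.memLp f).integrable one_le_two

/-- The holomorphic representative of the projection of `f` to the Bergman space. -/
def bergmanEval (f : Lp ℂ 2 (bergmanMeasure n ν)) (z : Cn n) : ℂ :=
  ∫ w, f w * bergmanKernel n ν z w ∂(bergmanMeasure n ν)

lemma differentiableOn_bergmanEval (hn : 0 < n) (hν : (n : ℝ) < ν)
    (f : Lp ℂ 2 (bergmanMeasure n ν)) :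
    DifferentiableOn ℂ (bergmanEval f) (unitBall n) :=
  differentiableOn_integral_bergmanKernel ((Nat.cast_nonneg n).trans hν.le)
    (integrable_coeFn hn hν f)

lemma bergmanEval_eq_inner (hn : 0 < n) (hν : (n : ℝ) < ν) {a : Cn n} (ha : ‖a‖ < 1)
    (f : Lp ℂ 2 (bergmanMeasure n ν)) : bergmanEval f a = inner ℂ (kerB n ν a).1 f :=
  (inner_kerB hn hν ha f).symm

lemma bergmanEval_eq (hn : 0 < n) (hν : (n : ℝ) < ν) {f : Lp ℂ 2 (bergmanMeasure n ν)}
    {g : Cn n → ℂ} (hg : DifferentiableOn ℂ g (unitBall n)) (hfg : f =ᵐ[bergmanMeasure n ν] g)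
    {a : Cn n} (ha : ‖a‖ < 1) : bergmanEval f a = g a := by
  rw [← (integral_mul_bergmanKernel hn hν hg ((integrable_coeFn hn hν f).congr hfg) ha).2]
  refine integral_congr_ae ?_
  filter_upwards [hfg] with w hw
  rw [hw]

lemma mem_bergmanSpace_iff (hn : 0 < n) (hν : (n : ℝ) < ν) {f : Lp ℂ 2 (bergmanMeasure n ν)} :
    f ∈ bergmanSpace n ν ↔ f =ᵐ[bergmanMeasure n ν] bergmanEval f := by
  constructor
  · rintro ⟨g, hg, hfg⟩
    filter_upwards [hfg, ae_mem_unitBall ν] with z hz hzb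
    rw [hz, bergmanEval_eq hn hν hg hfg (mem_unitBall.1 hzb)]
  · exact fun h => ⟨_, differentiableOn_bergmanEval hn hν f, h⟩

/-- Along an L²-convergent sequence the evaluations converge at every point of the ball, being inner
products with kernel functions, while a subsequence of the functions converges almost everywhere;
the two limits must agree. -/
lemma isClosed_bergmanSpace (hn : 0 < n) (hν : (n : ℝ) < ν) :
    IsClosed (bergmanSpace n ν : Set (Lp ℂ 2 (bergmanMeasure n ν))) := by
  refine IsSeqClosed.isClosed fun u f hu hf => ?_
  rw [SetLike.mem_coe, mem_bergmanSpace_iff hn hν]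
  obtain ⟨s, hs, hlim⟩ := (tendstoInMeasure_of_tendsto_Lp hf).exists_seq_tendsto_ae
  have h1 : ∀ᵐ z ∂(bergmanMeasure n ν), ∀ i, u i z = bergmanEval (u i) z :=
    ae_all_iff.2 fun i => (mem_bergmanSpace_iff hn hν).1 (hu i)
  filter_upwards [h1, hlim, ae_mem_unitBall ν] with z hz hzl hzb
  have hzb' := mem_unitBall.1 hzb
  refine tendsto_nhds_unique hzl ?_
  simp only [hz, bergmanEval_eq_inner hn hν hzb']
  exact ((tendsto_const_nhds.inner hf).comp hs.tendsto_atTop)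

lemma completeSpace_bergmanSpace (hn : 0 < n) (hν : (n : ℝ) < ν) :
    CompleteSpace (bergmanSpace n ν) :=
  (isClosed_bergmanSpace hn hν).completeSpace_coe

/-- A function holomorphic on the ball that vanishes near the origin vanishes on the ball. -/
lemma eq_zero_of_eq_zero_near {g : Cn n → ℂ} (hg : DifferentiableOn ℂ g (unitBall n)) {ε : ℝ}
    (hε : 0 < ε) (h : ∀ a : Cn n, ‖a‖ < ε → ‖a‖ < 1 → g a = 0) {z : Cn n} (hz : ‖z‖ < 1) :
    g z = 0 := by
  -- The slice of the ball by the complex line through z is convex and contains 0 and 1, so the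
  -- one-variable identity theorem carries the vanishing from near 0 to z.
  set U : Set ℂ := {c | ‖c • z‖ < 1} with hU
  have hUo : IsOpen U := isOpen_lt (by fun_prop) continuous_const
  have hUc : IsPreconnected U := by
    have : U = (LinearMap.toSpanSingleton ℂ (Cn n) z).restrictScalars ℝ ⁻¹' Metric.ball 0 1 := by
      ext c; simp [hU]
    rw [this]
    exact ((convex_ball (0 : Cn n) 1).linear_preimage _).isPreconnected
  have hd : DifferentiableOn ℂ (fun c : ℂ => g (c • z)) U :=
    hg.comp (by fun_prop) fun c hc => mem_unitBall.2 hc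
  have h0 : (0 : ℂ) ∈ U := by simp [hU]
  have hev : (fun c : ℂ => g (c • z)) =ᶠ[nhds 0] 0 := by
    have : ∀ᶠ c : ℂ in nhds 0, ‖c • z‖ < ε := by
      have : Continuous fun c : ℂ => ‖c • z‖ := by fun_prop
      exact this.tendsto' 0 0 (by simp) |>.eventually (gt_mem_nhds hε)
    filter_upwards [this, hUo.mem_nhds h0] with c hc hc'
    exact h _ hc hc'
  have := (hd.analyticOnNhd hUo).eqOn_zero_of_preconnected_of_eventuallyEq_zero hUc h0 hev
    (x := 1) (by simpa [hU] using hz)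
  simpa using this

/-- The kernel functions based at points near the origin span a dense subspace. -/
lemma dense_span_kerB (hn : 0 < n) (hν : (n : ℝ) < ν) {ε : ℝ} (hε : 0 < ε) :
    (Submodule.span ℂ (kerB n ν '' Metric.ball 0 ε)).topologicalClosure = ⊤ := by
  have := completeSpace_bergmanSpace hn hν
  rw [Submodule.topologicalClosure_eq_top_iff, Submodule.eq_bot_iff]
  -- Orthogonality to the kernels near 0 says that the holomorphic representative of f vanishes near
  -- 0, hence on the whole ball.
  intro f hf
  rw [Submodule.mem_orthogonal] at hf
  have h1 : ∀ z : Cn n, ‖z‖ < 1 → bergmanEval f.1 z = 0 := by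
    intro z hz
    refine eq_zero_of_eq_zero_near (differentiableOn_bergmanEval hn hν f.1) hε ?_ hz
    intro a ha ha1
    rw [bergmanEval_eq_inner hn hν ha1]
    exact hf _ (Submodule.subset_span ⟨a, by simpa using ha, rfl⟩)
  apply Subtype.ext
  apply Lp.ext
  filter_upwards [(mem_bergmanSpace_iff hn hν).1 f.2, ae_mem_unitBall ν,
    Lp.coeFn_zero ℂ 2 (bergmanMeasure n ν)] with z hz hzb hz0
  rw [hz, h1 z (mem_unitBall.1 hzb)]
  exact hz0.symm

/-! ### Toeplitz operators -/

open Classical in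
/-- The Toeplitz operator with symbol `f ∈ L^∞`: multiplication by `f` followed by the orthogonal
projection to the Bergman space. -/
def toeplitz (hn : 0 < n) (hν : (n : ℝ) < ν) (f : Lp ℂ ⊤ (bergmanMeasure n ν)) :
    bergmanSpace n ν →L[ℂ] bergmanSpace n ν :=
  haveI := completeSpace_bergmanSpace hn hν
  (bergmanSpace n ν).orthogonalProjectionOnto ∘L
    ((ContinuousLinearMap.mul ℂ ℂ).holderL (bergmanMeasure n ν) ⊤ 2 2 f) ∘L
      (bergmanSpace n ν).subtypeL

lemma inner_toeplitz (hn : 0 < n) (hν : (n : ℝ) < ν) {φ : Cn n → ℂ}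
    (hφ : MemLp φ ⊤ (bergmanMeasure n ν)) (f g : bergmanSpace n ν) :
    inner ℂ g (toeplitz hn hν hφ.toLp f) =
      ∫ w, φ w * f.1 w * conj (g.1 w) ∂(bergmanMeasure n ν) := by
  have := completeSpace_bergmanSpace hn hν
  rw [toeplitz]
  simp only [ContinuousLinearMap.comp_apply]
  rw [Submodule.inner_orthogonalProjectionOnto_eq_of_mem_left, L2.inner_def]
  refine integral_congr_ae ?_
  filter_upwards [(ContinuousLinearMap.mul ℂ ℂ).coeFn_holder (r := 2) hφ.toLp f.1,
    hφ.coeFn_toLp] with w hw1 hw2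
  rw [RCLike.inner_apply]
  change ((ContinuousLinearMap.mul ℂ ℂ).holder 2 hφ.toLp f.1) w * _ = _
  rw [hw1, hw2]
  simp

lemma integrable_symbol_mul (hn : 0 < n) (hν : (n : ℝ) < ν) {φ : Cn n → ℂ}
    (hφ : MemLp φ ⊤ (bergmanMeasure n ν)) (f : bergmanSpace n ν) {z : Cn n} (hz : ‖z‖ < 1) :
    Integrable (fun w => φ w * f.1 w * bergmanKernel n ν z w) (bergmanMeasure n ν) := by
  have := isProbabilityMeasure_bergmanMeasure hn hν
  have hν0 : 0 ≤ ν := (Nat.cast_nonneg n).trans hν.le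
  have h1 : MemLp (fun w => φ w * f.1 w) 2 (bergmanMeasure n ν) :=
    (Lp.memLp f.1).mul hφ
  refine ((h1.integrable one_le_two).norm.mul_const ((1 - ‖z‖) ^ (-ν))).mono' (h1.1.mul
      (aestronglyMeasurable_of_continuousOn (continuousOn_bergmanKernel_right ν hz))) ?_
  filter_upwards [ae_mem_unitBall ν] with w hw
  rw [norm_mul]
  exact mul_le_mul_of_nonneg_left
    (norm_bergmanKernel_le hν0 hz le_rfl (mem_unitBall.1 hw).le) (norm_nonneg _)

lemma isToeplitz_toeplitz (hn : 0 < n) (hν : (n : ℝ) < ν) {φ : Cn n → ℂ}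
    (hφ : MemLp φ ⊤ (bergmanMeasure n ν)) : IsToeplitz n ν φ (toeplitz hn hν hφ.toLp) := by
  intro f
  refine ⟨fun z hz => integrable_symbol_mul hn hν hφ f (mem_unitBall.1 hz), ?_⟩
  filter_upwards [(mem_bergmanSpace_iff hn hν).1 (toeplitz hn hν hφ.toLp f).2,
    ae_mem_unitBall ν] with z hz hzb
  have hzb' := mem_unitBall.1 hzb
  rw [hz, bergmanEval_eq_inner hn hν hzb']
  change inner ℂ (kerB n ν z) (toeplitz hn hν hφ.toLp f) = _
  rw [inner_toeplitz]
  refine integral_congr_ae ?_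
  filter_upwards [coeFn_kerB hn hν hzb', ae_mem_unitBall ν] with w hw hwb
  rw [hw, conj_bergmanKernel ν (mem_unitBall.1 hwb) hzb'.le]

lemma inner_kerB_toeplitz_kerB (hn : 0 < n) (hν : (n : ℝ) < ν) {φ : Cn n → ℂ}
    (hφ : MemLp φ ⊤ (bergmanMeasure n ν)) {a b : Cn n} (ha : ‖a‖ < 1) (hb : ‖b‖ < 1) :
    inner ℂ (kerB n ν a) (toeplitz hn hν hφ.toLp (kerB n ν b)) =
      ∫ w, φ w * bergmanKernel n ν w b * bergmanKernel n ν a w ∂(bergmanMeasure n ν) := by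
  rw [inner_toeplitz]
  refine integral_congr_ae ?_
  filter_upwards [coeFn_kerB hn hν ha, coeFn_kerB hn hν hb, ae_mem_unitBall ν] with w hwa hwb hw
  rw [hwa, hwb, conj_bergmanKernel ν (mem_unitBall.1 hw) ha.le]

end BallQHA
end

noncomputable section
namespace BallQHA

variable {n : ℕ} {ν : ℝ} {φ : Cn n → ℂ}

/-! ### Elementary properties of bounded spherical functions -/

lemma IsBoundedSpherical.apply_zero (hφ : IsBoundedSpherical n φ) : φ 0 = 1 := by
  obtain ⟨x, hx⟩ := hφ.nonzero
  have h := hφ.functional_equation x 1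
  have h1 : ∀ k, moebius (x * embK k * 1) (0 : Cn n) = moebius x 0 := by
    intro k
    rw [mul_one, moebius_mul _ _ (by simp)]
    change moebius x (rot k 0) = _
    rw [rot_zero]
  simp only [h1, moebius_one, integral_const, probReal_univ, one_smul] at h
  exact mul_left_cancel₀ hx (by rw [← h, mul_one])

lemma IsBoundedSpherical.integral_comp_rot (hφ : IsBoundedSpherical n φ) (x : SU1 n) {z : Cn n}
    (hz : ‖z‖ < 1) : ∫ k, φ (moebius x (rot k z)) ∂(haarU n) = φ (moebius x 0) * φ z := by
  have h := hφ.functional_equation x (boost z)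
  rw [moebius_boost_zero hz] at h
  rw [← h]
  congr 1
  funext k
  rw [mul_assoc, moebius_mul _ _ (by simp), moebius_mul _ _ (by simp), moebius_boost_zero hz]
  rfl

lemma IsBoundedSpherical.integral_rot (hφ : IsBoundedSpherical n φ) {z : Cn n}
    (hz : ‖z‖ < 1) : ∫ k, φ (rot k z) ∂(haarU n) = φ z := by
  have h := hφ.integral_comp_rot 1 hz
  simpa [hφ.apply_zero] using h

/-- φ equals its own average over K, and K is transitive on spheres. -/
lemma IsBoundedSpherical.eq_of_norm_eq (hn : 0 < n) (hφ : IsBoundedSpherical n φ) {z w : Cn n}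
    (hz : ‖z‖ < 1) (h : ‖z‖ = ‖w‖) : φ z = φ w := by
  rw [← hφ.integral_rot hz, ← hφ.integral_rot (h ▸ hz), integral_rot_congr hn φ h]

lemma IsBoundedSpherical.continuousOn (hφ : IsBoundedSpherical n φ) :
    ContinuousOn φ (unitBall n) := by
  have h := hφ.continuous.comp_continuousOn (continuousOn_boost (n := n))
  refine h.congr fun z hz => ?_
  simp [moebius_boost_zero (mem_unitBall.1 hz)]

/-- With S the supremum of |φ|, the functional equation gives |φ(x)| |φ(y)| ≤ S for all y, hence
|φ(x)| S ≤ S, where S ≥ |φ(0)| = 1. -/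
lemma IsBoundedSpherical.norm_le_one (hφ : IsBoundedSpherical n φ) {z : Cn n} (hz : ‖z‖ < 1) :
    ‖φ z‖ ≤ 1 := by
  obtain ⟨C, hC⟩ := hφ.bounded
  set S := ⨆ x : SU1 n, ‖φ (moebius x 0)‖ with hS
  have hbdd : BddAbove (range fun x : SU1 n => ‖φ (moebius x 0)‖) := ⟨C, by rintro _ ⟨x, rfl⟩; exact hC x⟩
  have hle : ∀ x : SU1 n, ‖φ (moebius x 0)‖ ≤ S := fun x => le_ciSup hbdd x
  have hS1 : 1 ≤ S := by simpa [hφ.apply_zero] using hle 1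
  have hmul : ∀ x y : SU1 n, ‖φ (moebius x 0)‖ * ‖φ (moebius y 0)‖ ≤ S := by
    intro x y
    rw [← norm_mul, ← hφ.functional_equation x y]
    refine (norm_integral_le_of_norm_le_const (C := S)
      (Filter.Eventually.of_forall fun k => hle _)).trans ?_
    simp
  have hx : ∀ x : SU1 n, ‖φ (moebius x 0)‖ ≤ 1 := by
    intro x
    by_cases h0 : ‖φ (moebius x 0)‖ = 0
    · rw [h0]; exact zero_le_one
    have hpos : 0 < ‖φ (moebius x 0)‖ := (norm_nonneg _).lt_of_ne' h0
    have : S ≤ S / ‖φ (moebius x 0)‖ := ciSup_le fun y => by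
      rw [le_div_iff₀ hpos, mul_comm]; exact hmul x y
    rw [le_div_iff₀ hpos] at this
    nlinarith
  have := hx (boost z)
  rwa [moebius_boost_zero hz] at this

lemma IsBoundedSpherical.memLp_top (hn : 0 < n) (hν : (n : ℝ) < ν) (hφ : IsBoundedSpherical n φ) :
    MemLp φ ⊤ (bergmanMeasure n ν) := by
  have := isProbabilityMeasure_bergmanMeasure hn hν
  refine memLp_top_of_bound (aestronglyMeasurable_of_continuousOn hφ.continuousOn) 1 ?_
  filter_upwards [ae_mem_unitBall ν] with z hz using hφ.norm_le_one (mem_unitBall.1 hz)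

lemma isBoundedSpherical_one : IsBoundedSpherical n fun _ => 1 where
  continuous := continuous_const
  nonzero := ⟨1, one_ne_zero⟩
  bounded := ⟨1, by simp⟩
  functional_equation := by simp

/-! ### Averages over `K` -/

lemma aestronglyMeasurable_prod_of_continuousOn (hn : 0 < n) (hν : (n : ℝ) < ν)
    {f : Cn n × Matrix.unitaryGroup (Fin n) ℂ → ℂ} (hf : ContinuousOn f (unitBall n ×ˢ univ)) :
    AEStronglyMeasurable f ((bergmanMeasure n ν).prod (haarU n)) := by
  have := isProbabilityMeasure_bergmanMeasure hn hν
  have h : ((bergmanMeasure n ν).prod (haarU n)).restrict (unitBall n ×ˢ univ) =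
      (bergmanMeasure n ν).prod (haarU n) := by
    rw [← Measure.prod_restrict, Measure.restrict_univ,
      Measure.restrict_eq_self_of_ae_mem (ae_mem_unitBall ν)]
  rw [← h]
  exact hf.aestronglyMeasurable (measurableSet_unitBall.prod MeasurableSet.univ)

lemma ae_prod_mem (hn : 0 < n) (hν : (n : ℝ) < ν) :
    ∀ᵐ p ∂((bergmanMeasure n ν).prod (haarU n)), p.1 ∈ unitBall n := by
  have := isProbabilityMeasure_bergmanMeasure hn hν
  exact Measure.quasiMeasurePreserving_fst.ae (ae_mem_unitBall ν)

/-- Convolution of a spherical function with a radial function. -/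
lemma IsBoundedSpherical.integral_comp_moebius_mul (hn : 0 < n) (hν : (n : ℝ) < ν)
    (hφ : IsBoundedSpherical n φ) (x : SU1 n) {ψ : Cn n → ℂ}
    (hψm : AEStronglyMeasurable ψ (bergmanMeasure n ν)) {C : ℝ}
    (hψb : ∀ z ∈ unitBall n, ‖ψ z‖ ≤ C) (hψ : ∀ k z, ψ (rot k z) = ψ z) :
    ∫ z, φ (moebius x z) * ψ z ∂(bergmanMeasure n ν) =
      φ (moebius x 0) * ∫ z, φ z * ψ z ∂(bergmanMeasure n ν) := by
  have := isProbabilityMeasure_bergmanMeasure hn hν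
  have hrotmem : ∀ k, ∀ z ∈ unitBall n, rot k z ∈ unitBall n := fun k z hz =>
    mem_unitBall.2 (by rw [norm_rot]; exact mem_unitBall.1 hz)
  have hint : Integrable (fun p : Cn n × Matrix.unitaryGroup (Fin n) ℂ =>
      φ (moebius x (rot p.2 p.1)) * ψ p.1) ((bergmanMeasure n ν).prod (haarU n)) := by
    refine Integrable.of_bound (C := C) (AEStronglyMeasurable.mul ?_ hψm.comp_fst) ?_
    · refine aestronglyMeasurable_prod_of_continuousOn hn hν ?_
      refine hφ.continuousOn.comp ((continuousOn_moebius x).comp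
        (continuous_rot.comp continuous_swap).continuousOn fun p hp => hrotmem _ _ hp.1)
        fun p hp => ?_
      exact mem_unitBall.2 (norm_moebius_lt_one x (mem_unitBall.1 (hrotmem _ _ hp.1)))
    · filter_upwards [ae_prod_mem hn hν] with p hp
      rw [norm_mul]
      have h1 := hφ.norm_le_one (norm_moebius_lt_one x (mem_unitBall.1 (hrotmem p.2 _ hp)))
      have h2 := hψb _ hp
      calc _ ≤ 1 * C := mul_le_mul h1 h2 (norm_nonneg _) zero_le_one
        _ = C := one_mul C
  -- Both ψ and μ_ν are invariant under K, so z may be replaced by rot k z in φ alone; averaging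
  -- over k then brings in the functional equation.
  have h1 : ∀ k, ∫ z, φ (moebius x (rot k z)) * ψ z ∂(bergmanMeasure n ν) =
      ∫ z, φ (moebius x z) * ψ z ∂(bergmanMeasure n ν) := by
    intro k
    rw [← BallQHA.integral_comp_rot hν k fun z => φ (moebius x z) * ψ z]
    simp only [hψ]
  have h2 := integral_integral_swap (f := fun (z : Cn n) (k : Matrix.unitaryGroup (Fin n) ℂ) =>
    φ (moebius x (rot k z)) * ψ z) hint
  simp only [h1, integral_const, probReal_univ, one_smul] at h2
  rw [← h2, ← integral_const_mul]
  refine integral_congr_ae ?_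
  filter_upwards [ae_mem_unitBall ν] with z hz
  rw [integral_mul_const, hφ.integral_comp_rot x (mem_unitBall.1 hz), mul_assoc]

/-! ### Diagonal values of Toeplitz kernels -/

lemma normSq_den_zero (x : SU1 n) : ‖den x 0‖ ^ 2 = (1 - ‖moebius x 0‖ ^ 2)⁻¹ := by
  have h := one_sub_normSq_moebius x (a := 0) (by simp)
  rw [h]; simp

lemma den_mul_den_inv (x : SU1 n) : den x⁻¹ 0 * den x (moebius x⁻¹ 0) = 1 := by
  rw [← den_mul x x⁻¹ (by simp), mul_inv_cancel]
  simp [den]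

/-- The invariance identity is applied at v and at x⁻¹ · 0, whose image is the origin, so the inner
product of the images vanishes. The case v = 0 gives |den x 0| = |den x⁻¹ 0|, from which the
equality of the norms follows. -/
lemma norm_den_eq (x : SU1 n) {u : Cn n} (hu : ‖u‖ ≤ 1) :
    ‖den x u‖ = ‖den x 0‖ * ‖(1 - inner ℂ u (moebius x⁻¹ 0) : ℂ)‖ ∧
      ‖moebius x⁻¹ 0‖ = ‖moebius x 0‖ := by
  have key : ∀ v : Cn n, ‖v‖ ≤ 1 →
      ‖den x v‖ = ‖den x⁻¹ 0‖ * ‖(1 - inner ℂ v (moebius x⁻¹ 0) : ℂ)‖ := by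
    intro v hv
    have hp : ‖moebius x⁻¹ (0 : Cn n)‖ ≤ 1 := norm_moebius_le_one _ (by simp)
    have h := one_sub_inner_moebius x hp hv
    rw [moebius_moebius_inv x (by simp), inner_zero_right, sub_zero, eq_div_iff
      (mul_ne_zero (den_ne_zero x hp) (by simpa using den_ne_zero x hv)), one_mul] at h
    have h2 := den_mul_den_inv x
    rw [← h, norm_mul, RCLike.norm_conj, ← mul_assoc, ← norm_mul, h2]; simp
  have h0 : ‖den x 0‖ = ‖den x⁻¹ 0‖ := by simpa using key 0 (by simp)
  refine ⟨by rw [h0]; exact key u hu, ?_⟩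
  have h1 := normSq_den_zero x
  have h2 := normSq_den_zero x⁻¹
  rw [← h0, h1, inv_inj] at h2
  have : ‖moebius x⁻¹ (0 : Cn n)‖ ^ 2 = ‖moebius x (0 : Cn n)‖ ^ 2 := by linarith
  exact (sq_eq_sq₀ (norm_nonneg _) (norm_nonneg _)).1 this

lemma rpow_norm_den_zero (x : SU1 n) (s : ℝ) :
    ‖den x 0‖ ^ (-(2 * s)) = (1 - ‖moebius x 0‖ ^ 2) ^ s := by
  have hp := one_sub_normSq_pos (norm_moebius_lt_one x (a := 0) (by simp))
  rw [show -(2 * s) = ((2 : ℕ) : ℝ) * (-s) by push_cast; ring, Real.rpow_mul (norm_nonneg _),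
    Real.rpow_natCast, normSq_den_zero, Real.inv_rpow hp.le, Real.rpow_neg hp.le, inv_inv]

/-- The substitution w = boost a · z turns |K_ν(a,w)|² dμ_ν(w) into (1-|a|²)^(-ν) dμ_ν(z). What
remains is the mean of a translate of φ, to which the convolution property with a constant radial
function applies. -/
lemma IsBoundedSpherical.integral_mul_normSq_kernel (hn : 0 < n) (hν : (n : ℝ) < ν)
    (hφ : IsBoundedSpherical n φ) {a : Cn n} (ha : ‖a‖ < 1) :
    ∫ w, φ w * ((‖(1 - inner ℂ w a : ℂ)‖ ^ (-(2 * ν)) : ℝ) : ℂ) ∂(bergmanMeasure n ν) =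
      (((1 - ‖a‖ ^ 2) ^ (-ν) : ℝ) : ℂ) * (φ a * hHat n ν φ) := by
  have h := hφ.integral_comp_moebius_mul hn hν (boost a) (ψ := fun _ => 1) (C := 1)
    aestronglyMeasurable_const (by simp) (by simp)
  simp only [mul_one, moebius_boost_zero ha] at h
  rw [hHat_eq_integral hν, ← h, ← integral_const_mul, ← integral_comp_moebius hν (boost a)]
  refine integral_congr_ae ?_
  filter_upwards [ae_mem_unitBall ν] with z hz
  have hz' := mem_unitBall.1 hz
  have h1 := one_sub_inner_moebius (boost a) (a := 0) (b := z) (by simp) hz'.le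
  rw [moebius_boost_zero ha, inner_zero_right, sub_zero] at h1
  have h2 : ‖den (boost a) z‖ ≠ 0 := norm_ne_zero_iff.2 (den_ne_zero _ hz'.le)
  have h3 := rpow_norm_den_zero (boost a) (-ν)
  rw [moebius_boost_zero ha] at h3
  rw [h1, norm_div, norm_one, norm_mul, RCLike.norm_conj, one_div, Real.inv_rpow (by positivity),
    Real.mul_rpow (norm_nonneg _) (norm_nonneg _), ← h3, Complex.real_smul]
  have h4 : ‖den (boost a) z‖ ^ (-(2 * ν)) ≠ 0 := by positivity
  have h5 : (‖den (boost a) 0‖ ^ (-(2 * ν)))⁻¹ = ‖den (boost a) 0‖ ^ (-(2 * -ν)) := by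
    rw [← Real.rpow_neg (norm_nonneg _)]; congr 1; ring
  rw [mul_inv, h5]
  push_cast
  have h4' : ((‖den (boost a) z‖ ^ (-(2 * ν)) : ℝ) : ℂ) ≠ 0 := by exact_mod_cast h4
  field_simp

/-- The `K`-average of `|K_ν(rot k b, z)|²`. -/
def kerAvg (n : ℕ) (ν : ℝ) (b z : Cn n) : ℝ :=
  ∫ k, ‖(1 - inner ℂ (rot k b) z : ℂ)‖ ^ (-(2 * ν)) ∂(haarU n)

lemma kerAvg_rot (ν : ℝ) (b z : Cn n) (l : Matrix.unitaryGroup (Fin n) ℂ) :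
    kerAvg n ν b (rot l z) = kerAvg n ν b z := by
  rw [kerAvg, kerAvg, ← integral_mul_left_eq_self
    (fun k => ‖(1 - inner ℂ (rot k b) (rot l z) : ℂ)‖ ^ (-(2 * ν))) l]
  simp only [rot_mul, inner_rot]

lemma kerAvg_congr (hn : 0 < n) (ν : ℝ) (b : Cn n) {z w : Cn n} (h : ‖z‖ = ‖w‖) :
    kerAvg n ν b z = kerAvg n ν b w := by
  obtain ⟨l, rfl⟩ := exists_rot_eq hn h
  rw [kerAvg_rot]

/-- The function `(1 + ⟨z,u⟩)(1 - ⟨a, boost z · u⟩)`, up to a constant the pairing of the lifts of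
`a` and of `boost z · u`. -/
def cross (z a u : Cn n) : ℂ :=
  1 + inner ℂ u z - inner ℂ z a - (del z : ℂ) * inner ℂ u a -
    (1 + del z : ℂ)⁻¹ * (inner ℂ z a * inner ℂ u z)

/-- The factored form carries the geometry; the expanded definition of `cross` shows holomorphy in a
and antiholomorphy in u, needed for polarization. -/
lemma cross_eq {z : Cn n} (hz : ‖z‖ < 1) (a : Cn n) {u : Cn n} (hu : ‖u‖ ≤ 1) :
    cross z a u = (1 + inner ℂ u z) * (1 - inner ℂ (moebius (boost z) u) a) := by
  obtain ⟨h0, h1, h2⟩ := boost_aux hz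
  have h3 := re_one_sub_inner_pos (z := -z) (w := u) (by rwa [norm_neg]) hu
  have h4 : (1 + inner ℂ u z : ℂ) ≠ 0 := by
    intro h; simp only [inner_neg_right, sub_neg_eq_add] at h3; rw [h] at h3; simp at h3
  rw [moebius_eq, den_boost hz, num_boost hz]
  have e : conj (inner ℂ z u : ℂ) = inner ℂ u z := inner_conj_symm _ _
  simp only [inner_smul_left, inner_add_left, map_inv₀, map_mul, map_add, map_one, e,
    Complex.conj_ofReal]
  rw [cross]
  field_simp
  ring

end BallQHA
end

/-! ### Squared moduli of matrix coefficients integrated against a spherical function. -/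

noncomputable section
namespace BallQHA

variable {n : ℕ} {ν : ℝ} {φ : Cn n → ℂ}

lemma norm_one_sub_inner_comm (z w : Cn n) :
    ‖(1 - inner ℂ z w : ℂ)‖ = ‖(1 - inner ℂ w z : ℂ)‖ := by
  rw [← RCLike.norm_conj, map_sub, map_one, inner_conj_symm]

lemma kernel_rot_le (hν : 0 ≤ ν) {b z : Cn n} (hb : ‖b‖ < 1) (hz : ‖z‖ ≤ 1)
    (k : Matrix.unitaryGroup (Fin n) ℂ) :
    ‖(1 - inner ℂ (rot k b) z : ℂ)‖ ^ (-(2 * ν)) ≤ (1 - ‖b‖) ^ (-(2 * ν)) := by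
  rw [norm_one_sub_inner_comm]
  exact rpow_neg_norm_le (by positivity) hb (norm_rot k b).le hz

lemma continuous_rot_left (b : Cn n) :
    Continuous fun k : Matrix.unitaryGroup (Fin n) ℂ => rot k b :=
  Continuous.comp (g := fun p : Matrix.unitaryGroup (Fin n) ℂ × Cn n => rot p.1 p.2)
    (f := fun k => (k, b)) continuous_rot (by fun_prop)

lemma aestronglyMeasurable_kernel_rot (hn : 0 < n) (hν : (n : ℝ) < ν) {b : Cn n} (hb : ‖b‖ < 1) :
    AEStronglyMeasurable (fun p : Cn n × Matrix.unitaryGroup (Fin n) ℂ =>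
      ((‖(1 - inner ℂ (rot p.2 b) p.1 : ℂ)‖ ^ (-(2 * ν)) : ℝ) : ℂ))
      ((bergmanMeasure n ν).prod (haarU n)) := by
  refine aestronglyMeasurable_prod_of_continuousOn hn hν ?_
  refine Complex.continuous_ofReal.comp_continuousOn ?_
  have hrot : Continuous fun p : Cn n × Matrix.unitaryGroup (Fin n) ℂ => rot p.2 b :=
    (continuous_rot_left b).comp continuous_snd
  have hc : Continuous fun p : Cn n × Matrix.unitaryGroup (Fin n) ℂ =>
      ‖(1 - inner ℂ (rot p.2 b) p.1 : ℂ)‖ :=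
    (continuous_const.sub (hrot.inner continuous_fst)).norm
  refine hc.continuousOn.rpow_const fun p hp => Or.inl ?_
  · have h := re_one_sub_inner_pos' (z := p.1) (w := rot p.2 b) (mem_unitBall.1 hp.1).le
      (by rwa [norm_rot])
    intro h0
    rw [norm_eq_zero] at h0
    rw [h0] at h; simp at h

lemma integrable_symbol_mul_kernel_rot (hn : 0 < n) (hν : (n : ℝ) < ν)
    (hφ : IsBoundedSpherical n φ) {b : Cn n} (hb : ‖b‖ < 1) :
    Integrable (fun p : Cn n × Matrix.unitaryGroup (Fin n) ℂ =>
      φ p.1 * ((‖(1 - inner ℂ (rot p.2 b) p.1 : ℂ)‖ ^ (-(2 * ν)) : ℝ) : ℂ))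
      ((bergmanMeasure n ν).prod (haarU n)) := by
  have := isProbabilityMeasure_bergmanMeasure hn hν
  refine Integrable.of_bound (C := (1 - ‖b‖) ^ (-(2 * ν)))
    ((aestronglyMeasurable_of_continuousOn hφ.continuousOn).comp_fst.mul
      (aestronglyMeasurable_kernel_rot hn hν hb)) ?_
  filter_upwards [ae_prod_mem hn hν] with p hp
  have hp' := mem_unitBall.1 hp
  rw [norm_mul, Complex.norm_real, Real.norm_of_nonneg (by positivity), ← one_mul ((1 - ‖b‖) ^ _)]
  exact mul_le_mul (hφ.norm_le_one hp') (kernel_rot_le ((Nat.cast_nonneg n).trans hν.le) hb hp'.le _)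
    (by positivity) zero_le_one

lemma ofReal_kerAvg (ν : ℝ) (b z : Cn n) : (kerAvg n ν b z : ℂ) =
    ∫ k, ((‖(1 - inner ℂ (rot k b) z : ℂ)‖ ^ (-(2 * ν)) : ℝ) : ℂ) ∂(haarU n) := by
  exact integral_complex_ofReal.symm

/-- After Fubini every k contributes the same value, because the evaluated kernel integral depends
on rot k b only through its norm. -/
lemma IsBoundedSpherical.integral_mul_kerAvg (hn : 0 < n) (hν : (n : ℝ) < ν)
    (hφ : IsBoundedSpherical n φ) {b : Cn n} (hb : ‖b‖ < 1) :
    ∫ w, φ w * (kerAvg n ν b w : ℂ) ∂(bergmanMeasure n ν) =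
      (((1 - ‖b‖ ^ 2) ^ (-ν) : ℝ) : ℂ) * (φ b * hHat n ν φ) := by
  have := isProbabilityMeasure_bergmanMeasure hn hν
  simp only [ofReal_kerAvg, ← integral_const_mul]
  rw [integral_integral_swap (f := fun (w : Cn n) (k : Matrix.unitaryGroup (Fin n) ℂ) =>
    φ w * ((‖(1 - inner ℂ (rot k b) w : ℂ)‖ ^ (-(2 * ν)) : ℝ) : ℂ))
    (integrable_symbol_mul_kernel_rot hn hν hφ hb)]
  have h : ∀ k, ∫ w, φ w * ((‖(1 - inner ℂ (rot k b) w : ℂ)‖ ^ (-(2 * ν)) : ℝ) : ℂ)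
      ∂(bergmanMeasure n ν) = (((1 - ‖b‖ ^ 2) ^ (-ν) : ℝ) : ℂ) * (φ b * hHat n ν φ) := by
    intro k
    have hk : ‖rot k b‖ < 1 := by rwa [norm_rot]
    have := hφ.integral_mul_normSq_kernel hn hν hk
    rw [norm_rot, hφ.eq_of_norm_eq hn hk (norm_rot k b)] at this
    rw [← this]
    simp only [norm_one_sub_inner_comm]
  simp only [h, integral_const, probReal_univ, one_smul]

/-- The cocycle rule for the denominator of boost (-a) * boost z, compared with `norm_den_eq`. The
dependence on u is isolated in one kernel based at (boost (-a) * boost z)⁻¹ · 0, a point with the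
same norm as boost (-a) · z. -/
lemma norm_cross {z a u : Cn n} (hz : ‖z‖ < 1) (ha : ‖a‖ < 1) (hu : ‖u‖ < 1) :
    ‖cross z a u‖ = del a * ‖den (boost (-a)) z‖ *
      ‖(1 - inner ℂ u (moebius (boost (-a) * boost z)⁻¹ 0) : ℂ)‖ := by
  have ha' : ‖-a‖ < 1 := by rwa [norm_neg]
  have hδ := del_pos hz
  have hδa := del_pos ha
  have h1 := (norm_den_eq (boost (-a) * boost z) hu.le).1
  rw [den_mul _ _ hu.le, den_mul _ _ (by simp), moebius_boost_zero hz, den_boost hz,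
    den_boost hz, den_boost ha' (moebius (boost z) u), del_neg] at h1
  simp only [inner_zero_right, add_zero, mul_one, norm_mul, norm_inv, Complex.norm_real,
    Real.norm_of_nonneg hδ.le, Real.norm_of_nonneg hδa.le, inner_neg_left, ← sub_eq_add_neg] at h1
  rw [cross_eq hz a hu.le, norm_mul, norm_one_sub_inner_comm (moebius (boost z) u) a]
  have h2 : ‖(1 + inner ℂ u z : ℂ)‖ = ‖(1 + inner ℂ z u : ℂ)‖ := by
    rw [← RCLike.norm_conj, map_add, map_one, inner_conj_symm]
  rw [h2]
  field_simp at h1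
  linear_combination h1

/-- After averaging over k only the norm of the base point in `norm_cross` matters, so it may be
replaced by w = boost (-a) · z. Taking w as the new variable absorbs the factor |den|^(-2ν) and
leaves φ(boost a · w) against the radial function `kerAvg`; the convolution property then splits off
φ(a). -/
lemma IsBoundedSpherical.integral_mul_normSq_cross (hn : 0 < n) (hν : (n : ℝ) < ν)
    (hφ : IsBoundedSpherical n φ) {a b : Cn n} (ha : ‖a‖ < 1) (hb : ‖b‖ < 1) :
    ∫ z, φ z * ∫ k, ((‖cross z a (rot k b)‖ ^ (-(2 * ν)) : ℝ) : ℂ) ∂(haarU n)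
      ∂(bergmanMeasure n ν) =
      (((1 - ‖a‖ ^ 2) ^ (-ν) : ℝ) : ℂ) * φ a *
        ((((1 - ‖b‖ ^ 2) ^ (-ν) : ℝ) : ℂ) * (φ b * hHat n ν φ)) := by
  have := isProbabilityMeasure_bergmanMeasure hn hν
  have hν0 : 0 ≤ ν := (Nat.cast_nonneg n).trans hν.le
  have hδa := del_pos ha
  have ha' : ‖-a‖ < 1 := by rwa [norm_neg]
  have hinv : (boost (-a))⁻¹ = boost a := by rw [boost_neg ha, inv_inv]
  have h1 : ∀ z ∈ unitBall n, φ z * ∫ k, ((‖cross z a (rot k b)‖ ^ (-(2 * ν)) : ℝ) : ℂ) ∂(haarU n) =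
      (((1 - ‖a‖ ^ 2) ^ (-ν) : ℝ) : ℂ) * (‖den (boost (-a)) z‖ ^ (-(2 * ν)) •
        (φ (moebius (boost a) (moebius (boost (-a)) z)) *
          (kerAvg n ν b (moebius (boost (-a)) z) : ℂ))) := by
    intro z hz
    have hz' := mem_unitBall.1 hz
    have e1 : moebius (boost a) (moebius (boost (-a)) z) = z := by
      rw [← hinv, moebius_inv_moebius _ hz'.le]
    have e2 : ‖moebius (boost (-a) * boost z)⁻¹ (0 : Cn n)‖ = ‖moebius (boost (-a)) z‖ := by
      rw [(norm_den_eq (boost (-a) * boost z) (u := 0) (by simp)).2, moebius_mul _ _ (by simp),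
        moebius_boost_zero hz']
    rw [e1, ← kerAvg_congr hn ν b e2, ofReal_kerAvg, Complex.real_smul]
    have e3 : ∀ k, ((‖cross z a (rot k b)‖ ^ (-(2 * ν)) : ℝ) : ℂ) =
        (((1 - ‖a‖ ^ 2) ^ (-ν) : ℝ) : ℂ) * (‖den (boost (-a)) z‖ ^ (-(2 * ν)) : ℝ) *
        ((‖(1 - inner ℂ (rot k b) (moebius (boost (-a) * boost z)⁻¹ 0) : ℂ)‖ ^ (-(2 * ν)) : ℝ) : ℂ) := by
      intro k
      rw [norm_cross hz' ha (by rwa [norm_rot]), Real.mul_rpow (by positivity) (by positivity),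
        Real.mul_rpow hδa.le (by positivity), ← del_sq ha, ← Real.rpow_natCast (del a) 2,
        ← Real.rpow_mul hδa.le]
      push_cast
      congr 4
      ring
    simp only [e3, integral_const_mul]
    ring
  rw [integral_congr_ae (by filter_upwards [ae_mem_unitBall ν] with z hz using h1 z hz),
    integral_const_mul, integral_comp_moebius hν (boost (-a))
      (fun w => φ (moebius (boost a) w) * (kerAvg n ν b w : ℂ)),
    hφ.integral_comp_moebius_mul hn hν (boost a) (C := (1 - ‖b‖) ^ (-(2 * ν)))
      (ψ := fun w => (kerAvg n ν b w : ℂ)), hφ.integral_mul_kerAvg hn hν hb, moebius_boost_zero ha,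
    mul_assoc]
  · simp only [ofReal_kerAvg]
    exact (aestronglyMeasurable_kernel_rot hn hν hb).integral_prod_right'
  · intro z hz
    rw [ofReal_kerAvg]
    refine (norm_integral_le_of_norm_le_const (C := (1 - ‖b‖) ^ (-(2 * ν)))
      (Filter.Eventually.of_forall fun k => ?_)).trans (by simp)
    rw [Complex.norm_real, Real.norm_of_nonneg (by positivity)]
    exact kernel_rot_le hν0 hb (mem_unitBall.1 hz).le k
  · intro k z
    rw [kerAvg_rot]

/-! ### Holomorphic dependence on parameters -/

/-- Cauchy's estimate on discs of radius ε/4 turns the uniform bound on f into the bound C/(ε/4) on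
its derivative, which serves as dominating function. -/
lemma differentiableOn_integral_of_bound {Ω : Type*} [MeasurableSpace Ω] {μ : Measure Ω}
    [IsFiniteMeasure μ] {f : ℂ → Ω → ℂ} {U : Set ℂ} (hU : IsOpen U) {C : ℝ}
    (hm : ∀ β ∈ U, AEStronglyMeasurable (f β) μ)
    (hd : ∀ᵐ ω ∂μ, DifferentiableOn ℂ (fun β => f β ω) U)
    (hb : ∀ᵐ ω ∂μ, ∀ β ∈ U, ‖f β ω‖ ≤ C) :
    DifferentiableOn ℂ (fun β => ∫ ω, f β ω ∂μ) U := by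
  intro β hβ
  obtain ⟨ε, hε, hεU⟩ := Metric.isOpen_iff.1 hU β hβ
  have hsub : ∀ γ ∈ Metric.ball β (ε / 2), Metric.closedBall γ (ε / 4) ⊆ U := by
    intro γ hγ x hx
    apply hεU
    rw [Metric.mem_ball] at hγ ⊢
    rw [Metric.mem_closedBall] at hx
    linarith [dist_triangle x γ β]
  have hball : Metric.ball β (ε / 2) ⊆ U := fun γ hγ =>
    hsub γ hγ (Metric.mem_closedBall_self (by positivity))
  refine (hasDerivAt_integral_of_dominated_loc_of_deriv_le (s := Metric.ball β (ε / 2))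
    (F' := fun γ ω => deriv (fun β => f β ω) γ) (bound := fun _ => C / (ε / 4))
    (Metric.ball_mem_nhds β (by positivity)) ?_ ?_ ?_ ?_ (integrable_const _)
    ?_).2.differentiableAt.differentiableWithinAt
  · filter_upwards [hU.mem_nhds hβ] with γ hγ using hm γ hγ
  · exact Integrable.of_bound (hm β hβ) C (by filter_upwards [hb] with ω hω using hω β hβ)
  -- The derivative is a pointwise limit of difference quotients along u m → 0, hence measurable in
  -- ω; steps of length at most ε/4 keep β + u m in U.
  · set u : ℕ → ℂ := fun m => (ε / 4) * ((m : ℂ) + 1)⁻¹ with hu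
    have hu0 : Filter.Tendsto u Filter.atTop (nhds 0) := by
      have := (tendsto_one_div_add_atTop_nhds_zero_nat (𝕜 := ℂ)).const_mul ((ε : ℂ) / 4)
      simpa [hu] using this
    have hune : ∀ m, u m ≠ 0 := fun m => by
      have h1 : ((m : ℂ) + 1) ≠ 0 := by exact_mod_cast Nat.succ_ne_zero m
      have h2 : (ε : ℂ) ≠ 0 := by exact_mod_cast hε.ne'
      simp only [hu]
      exact mul_ne_zero (div_ne_zero h2 (by norm_num)) (inv_ne_zero h1)
    have huU : ∀ m, β + u m ∈ U := by
      intro m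
      apply hball
      rw [Metric.mem_ball, dist_eq_norm, add_sub_cancel_left, hu]
      have : ‖((m : ℂ) + 1)⁻¹‖ ≤ 1 := by
        rw [norm_inv]
        apply inv_le_one_of_one_le₀
        have : ((m : ℂ) + 1) = ((m + 1 : ℕ) : ℂ) := by push_cast; rfl
        rw [this, Complex.norm_natCast]
        exact_mod_cast Nat.succ_le_succ (Nat.zero_le m)
      rw [norm_mul, norm_div, Complex.norm_real, Real.norm_of_nonneg hε.le]
      have h4 : ‖(4 : ℂ)‖ = 4 := by simp
      rw [h4]
      nlinarith
    refine aestronglyMeasurable_of_tendsto_ae Filter.atTop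
      (f := fun m ω => (u m)⁻¹ • (f (β + u m) ω - f β ω))
      (fun m => ((hm _ (huU m)).sub (hm β hβ)).const_smul (u m)⁻¹) ?_
    filter_upwards [hd] with ω hω
    have h1 := ((hω.differentiableAt (hU.mem_nhds hβ)).hasDerivAt).tendsto_slope_zero
    refine h1.comp (tendsto_nhdsWithin_iff.2 ⟨hu0, Filter.Eventually.of_forall fun m => hune m⟩)
  · filter_upwards [hd, hb] with ω hω hbω γ hγ
    refine Complex.norm_deriv_le_of_forall_mem_sphere_norm_le (by positivity) ?_ ?_
    · apply DifferentiableOn.diffContOnCl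
      rw [closure_ball _ (by positivity)]
      exact hω.mono (hsub γ hγ)
    · exact fun x hx => hbω x (hsub γ hγ (Metric.sphere_subset_closedBall hx))
  · filter_upwards [hd] with ω hω γ hγ
    exact (hω.differentiableAt (hU.mem_nhds (hball hγ))).hasDerivAt

/-- A function holomorphic on an open convex set that vanishes at the real points near `0`
vanishes. -/
lemma eq_zero_of_eq_zero_on_real {f : ℂ → ℂ} {U : Set ℂ} (hU : IsOpen U) (hc : Convex ℝ U)
    (h0 : (0 : ℂ) ∈ U) (hf : DifferentiableOn ℂ f U) (h : ∀ t : ℝ, (t : ℂ) ∈ U → f t = 0)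
    {β : ℂ} (hβ : β ∈ U) : f β = 0 := by
  refine (hf.analyticOnNhd hU).eqOn_zero_of_preconnected_of_frequently_eq_zero hc.isPreconnected h0
    ?_ hβ
  set u : ℕ → ℂ := fun m => (((m : ℝ) + 1)⁻¹ : ℝ) with hu
  have hu0 : Filter.Tendsto u Filter.atTop (nhds 0) := by
    have := (Complex.continuous_ofReal.tendsto 0).comp
      (tendsto_one_div_add_atTop_nhds_zero_nat (𝕜 := ℝ))
    simpa [hu, Function.comp_def] using this
  have hune : ∀ m, u m ≠ 0 := fun m => by
    simp only [hu]; exact_mod_cast inv_ne_zero (by positivity)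
  have h1 : Filter.Tendsto u Filter.atTop (nhdsWithin 0 {0}ᶜ) :=
    tendsto_nhdsWithin_iff.2 ⟨hu0, Filter.Eventually.of_forall fun m => hune m⟩
  refine h1.frequently (Filter.Eventually.frequently ?_)
  filter_upwards [hu0.eventually (hU.mem_nhds h0)] with m hm using h _ hm

end BallQHA
end

noncomputable section
namespace BallQHA

variable {n : ℕ} {ν : ℝ} {φ : Cn n → ℂ}

/-! ### Matrix coefficients of the translation action and the product formula -/

/-- The four terms besides 1 have norm at most 1/4, 1/4, 1/16 and 1/16, uniformly in z. A total
below 1 keeps `cross` in the right half plane, where the principal power is holomorphic. -/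
lemma norm_cross_sub_one_le {z a u : Cn n} (hz : ‖z‖ ≤ 1) (ha : ‖a‖ ≤ 1 / 4) (hu : ‖u‖ ≤ 1 / 4) :
    ‖cross z a u - 1‖ ≤ 5 / 8 := by
  have h1 : ‖(inner ℂ u z : ℂ)‖ ≤ 1 / 4 := (norm_inner_le_norm u z).trans (by
    nlinarith [norm_nonneg u, norm_nonneg z])
  have h2 : ‖(inner ℂ z a : ℂ)‖ ≤ 1 / 4 := (norm_inner_le_norm z a).trans (by
    nlinarith [norm_nonneg a, norm_nonneg z])
  have h3 : ‖(inner ℂ u a : ℂ)‖ ≤ 1 / 16 := (norm_inner_le_norm u a).trans (by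
    nlinarith [norm_nonneg u, norm_nonneg a])
  have h4 : ‖(del z : ℂ) * inner ℂ u a‖ ≤ 1 / 16 := by
    rw [norm_mul, Complex.norm_real, Real.norm_of_nonneg (del_nonneg z)]
    nlinarith [del_le_one z, del_nonneg z, norm_nonneg (inner ℂ u a : ℂ)]
  have h5 : ‖(1 + del z : ℂ)⁻¹ * (inner ℂ z a * inner ℂ u z)‖ ≤ 1 / 16 := by
    have h6 : ‖(1 + del z : ℂ)⁻¹‖ ≤ 1 := by
      have : (1 + del z : ℂ) = ((1 + del z : ℝ) : ℂ) := by push_cast; rfl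
      rw [this, norm_inv, Complex.norm_real, Real.norm_of_nonneg (by linarith [del_nonneg z])]
      exact inv_le_one_of_one_le₀ (by linarith [del_nonneg z])
    rw [norm_mul, norm_mul]
    have h7 : ‖(inner ℂ z a : ℂ)‖ * ‖(inner ℂ u z : ℂ)‖ ≤ 1 / 16 := by
      nlinarith [norm_nonneg (inner ℂ z a : ℂ), norm_nonneg (inner ℂ u z : ℂ)]
    nlinarith [norm_nonneg ((1 + del z : ℂ)⁻¹),
      mul_nonneg (norm_nonneg (inner ℂ z a : ℂ)) (norm_nonneg (inner ℂ u z : ℂ))]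
  have e : cross z a u - 1 = inner ℂ u z - inner ℂ z a - (del z : ℂ) * inner ℂ u a -
    (1 + del z : ℂ)⁻¹ * (inner ℂ z a * inner ℂ u z) := by rw [cross]; ring
  rw [e]
  refine (norm_sub_le _ _).trans ?_
  have := (norm_sub_le (inner ℂ u z - inner ℂ z a) ((del z : ℂ) * inner ℂ u a))
  have := norm_sub_le (inner ℂ u z : ℂ) (inner ℂ z a)
  linarith

lemma re_cross_ge {z a u : Cn n} (hz : ‖z‖ ≤ 1) (ha : ‖a‖ ≤ 1 / 4) (hu : ‖u‖ ≤ 1 / 4) :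
    3 / 8 ≤ (cross z a u).re := by
  have h1 := norm_cross_sub_one_le hz ha hu
  have h2 := (abs_le.1 ((Complex.abs_re_le_norm (cross z a u - 1)).trans h1)).1
  simp only [Complex.sub_re, Complex.one_re] at h2
  linarith

lemma continuous_cross (a : Cn n) : Continuous fun p : Cn n × Cn n => cross p.1 a p.2 := by
  unfold cross
  have hd : Continuous fun p : Cn n × Cn n => (del p.1 : ℂ) :=
    Complex.continuous_ofReal.comp (continuous_del.comp continuous_fst)
  have hi : Continuous fun p : Cn n × Cn n => (1 + del p.1 : ℂ)⁻¹ := by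
    have hs : Continuous fun p : Cn n × Cn n => (1 + del p.1 : ℂ) := continuous_const.add hd
    refine hs.inv₀ fun p => ?_
    exact_mod_cast (by linarith [del_nonneg p.1] : (0 : ℝ) < 1 + del p.1).ne'
  fun_prop

/-- The matrix coefficient of the translation by `boost z * embK k` between the kernel functions
at `b` and `a`, up to a factor independent of `a` and `b`. -/
def coeff (ν : ℝ) (a b : Cn n) (p : Cn n × Matrix.unitaryGroup (Fin n) ℂ) : ℂ :=
  cross p.1 a (rot p.2 b) ^ ((-ν : ℝ) : ℂ)

lemma continuousOn_coeff (ν : ℝ) {a b : Cn n} (ha : ‖a‖ ≤ 1 / 4) (hb : ‖b‖ ≤ 1 / 4) :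
    ContinuousOn (coeff ν a b) (unitBall n ×ˢ univ) := by
  have hc : Continuous fun p : Cn n × Matrix.unitaryGroup (Fin n) ℂ => cross p.1 a (rot p.2 b) :=
    Continuous.comp (g := fun q : Cn n × Cn n => cross q.1 a q.2)
      (f := fun p : Cn n × Matrix.unitaryGroup (Fin n) ℂ => (p.1, rot p.2 b)) (continuous_cross a)
      (continuous_fst.prodMk ((continuous_rot_left b).comp continuous_snd))
  refine hc.continuousOn.cpow_const fun p hp => Or.inl ?_
  have := re_cross_ge (mem_unitBall.1 hp.1).le ha ((norm_rot p.2 b).trans_le hb)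
  linarith

lemma norm_cpow_neg_le (hν : 0 ≤ ν) {s : ℂ} {c : ℝ} (hc : 0 < c) (hs : c ≤ s.re) :
    ‖s ^ ((-ν : ℝ) : ℂ)‖ ≤ c ^ (-ν) := by
  rw [Complex.norm_cpow_real]
  exact Real.rpow_le_rpow_of_nonpos hc (hs.trans (Complex.re_le_norm _)) (by linarith)

lemma norm_coeff_le (hν : 0 ≤ ν) {a b : Cn n} (ha : ‖a‖ ≤ 1 / 4) (hb : ‖b‖ ≤ 1 / 4)
    {p : Cn n × Matrix.unitaryGroup (Fin n) ℂ} (hp : p.1 ∈ unitBall n) :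
    ‖coeff ν a b p‖ ≤ (3 / 8) ^ (-ν) :=
  norm_cpow_neg_le hν (by norm_num)
    (re_cross_ge (mem_unitBall.1 hp).le ha ((norm_rot p.2 b).trans_le hb))

lemma aestronglyMeasurable_coeff (hn : 0 < n) (hν : (n : ℝ) < ν) {a b : Cn n} (ha : ‖a‖ ≤ 1 / 4)
    (hb : ‖b‖ ≤ 1 / 4) :
    AEStronglyMeasurable (coeff ν a b) ((bergmanMeasure n ν).prod (haarU n)) :=
  aestronglyMeasurable_prod_of_continuousOn hn hν (continuousOn_coeff ν ha hb)

lemma aestronglyMeasurable_coeff_mul (hn : 0 < n) (hν : (n : ℝ) < ν)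
    (hφ : IsBoundedSpherical n φ) {a b a' b' : Cn n}
    (ha : ‖a‖ ≤ 1 / 4) (hb : ‖b‖ ≤ 1 / 4) (ha' : ‖a'‖ ≤ 1 / 4) (hb' : ‖b'‖ ≤ 1 / 4) :
    AEStronglyMeasurable (fun p => φ p.1 * (coeff ν a b p * conj (coeff ν a' b' p)))
      ((bergmanMeasure n ν).prod (haarU n)) := by
  have := isProbabilityMeasure_bergmanMeasure hn hν
  refine (aestronglyMeasurable_of_continuousOn hφ.continuousOn).comp_fst.mul
    ((aestronglyMeasurable_coeff hn hν ha hb).mul ?_)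
  exact Complex.continuous_conj.comp_aestronglyMeasurable
    (aestronglyMeasurable_coeff hn hν ha' hb')

lemma norm_symbol_mul_coeff_le (hν : 0 ≤ ν)
    (hφ : IsBoundedSpherical n φ) {a b a' b' : Cn n}
    (ha : ‖a‖ ≤ 1 / 4) (hb : ‖b‖ ≤ 1 / 4) (ha' : ‖a'‖ ≤ 1 / 4) (hb' : ‖b'‖ ≤ 1 / 4)
    {p : Cn n × Matrix.unitaryGroup (Fin n) ℂ} (hp : p.1 ∈ unitBall n) :
    ‖φ p.1 * (coeff ν a b p * conj (coeff ν a' b' p))‖ ≤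
      1 * ((3 / 8) ^ (-ν) * (3 / 8) ^ (-ν)) := by
  rw [norm_mul, norm_mul, RCLike.norm_conj]
  have h1 := norm_coeff_le hν ha hb hp
  have h2 := norm_coeff_le hν ha' hb' hp
  have h3 := hφ.norm_le_one (mem_unitBall.1 hp)
  gcongr

lemma integrable_symbol_mul_coeff (hn : 0 < n) (hν : (n : ℝ) < ν)
    (hφ : IsBoundedSpherical n φ) {a b a' b' : Cn n}
    (ha : ‖a‖ ≤ 1 / 4) (hb : ‖b‖ ≤ 1 / 4) (ha' : ‖a'‖ ≤ 1 / 4) (hb' : ‖b'‖ ≤ 1 / 4) :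
    Integrable (fun p => φ p.1 * (coeff ν a b p * conj (coeff ν a' b' p)))
      ((bergmanMeasure n ν).prod (haarU n)) := by
  have := isProbabilityMeasure_bergmanMeasure hn hν
  refine Integrable.of_bound (aestronglyMeasurable_coeff_mul hn hν hφ ha hb ha' hb')
    (1 * ((3 / 8) ^ (-ν) * (3 / 8) ^ (-ν))) ?_
  filter_upwards [ae_prod_mem hn hν] with p hp
  exact norm_symbol_mul_coeff_le ((Nat.cast_nonneg n).trans hν.le) hφ ha hb ha' hb' hp

/-- The kernel `⟨T_φ K_b, K_a⟩` of the Toeplitz operator with symbol `φ`. -/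
def toepKer (ν : ℝ) (φ : Cn n → ℂ) (a b : Cn n) : ℂ :=
  ∫ w, φ w * bergmanKernel n ν w b * bergmanKernel n ν a w ∂(bergmanMeasure n ν)

lemma IsBoundedSpherical.toepKer_self (hn : 0 < n) (hν : (n : ℝ) < ν)
    (hφ : IsBoundedSpherical n φ) {a : Cn n} (ha : ‖a‖ < 1) :
    toepKer ν φ a a = (((1 - ‖a‖ ^ 2) ^ (-ν) : ℝ) : ℂ) * (φ a * hHat n ν φ) := by
  rw [← hφ.integral_mul_normSq_kernel hn hν ha, toepKer]
  refine integral_congr_ae ?_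
  filter_upwards [ae_mem_unitBall ν] with w hw
  have hw' := mem_unitBall.1 hw
  rw [mul_assoc, ← conj_bergmanKernel ν ha hw'.le, mul_comm (conj _), bergmanKernel_eq,
    cpow_mul_conj_cpow]
  congr 3; ring

/-- Both sides equal (1-|a|²)^(-ν) (1-|b|²)^(-ν) φ(a) φ(b) ĥ²: the left by
`IsBoundedSpherical.integral_mul_normSq_cross`, the right by the diagonal values of the Toeplitz
kernel. -/
lemma product_formula_diag (hn : 0 < n) (hν : (n : ℝ) < ν) (hφ : IsBoundedSpherical n φ)
    {a b : Cn n} (ha : ‖a‖ ≤ 1 / 4) (hb : ‖b‖ ≤ 1 / 4) :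
    hHat n ν φ * ∫ p, φ p.1 * (coeff ν a b p * conj (coeff ν a b p))
      ∂((bergmanMeasure n ν).prod (haarU n)) = toepKer ν φ b b * toepKer ν φ a a := by
  have := isProbabilityMeasure_bergmanMeasure hn hν
  have ha1 : ‖a‖ < 1 := by linarith
  have hb1 : ‖b‖ < 1 := by linarith
  rw [integral_prod _ (integrable_symbol_mul_coeff hn hν hφ ha hb ha hb),
    hφ.toepKer_self hn hν ha1, hφ.toepKer_self hn hν hb1]
  have h := hφ.integral_mul_normSq_cross hn hν ha1 hb1
  have e : ∀ p : Cn n × Matrix.unitaryGroup (Fin n) ℂ, coeff ν a b p * conj (coeff ν a b p) =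
      ((‖cross p.1 a (rot p.2 b)‖ ^ (-(2 * ν)) : ℝ) : ℂ) := by
    intro p
    rw [coeff, cpow_mul_conj_cpow]
    congr 2; ring
  simp only [e, integral_const_mul]
  rw [h]; ring

lemma conj_cross (z a u : Cn n) : conj (cross z a u) =
    1 + inner ℂ z u - inner ℂ a z - (del z : ℂ) * inner ℂ a u -
      (1 + del z : ℂ)⁻¹ * (inner ℂ a z * inner ℂ z u) := by
  simp only [cross, map_sub, map_add, map_mul, map_one, map_inv₀, inner_conj_symm,
    Complex.conj_ofReal]

lemma rot_add_smul (k : Matrix.unitaryGroup (Fin n) ℂ) (b₀ b₁ : Cn n) (c : ℂ) :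
    rot k (b₀ + c • b₁) = rot k b₀ + c • rot k b₁ := by
  rw [rot_add, rot_smul]

lemma differentiable_inner_line (w c d : Cn n) :
    Differentiable ℂ fun β : ℂ => (inner ℂ w (c + β • d) : ℂ) := by
  simp only [inner_add_right, inner_smul_right]
  fun_prop

lemma differentiable_inner_conj_line (w c d : Cn n) :
    Differentiable ℂ fun β : ℂ => (inner ℂ (c + conj β • d) w : ℂ) := by
  simp only [inner_add_left, inner_smul_left, Complex.conj_conj]
  fun_prop

lemma differentiable_inner_both (a₀ a₁ b₀ b₁ : Cn n) :
    Differentiable ℂ fun β : ℂ => (inner ℂ (b₀ + conj β • b₁) (a₀ + β • a₁) : ℂ) := by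
  simp only [inner_add_left, inner_smul_left, Complex.conj_conj, inner_add_right, inner_smul_right]
  fun_prop

/-- β enters the affine slot and conj β the conjugate-affine slot, so the composite is a polynomial
in β of degree at most two. -/
lemma differentiable_cross_line (z a₀ a₁ b₀ b₁ : Cn n) :
    Differentiable ℂ fun β : ℂ => cross z (a₀ + β • a₁) (b₀ + conj β • b₁) := by
  have h1 := differentiable_inner_line z a₀ a₁
  have h2 := differentiable_inner_conj_line z b₀ b₁
  have h3 := differentiable_inner_both a₀ a₁ b₀ b₁
  unfold cross
  fun_prop

lemma differentiable_conj_cross_line (z a₀ a₁ b₀ b₁ : Cn n) :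
    Differentiable ℂ fun β : ℂ => conj (cross z (a₀ + conj β • a₁) (b₀ + β • b₁)) := by
  have h1 := differentiable_inner_line z b₀ b₁
  have h2 := differentiable_inner_conj_line z a₀ a₁
  have h3 := differentiable_inner_both b₀ b₁ a₀ a₁
  simp only [conj_cross]
  fun_prop

lemma differentiableOn_toepKer_line (hn : 0 < n) (hν : (n : ℝ) < ν) (hφ : IsBoundedSpherical n φ)
    (a₀ a₁ b₀ b₁ : Cn n) {U : Set ℂ} (hU : IsOpen U)
    (ha : ∀ β ∈ U, ‖a₀ + β • a₁‖ ≤ 1 / 4) (hb : ∀ β ∈ U, ‖b₀ + conj β • b₁‖ ≤ 1 / 4) :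
    DifferentiableOn ℂ (fun β : ℂ => toepKer ν φ (a₀ + β • a₁) (b₀ + conj β • b₁)) U := by
  have := isProbabilityMeasure_bergmanMeasure hn hν
  have hν0 : 0 ≤ ν := (Nat.cast_nonneg n).trans hν.le
  refine differentiableOn_integral_of_bound hU
    (C := 1 * (1 - 1 / 4) ^ (-ν) * (1 - 1 / 4) ^ (-ν)) ?_ ?_ ?_
  · intro β hβ
    refine ((aestronglyMeasurable_of_continuousOn hφ.continuousOn).mul
      (aestronglyMeasurable_of_continuousOn
        (differentiableOn_bergmanKernel ν ((hb β hβ).trans (by norm_num))).continuousOn)).mul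
      (aestronglyMeasurable_of_continuousOn
        (continuousOn_bergmanKernel_right ν ((ha β hβ).trans_lt (by norm_num))))
  · filter_upwards [ae_mem_unitBall ν] with w hw β hβ
    have hw' := (mem_unitBall.1 hw).le
    simp only [bergmanKernel_eq]
    refine (DifferentiableAt.mul (DifferentiableAt.mul (differentiableAt_const _) ?_)
      ?_).differentiableWithinAt
    · refine DifferentiableAt.cpow_const ((differentiable_inner_conj_line w b₀ b₁ β).const_sub 1)
        (Or.inl ?_)
      exact re_one_sub_inner_pos' hw' ((hb β hβ).trans_lt (by norm_num))
    · refine DifferentiableAt.cpow_const ((differentiable_inner_line w a₀ a₁ β).const_sub 1)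
        (Or.inl ?_)
      exact re_one_sub_inner_pos ((ha β hβ).trans_lt (by norm_num)) hw'
  · filter_upwards [ae_mem_unitBall ν] with w hw β hβ
    have hw' := mem_unitBall.1 hw
    rw [norm_mul, norm_mul]
    have h1 := hφ.norm_le_one hw'
    have h2 := norm_bergmanKernel_le hν0 (by norm_num) (ha β hβ) hw'.le
    have h3 := norm_bergmanKernel_le hν0 (by norm_num) (hb β hβ) hw'.le
    rw [← conj_bergmanKernel ν hw' ((hb β hβ).trans (by norm_num)), RCLike.norm_conj] at h3
    gcongr

/-- The product formula: the matrix coefficients of `T_φ` multiply under the averaging over the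
group against `φ`. -/
lemma product_formula (hn : 0 < n) (hν : (n : ℝ) < ν) (hφ : IsBoundedSpherical n φ)
    {a b a' b' : Cn n}
    (ha : ‖a‖ < 1 / 4) (hb : ‖b‖ < 1 / 4) (ha' : ‖a'‖ < 1 / 4) (hb' : ‖b'‖ < 1 / 4) :
    hHat n ν φ * ∫ p, φ p.1 * (coeff ν a b p * conj (coeff ν a' b' p))
      ∂((bergmanMeasure n ν).prod (haarU n)) = toepKer ν φ b' b * toepKer ν φ a a' := by
  have := isProbabilityMeasure_bergmanMeasure hn hν
  have hν0 : 0 ≤ ν := (Nat.cast_nonneg n).trans hν.le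
  -- Lines through the midpoints, chosen so that β = I recovers a, a', b, b', whereas for real β the
  -- two points on the a-line coincide, as do those on the b-line. The diagonal formula thus holds
  -- at real β and is continued to β = I.
  set a₀ : Cn n := (2⁻¹ : ℂ) • (a + a') with ha0
  set a₁ : Cn n := (-(Complex.I) * 2⁻¹) • (a - a') with ha1
  set b₀ : Cn n := (2⁻¹ : ℂ) • (b + b') with hb0
  set b₁ : Cn n := (-(Complex.I) * 2⁻¹) • (b' - b) with hb1
  have hII : Complex.I * Complex.I = -1 := Complex.I_mul_I
  have ea : a₀ + Complex.I • a₁ = a := by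
    rw [ha0, ha1, smul_smul, ← mul_assoc, mul_neg, hII]; module
  have ea' : a₀ + conj Complex.I • a₁ = a' := by
    rw [ha0, ha1, smul_smul, Complex.conj_I, ← mul_assoc, neg_mul_neg, hII]; module
  have eb : b₀ + conj Complex.I • b₁ = b := by
    rw [hb0, hb1, smul_smul, Complex.conj_I, ← mul_assoc, neg_mul_neg, hII]; module
  have eb' : b₀ + Complex.I • b₁ = b' := by
    rw [hb0, hb1, smul_smul, ← mul_assoc, mul_neg, hII]; module
  have hhalf : ∀ c d : Cn n, ‖c‖ < 1 / 4 → ‖d‖ < 1 / 4 → ‖(2⁻¹ : ℂ) • (c + d)‖ < 1 / 4 := by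
    intro c d hc hd
    rw [norm_smul]
    have h1 := norm_add_le c d
    have h2 : ‖(2⁻¹ : ℂ)‖ = 2⁻¹ := by simp
    rw [h2]; linarith
  set L : ℂ → Cn n → Cn n → Cn n := fun β c d => c + β • d with hL
  have hconvex : ∀ c d : Cn n, Convex ℝ {β : ℂ | ‖c + β • d‖ < 1 / 4} ∧
      Convex ℝ {β : ℂ | ‖c + conj β • d‖ < 1 / 4} := by
    intro c d
    constructor
    · intro x hx y hy s t hs ht hst
      have e : c + (s • x + t • y) • d = s • (c + x • d) + t • (c + y • d) := by
        simp only [Complex.real_smul]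
        have : (s : ℂ) + t = 1 := by exact_mod_cast hst
        calc c + ((s : ℂ) * x + t * y) • d
            = ((s : ℂ) + t) • c + ((s : ℂ) * x + t * y) • d := by rw [this, one_smul]
          _ = (s : ℂ) • (c + x • d) + (t : ℂ) • (c + y • d) := by module
          _ = _ := by simp only [Complex.coe_smul]
      simp only [mem_ofPred_eq] at hx hy ⊢
      rw [e]
      refine (norm_add_le _ _).trans_lt ?_
      rw [norm_smul, norm_smul, Real.norm_of_nonneg hs, Real.norm_of_nonneg ht]
      have : t = 1 - s := by linarith
      rcases hs.eq_or_lt with h | h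
      · rw [← h] at this ⊢; rw [this]; simpa using hy
      · nlinarith
    · intro x hx y hy s t hs ht hst
      have e : c + (conj (s • x + t • y)) • d = s • (c + conj x • d) + t • (c + conj y • d) := by
        simp only [Complex.real_smul, map_add, map_mul, Complex.conj_ofReal]
        have : (s : ℂ) + t = 1 := by exact_mod_cast hst
        calc c + ((s : ℂ) * conj x + t * conj y) • d
            = ((s : ℂ) + t) • c + ((s : ℂ) * conj x + t * conj y) • d := by rw [this, one_smul]
          _ = (s : ℂ) • (c + conj x • d) + (t : ℂ) • (c + conj y • d) := by module
          _ = _ := by simp only [Complex.coe_smul]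
      simp only [mem_ofPred_eq] at hx hy ⊢
      rw [e]
      refine (norm_add_le _ _).trans_lt ?_
      rw [norm_smul, norm_smul, Real.norm_of_nonneg hs, Real.norm_of_nonneg ht]
      have : t = 1 - s := by linarith
      rcases hs.eq_or_lt with h | h
      · rw [← h] at this ⊢; rw [this]; simpa using hy
      · nlinarith
  -- The parameters for which all four moving points stay in the ball of radius 1/4. The set is open
  -- and convex; it contains 0, where the points are the midpoints, and I.
  set U : Set ℂ := ({β : ℂ | ‖a₀ + β • a₁‖ < 1 / 4} ∩ {β : ℂ | ‖a₀ + conj β • a₁‖ < 1 / 4}) ∩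
    ({β : ℂ | ‖b₀ + β • b₁‖ < 1 / 4} ∩ {β : ℂ | ‖b₀ + conj β • b₁‖ < 1 / 4}) with hUdef
  have hUo : IsOpen U := by
    refine ((isOpen_lt ?_ continuous_const).inter (isOpen_lt ?_ continuous_const)).inter
      ((isOpen_lt ?_ continuous_const).inter (isOpen_lt ?_ continuous_const))
    · fun_prop
    · exact (continuous_const.add (Complex.continuous_conj.smul continuous_const)).norm
    · fun_prop
    · exact (continuous_const.add (Complex.continuous_conj.smul continuous_const)).norm
  have hUc : Convex ℝ U := ((hconvex a₀ a₁).1.inter (hconvex a₀ a₁).2).inter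
    ((hconvex b₀ b₁).1.inter (hconvex b₀ b₁).2)
  have h0U : (0 : ℂ) ∈ U := by
    have h1 := hhalf a a' ha ha'
    have h2 := hhalf b b' hb hb'
    refine ⟨⟨?_, ?_⟩, ⟨?_, ?_⟩⟩ <;>
      simp only [mem_ofPred_eq, map_zero, zero_smul, add_zero] <;> assumption
  have hIU : Complex.I ∈ U := by
    refine ⟨⟨?_, ?_⟩, ⟨?_, ?_⟩⟩ <;> simp only [mem_ofPred_eq]
    · rwa [ea]
    · rwa [ea']
    · rwa [eb']
    · rwa [eb]
  set f : ℂ → ℂ := fun β => hHat n ν φ * (∫ p, φ p.1 *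
      (coeff ν (a₀ + β • a₁) (b₀ + conj β • b₁) p *
        conj (coeff ν (a₀ + conj β • a₁) (b₀ + β • b₁) p))
      ∂((bergmanMeasure n ν).prod (haarU n))) -
    toepKer ν φ (b₀ + β • b₁) (b₀ + conj β • b₁) *
      toepKer ν φ (a₀ + β • a₁) (a₀ + conj β • a₁) with hf
  have hfd : DifferentiableOn ℂ f U := by
    refine DifferentiableOn.sub (DifferentiableOn.const_mul ?_ _) (DifferentiableOn.mul ?_ ?_)
    · refine differentiableOn_integral_of_bound hUo
        (C := 1 * ((3 / 8) ^ (-ν) * (3 / 8) ^ (-ν))) ?_ ?_ ?_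
      · exact fun β hβ => aestronglyMeasurable_coeff_mul hn hν hφ hβ.1.1.le hβ.2.2.le hβ.1.2.le
          hβ.2.1.le
      · filter_upwards [ae_prod_mem hn hν] with p hp β hβ
        have hp' := (mem_unitBall.1 hp).le
        have r1 := re_cross_ge (a := a₀ + β • a₁) (u := rot p.2 (b₀ + conj β • b₁)) hp' hβ.1.1.le
          ((norm_rot p.2 _).trans_le hβ.2.2.le)
        have r2 := re_cross_ge (a := a₀ + conj β • a₁) (u := rot p.2 (b₀ + β • b₁)) hp' hβ.1.2.le
          ((norm_rot p.2 _).trans_le hβ.2.1.le)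
        refine DifferentiableWithinAt.const_mul (DifferentiableWithinAt.mul ?_ ?_) _
        · unfold coeff
          simp only [rot_add_smul] at r1 ⊢
          exact ((differentiable_cross_line p.1 a₀ a₁ _ _ β).cpow_const
            (Or.inl (by linarith))).differentiableWithinAt
        -- Conjugation passes inside the principal power because `cross` has positive real part; the
        -- conjugated base is then polynomial in γ.
        · have e : ∀ γ ∈ U, conj (coeff ν (a₀ + conj γ • a₁) (b₀ + γ • b₁) p) =
              (conj (cross p.1 (a₀ + conj γ • a₁) (rot p.2 b₀ + γ • rot p.2 b₁))) ^
                ((-ν : ℝ) : ℂ) := by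
            intro γ hγ
            have r3 := re_cross_ge (a := a₀ + conj γ • a₁) (u := rot p.2 (b₀ + γ • b₁)) hp'
              hγ.1.2.le ((norm_rot p.2 _).trans_le hγ.2.1.le)
            rw [coeff, conj_cpow_ofReal (by linarith), rot_add_smul]
          refine DifferentiableWithinAt.congr ?_ e (e β hβ)
          refine ((differentiable_conj_cross_line p.1 a₀ a₁ _ _ β).cpow_const
            (Or.inl ?_)).differentiableWithinAt
          rw [Complex.conj_re, ← rot_add_smul]
          linarith
      · filter_upwards [ae_prod_mem hn hν] with p hp β hβ
        exact norm_symbol_mul_coeff_le hν0 hφ hβ.1.1.le hβ.2.2.le hβ.1.2.le hβ.2.1.le hp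
    · exact differentiableOn_toepKer_line hn hν hφ b₀ b₁ b₀ b₁ hUo (fun β hβ => hβ.2.1.le)
        fun β hβ => hβ.2.2.le
    · exact differentiableOn_toepKer_line hn hν hφ a₀ a₁ a₀ a₁ hUo (fun β hβ => hβ.1.1.le)
        fun β hβ => hβ.1.2.le
  have hreal : ∀ t : ℝ, (t : ℂ) ∈ U → f t = 0 := by
    intro t ht
    simp only [hf, Complex.conj_ofReal]
    rw [product_formula_diag hn hν hφ ht.1.1.le ht.2.1.le, sub_self]
  have := eq_zero_of_eq_zero_on_real hUo hUc h0U hfd hreal hIU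
  simp only [hf, ea, ea', eb, eb'] at this
  exact sub_eq_zero.1 this

end BallQHA
end

noncomputable section
namespace BallQHA

variable {n : ℕ} {ν : ℝ} {φ : Cn n → ℂ}

/-! ### The norm bound -/

/-- The matrix coefficient of the translation action between two linear combinations of kernel
functions. -/
def coeffSum (ν : ℝ) (s t : Finset (Cn n)) (g f : Cn n → ℂ)
    (p : Cn n × Matrix.unitaryGroup (Fin n) ℂ) : ℂ :=
  ∑ i ∈ s ×ˢ t, conj (g i.1) * f i.2 * coeff ν i.1 i.2 p

/-- The sesquilinear form of the Toeplitz operator on linear combinations of kernel functions. -/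
def toepForm (ν : ℝ) (φ : Cn n → ℂ) (s t : Finset (Cn n)) (g f : Cn n → ℂ) : ℂ :=
  ∑ a ∈ s, ∑ b ∈ t, conj (g a) * f b * toepKer ν φ a b

lemma inner_toeplitz_sum (hn : 0 < n) (hν : (n : ℝ) < ν) (hφ : IsBoundedSpherical n φ)
    {s t : Finset (Cn n)} (hs : ∀ a ∈ s, ‖a‖ < 1 / 4) (ht : ∀ b ∈ t, ‖b‖ < 1 / 4)
    (g f : Cn n → ℂ) :
    inner ℂ (∑ a ∈ s, g a • kerB n ν a)
      (toeplitz hn hν (hφ.memLp_top hn hν).toLp (∑ b ∈ t, f b • kerB n ν b)) =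
      toepForm ν φ s t g f := by
  rw [map_sum, sum_inner, toepForm]
  refine Finset.sum_congr rfl fun a ha => ?_
  rw [inner_sum]
  refine Finset.sum_congr rfl fun b hb => ?_
  rw [map_smul, inner_smul_left (E := bergmanSpace n ν), inner_smul_right (E := bergmanSpace n ν),
    inner_kerB_toeplitz_kerB hn hν _
    ((hs a ha).trans (by norm_num)) ((ht b hb).trans (by norm_num)), toepKer, mul_assoc]

lemma inner_sum_kerB (hn : 0 < n) (hν : (n : ℝ) < ν)
    {s t : Finset (Cn n)} (hs : ∀ a ∈ s, ‖a‖ < 1 / 4) (ht : ∀ b ∈ t, ‖b‖ < 1 / 4)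
    (g f : Cn n → ℂ) :
    inner ℂ (∑ a ∈ s, g a • kerB n ν a) (∑ b ∈ t, f b • kerB n ν b) =
      toepForm ν (fun _ => 1) s t g f := by
  rw [sum_inner, toepForm]
  refine Finset.sum_congr rfl fun a ha => ?_
  rw [inner_sum]
  refine Finset.sum_congr rfl fun b hb => ?_
  rw [inner_smul_left (E := bergmanSpace n ν), inner_smul_right (E := bergmanSpace n ν), mul_assoc,
    toepKer]
  congr 2
  change inner ℂ (kerB n ν a).1 (kerB n ν b).1 = _
  rw [inner_kerB hn hν ((hs a ha).trans (by norm_num))]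
  refine integral_congr_ae ?_
  filter_upwards [coeFn_kerB hn hν ((ht b hb).trans (by norm_num))] with w hw
  rw [hw, one_mul]

/-- Sesquilinear extension of the product formula. The pairing crosses over: the coefficients on the
left join f to g and g' to f', the forms on the right join f to g' and f' to g. -/
lemma product_formula_sum (hn : 0 < n) (hν : (n : ℝ) < ν) (hφ : IsBoundedSpherical n φ)
    {s t s' t' : Finset (Cn n)} (hs : ∀ a ∈ s, ‖a‖ < 1 / 4) (ht : ∀ b ∈ t, ‖b‖ < 1 / 4)
    (hs' : ∀ a ∈ s', ‖a‖ < 1 / 4) (ht' : ∀ b ∈ t', ‖b‖ < 1 / 4) (f g f' g' : Cn n → ℂ) :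
    Integrable (fun p => φ p.1 * (coeffSum ν s t g f p * conj (coeffSum ν t' s' f' g' p)))
      ((bergmanMeasure n ν).prod (haarU n)) ∧
    hHat n ν φ * ∫ p, φ p.1 * (coeffSum ν s t g f p * conj (coeffSum ν t' s' f' g' p))
      ∂((bergmanMeasure n ν).prod (haarU n)) =
      toepForm ν φ s' t g' f * toepForm ν φ s t' g f' := by
  have e : (fun p => φ p.1 * (coeffSum ν s t g f p * conj (coeffSum ν t' s' f' g' p))) =
      fun p => ∑ i ∈ s ×ˢ t, ∑ j ∈ t' ×ˢ s',
        (conj (g i.1) * f i.2 * (f' j.1 * conj (g' j.2))) *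
          (φ p.1 * (coeff ν i.1 i.2 p * conj (coeff ν j.1 j.2 p))) := by
    funext p
    rw [coeffSum, coeffSum, map_sum, Finset.sum_mul_sum, Finset.mul_sum]
    refine Finset.sum_congr rfl fun i _ => ?_
    rw [Finset.mul_sum]
    refine Finset.sum_congr rfl fun j _ => ?_
    simp only [map_mul, Complex.conj_conj]
    ring
  have hi : ∀ i ∈ s ×ˢ t, ∀ j ∈ t' ×ˢ s', Integrable (fun p =>
      (conj (g i.1) * f i.2 * (f' j.1 * conj (g' j.2))) *
          (φ p.1 * (coeff ν i.1 i.2 p * conj (coeff ν j.1 j.2 p))))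
        ((bergmanMeasure n ν).prod (haarU n)) := by
    intro i hi j hj
    rw [Finset.mem_product] at hi hj
    exact (integrable_symbol_mul_coeff hn hν hφ (hs _ hi.1).le (ht _ hi.2).le (ht' _ hj.1).le
      (hs' _ hj.2).le).const_mul _
  rw [e]
  refine ⟨integrable_finsetSum _ fun i h => integrable_finsetSum _ fun j h' => hi i h j h', ?_⟩
  rw [integral_finsetSum _ fun i h => integrable_finsetSum _ fun j h' => hi i h j h',
    Finset.mul_sum]
  have e2 : ∀ i ∈ s ×ˢ t, hHat n ν φ * ∫ p, ∑ j ∈ t' ×ˢ s',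
        (conj (g i.1) * f i.2 * (f' j.1 * conj (g' j.2))) *
          (φ p.1 * (coeff ν i.1 i.2 p * conj (coeff ν j.1 j.2 p)))
          ∂((bergmanMeasure n ν).prod (haarU n)) =
      (∑ b' ∈ s', conj (g' b') * f i.2 * toepKer ν φ b' i.2) *
        ∑ a' ∈ t', conj (g i.1) * f' a' * toepKer ν φ i.1 a' := by
    intro i h
    rw [integral_finsetSum _ fun j h' => hi i h j h', Finset.mul_sum, Finset.sum_mul_sum,
      Finset.sum_product_right]
    refine Finset.sum_congr rfl fun b' hb' => Finset.sum_congr rfl fun a' ha' => ?_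
    rw [Finset.mem_product] at h
    have := product_formula hn hν hφ (hs _ h.1) (ht _ h.2) (ht' _ ha') (hs' _ hb')
    rw [integral_const_mul]
    linear_combination (conj (g i.1) * f i.2 * (f' a' * conj (g' b'))) * this
  rw [Finset.sum_congr rfl e2, Finset.sum_product_right, toepForm, toepForm,
    Finset.sum_comm (s := s'), Finset.sum_mul_sum]

/-- Schur orthogonality: the product formula for the spherical function 1, whose transform is 1 and
whose Toeplitz form is the inner product. -/
lemma toepForm_one_self_integral (hn : 0 < n) (hν : (n : ℝ) < ν)
    {s t : Finset (Cn n)} (hs : ∀ a ∈ s, ‖a‖ < 1 / 4) (ht : ∀ b ∈ t, ‖b‖ < 1 / 4)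
    (g f : Cn n → ℂ) :
    Integrable (fun p => ‖coeffSum ν s t g f p‖ ^ 2) ((bergmanMeasure n ν).prod (haarU n)) ∧
    ∫ p, ‖coeffSum ν s t g f p‖ ^ 2 ∂((bergmanMeasure n ν).prod (haarU n)) =
      ‖∑ b ∈ t, f b • kerB n ν b‖ ^ 2 * ‖∑ a ∈ s, g a • kerB n ν a‖ ^ 2 := by
  have := isProbabilityMeasure_bergmanMeasure hn hν
  obtain ⟨h1, h2⟩ := product_formula_sum hn hν (isBoundedSpherical_one (n := n)) hs ht ht hs f g g f
  have e : ∀ p, (1 : ℂ) * (coeffSum ν s t g f p * conj (coeffSum ν s t g f p)) =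
      ((‖coeffSum ν s t g f p‖ ^ 2 : ℝ) : ℂ) := by
    intro p; rw [one_mul, Complex.mul_conj, Complex.normSq_eq_norm_sq]
  simp only [e] at h1 h2
  refine ⟨by simpa only [RCLike.re_to_complex, Complex.ofReal_re] using h1.re, ?_⟩
  rw [integral_complex_ofReal, hHat_eq_integral hν, integral_const, probReal_univ,
    ← inner_sum_kerB hn hν ht ht, ← inner_sum_kerB hn hν hs hs,
    inner_self_eq_norm_sq_to_K (𝕜 := ℂ) (∑ b ∈ t, f b • kerB n ν b),
    inner_self_eq_norm_sq_to_K (𝕜 := ℂ) (∑ a ∈ s, g a • kerB n ν a)] at h2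
  simp only [one_smul, one_mul] at h2
  apply Complex.ofReal_injective
  rw [h2]
  push_cast
  rfl

/-- With f' = f and g' = g the product formula computes the square of ⟨T_φ f, g⟩. Then |φ| ≤ 1 and
xy ≤ (x² + y²)/2 suffice: both squares integrate to the same ‖f‖²‖g‖², so nothing is lost against
Cauchy–Schwarz. -/
lemma norm_inner_toeplitz_sum_le (hn : 0 < n) (hν : (n : ℝ) < ν) (hφ : IsBoundedSpherical n φ)
    {s t : Finset (Cn n)} (hs : ∀ a ∈ s, ‖a‖ < 1 / 4) (ht : ∀ b ∈ t, ‖b‖ < 1 / 4)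
    (g f : Cn n → ℂ) :
    ‖inner ℂ (∑ a ∈ s, g a • kerB n ν a)
      (toeplitz hn hν (hφ.memLp_top hn hν).toLp (∑ b ∈ t, f b • kerB n ν b))‖ ^ 2 ≤
    ‖hHat n ν φ‖ * (‖∑ b ∈ t, f b • kerB n ν b‖ ^ 2 * ‖∑ a ∈ s, g a • kerB n ν a‖ ^ 2) := by
  obtain ⟨-, h⟩ := product_formula_sum hn hν hφ hs ht hs ht f g f g
  obtain ⟨i1, e1⟩ := toepForm_one_self_integral hn hν hs ht g f
  obtain ⟨i2, e2⟩ := toepForm_one_self_integral hn hν ht hs f g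
  rw [inner_toeplitz_sum hn hν hφ hs ht, ← norm_pow, sq, ← h, norm_mul]
  refine mul_le_mul_of_nonneg_left ?_ (norm_nonneg _)
  refine (norm_integral_le_of_norm_le ((i1.add i2).const_mul (1 / 2)) ?_).trans ?_
  · filter_upwards [ae_prod_mem hn hν] with p hp
    have h3 := hφ.norm_le_one (mem_unitBall.1 hp)
    rw [norm_mul, norm_mul, RCLike.norm_conj, Pi.add_apply]
    have h4 : 0 ≤ ‖coeffSum ν s t g f p‖ * ‖coeffSum ν t s f g p‖ := by positivity
    nlinarith [sq_nonneg (‖coeffSum ν s t g f p‖ - ‖coeffSum ν t s f g p‖)]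
  · rw [integral_const_mul, integral_add' i1 i2, e1, e2]
    apply le_of_eq; ring

lemma norm_inner_toeplitz_le (hn : 0 < n) (hν : (n : ℝ) < ν) (hφ : IsBoundedSpherical n φ)
    (f g : bergmanSpace n ν) :
    ‖inner ℂ g (toeplitz hn hν (hφ.memLp_top hn hν).toLp f)‖ ^ 2 ≤
      ‖hHat n ν φ‖ * (‖f‖ ^ 2 * ‖g‖ ^ 2) := by
  have hd : Dense (Submodule.span ℂ (kerB n ν '' Metric.ball 0 (1 / 4)) :
      Set (bergmanSpace n ν)) := by
    rw [Submodule.dense_iff_topologicalClosure_eq_top]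
    exact dense_span_kerB hn hν (by norm_num)
  have hspan : ∀ f ∈ Submodule.span ℂ (kerB n ν '' Metric.ball 0 (1 / 4)),
      ∃ (s : Finset (Cn n)) (c : Cn n → ℂ), (∀ a ∈ s, ‖a‖ < 1 / 4) ∧
        ∑ a ∈ s, c a • kerB n ν a = f := by
    intro f hf
    rw [Finsupp.mem_span_image_iff_linearCombination] at hf
    obtain ⟨l, hl, rfl⟩ := hf
    refine ⟨l.support, l, fun a ha => ?_, (Finsupp.linearCombination_apply ℂ l).symm⟩
    have := (Finsupp.mem_supported ℂ l).1 hl ha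
    simpa using this
  refine hd.denseRange_val.induction_on₂ (p := fun f g =>
    ‖inner ℂ g (toeplitz hn hν (hφ.memLp_top hn hν).toLp f)‖ ^ 2 ≤
      ‖hHat n ν φ‖ * (‖f‖ ^ 2 * ‖g‖ ^ 2)) ?_ ?_ f g
  · refine isClosed_le ((Continuous.inner (𝕜 := ℂ) (E := bergmanSpace n ν) continuous_snd
      ((ContinuousLinearMap.continuous _).comp continuous_fst)).norm.pow 2) (by fun_prop)
  · rintro ⟨f, hf⟩ ⟨g, hg⟩
    obtain ⟨t, c, ht, rfl⟩ := hspan f hf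
    obtain ⟨s, d, hs, rfl⟩ := hspan g hg
    exact norm_inner_toeplitz_sum_le hn hν hφ hs ht d c

lemma norm_toeplitz_le (hn : 0 < n) (hν : (n : ℝ) < ν) (hφ : IsBoundedSpherical n φ) :
    ‖toeplitz hn hν (hφ.memLp_top hn hν).toLp‖ ≤ √‖hHat n ν φ‖ := by
  refine ContinuousLinearMap.opNorm_le_bound _ (Real.sqrt_nonneg _) fun f => ?_
  set T := toeplitz hn hν (hφ.memLp_top hn hν).toLp
  have h := norm_inner_toeplitz_le hn hν hφ f (T f)
  rw [inner_self_eq_norm_sq_to_K (𝕜 := ℂ) (T f)] at h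
  simp only [norm_pow, RCLike.norm_ofReal, abs_norm] at h
  rcases (norm_nonneg (T f)).eq_or_lt with h0 | h0
  · rw [← h0]; positivity
  · have h1 : ‖T f‖ ^ 2 ≤ ‖hHat n ν φ‖ * ‖f‖ ^ 2 := by
      have : 0 < ‖T f‖ ^ 2 := by positivity
      refine le_of_mul_le_mul_right ?_ this
      nlinarith
    rw [← Real.sqrt_sq (norm_nonneg f), ← Real.sqrt_mul (norm_nonneg _)]
    exact Real.le_sqrt_of_sq_le h1

end BallQHA
end

noncomputable section
namespace BallQHA

variable {n : ℕ} {ν : ℝ} {φ : Cn n → ℂ}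

/-! ### Nonvanishing of the spherical transform -/

lemma exists_norm_le_of_continuous {G : Cn n → ℂ} (hG : Continuous G) :
    ∃ C, ∀ z ∈ unitBall n, ‖G z‖ ≤ C := by
  obtain ⟨C, hC⟩ := (isCompact_closedBall (0 : Cn n) 1).exists_bound_of_continuousOn hG.continuousOn
  exact ⟨C, fun z hz => hC z (Metric.ball_subset_closedBall hz)⟩

lemma memLp_of_continuous (hn : 0 < n) (hν : (n : ℝ) < ν) {G : Cn n → ℂ} (hG : Continuous G)
    (p : ENNReal) : MemLp G p (bergmanMeasure n ν) := by
  have := isProbabilityMeasure_bergmanMeasure hn hν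
  obtain ⟨C, hC⟩ := exists_norm_le_of_continuous hG
  exact MemLp.of_bound (aestronglyMeasurable_of_continuousOn hG.continuousOn) C
    ((ae_mem_unitBall ν).mono hC)

lemma integrable_symbol_mul_of_continuous (hn : 0 < n) (hν : (n : ℝ) < ν)
    (hφ : MemLp φ ⊤ (bergmanMeasure n ν)) {G : Cn n → ℂ} (hG : Continuous G) :
    Integrable (fun z => φ z * G z) (bergmanMeasure n ν) :=
  memLp_one_iff_integrable.1 ((memLp_of_continuous hn hν hG 1).mul hφ)

/-- The products `p · conj q` of restrictions to the closed ball of entire functions. -/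
def polyProducts (n : ℕ) : Set C(Metric.closedBall (0 : Cn n) 1, ℂ) :=
  {F | ∃ p q : Cn n → ℂ, Differentiable ℂ p ∧ Differentiable ℂ q ∧ ∀ z, F z = p z * conj (q z)}

/-- The star algebra spanned by the products `p · conj q`. -/
def polyAlgebra (n : ℕ) : StarSubalgebra ℂ C(Metric.closedBall (0 : Cn n) 1, ℂ) where
  toSubalgebra := (Submodule.span ℂ (polyProducts n)).toSubalgebra
    (Submodule.subset_span ⟨1, 1, differentiable_const _, differentiable_const _, fun z => by simp⟩)
    (fun x y hx hy => by
      have h := Submodule.mul_mem_mul hx hy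
      rw [Submodule.span_mul_span] at h
      refine Submodule.span_mono ?_ h
      rintro _ ⟨F, ⟨p, q, hp, hq, hF⟩, F', ⟨p', q', hp', hq', hF'⟩, rfl⟩
      refine ⟨p * p', q * q', hp.mul hp', hq.mul hq', fun z => ?_⟩
      simp only [ContinuousMap.mul_apply, hF, hF', Pi.mul_apply, map_mul]
      ring)
  star_mem' := by
    intro a ha
    have ha' : a ∈ Submodule.span ℂ (polyProducts n) := ha
    change star a ∈ Submodule.span ℂ (polyProducts n)
    induction ha' using Submodule.span_induction with
    | mem F hF =>
      obtain ⟨p, q, hp, hq, hF⟩ := hF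
      refine Submodule.subset_span ⟨q, p, hq, hp, fun z => ?_⟩
      rw [ContinuousMap.star_apply, hF]
      simp [mul_comm]
    | zero => simp
    | add x y _ _ hx hy => rw [star_add]; exact add_mem (hx ‹_›) (hy ‹_›)
    | smul c x _ hx => rw [star_smul]; exact Submodule.smul_mem _ _ (hx ‹_›)

/-- Stone–Weierstrass: coordinate functions, taken with q = 1, separate points. -/
lemma dense_polyAlgebra (n : ℕ) : (polyAlgebra n).topologicalClosure = ⊤ := by
  refine ContinuousMap.starSubalgebra_topologicalClosure_eq_top_of_separatesPoints _ ?_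
  intro x y hxy
  obtain ⟨i, hi⟩ : ∃ i, x.1 i ≠ y.1 i := by
    by_contra! h
    exact hxy (Subtype.ext (PiLp.ext h))
  have hd : Differentiable ℂ fun z : Cn n => z i := by fun_prop
  refine ⟨_, ⟨⟨fun z => z.1 i, hd.continuous.comp continuous_subtype_val⟩,
    Submodule.subset_span ⟨fun z => z i, 1, hd, differentiable_const _, fun z => ?_⟩, rfl⟩, hi⟩
  simp

/-- G is uniformly approximated on the closed ball by the span of the products p · conj q; since |φ|
≤ 1 and μ_ν has mass one, a uniform error ε changes the integral by at most ε. -/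
lemma integral_mul_eq_zero_of_continuous (hn : 0 < n) (hν : (n : ℝ) < ν)
    (hφ : MemLp φ ⊤ (bergmanMeasure n ν)) (hφ1 : ∀ z ∈ unitBall n, ‖φ z‖ ≤ 1)
    (h0 : ∀ p q : Cn n → ℂ, Differentiable ℂ p → Differentiable ℂ q →
      ∫ z, φ z * (p z * conj (q z)) ∂(bergmanMeasure n ν) = 0)
    {G : Cn n → ℂ} (hG : Continuous G) : ∫ z, φ z * G z ∂(bergmanMeasure n ν) = 0 := by
  have := isProbabilityMeasure_bergmanMeasure hn hν
  have hM : ∀ F ∈ Submodule.span ℂ (polyProducts n), ∃ G : Cn n → ℂ, Continuous G ∧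
      (∀ z, F z = G z) ∧ ∫ z, φ z * G z ∂(bergmanMeasure n ν) = 0 := by
    intro F hF
    induction hF using Submodule.span_induction with
    | mem F hF =>
      obtain ⟨p, q, hp, hq, hF⟩ := hF
      exact ⟨_, hp.continuous.mul (Complex.continuous_conj.comp hq.continuous), hF, h0 p q hp hq⟩
    | zero => exact ⟨0, continuous_const, fun z => rfl, by simp⟩
    | add x y _ _ hx hy =>
      obtain ⟨G₁, c₁, e₁, i₁⟩ := hx
      obtain ⟨G₂, c₂, e₂, i₂⟩ := hy
      refine ⟨fun z => G₁ z + G₂ z, c₁.add c₂, fun z => by simp [e₁, e₂], ?_⟩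
      simp only [mul_add]
      rw [integral_add (integrable_symbol_mul_of_continuous hn hν hφ c₁)
        (integrable_symbol_mul_of_continuous hn hν hφ c₂), i₁, i₂, add_zero]
    | smul c x _ hx =>
      obtain ⟨G₁, c₁, e₁, i₁⟩ := hx
      refine ⟨fun z => c * G₁ z, continuous_const.mul c₁, fun z => by simp [e₁], ?_⟩
      simp only [mul_left_comm _ c]
      rw [integral_const_mul, i₁, mul_zero]
  rw [← norm_le_zero_iff]
  refine le_of_forall_pos_le_add fun ε hε => ?_
  set F : C(Metric.closedBall (0 : Cn n) 1, ℂ) := ⟨fun z => G z, hG.comp continuous_subtype_val⟩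
  have hF : F ∈ closure (polyAlgebra n : Set C(Metric.closedBall (0 : Cn n) 1, ℂ)) := by
    have : F ∈ (polyAlgebra n).topologicalClosure := by rw [dense_polyAlgebra]; trivial
    exact this
  obtain ⟨F', hF', hd⟩ := Metric.mem_closure_iff.1 hF ε hε
  obtain ⟨G', c', e', i'⟩ := hM F' hF'
  rw [← sub_zero (∫ z, φ z * G z ∂(bergmanMeasure n ν)), ← i',
    ← integral_sub (integrable_symbol_mul_of_continuous hn hν hφ hG)
    (integrable_symbol_mul_of_continuous hn hν hφ c'), zero_add]
  refine (norm_integral_le_of_norm_le_const (C := ε) ?_).trans (by simp)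
  filter_upwards [ae_mem_unitBall ν] with z hz
  rw [← mul_sub, norm_mul]
  have h1 := (F.dist_apply_le_dist (g := F') ⟨z, Metric.ball_subset_closedBall hz⟩).trans hd.le
  rw [e', dist_eq_norm] at h1
  have h2 := hφ1 z hz
  have h3 : ‖G z - G' z‖ ≤ ε := h1
  nlinarith [norm_nonneg (G z - G' z), norm_nonneg (φ z)]

/-- Otherwise φ would differ from c on a nonempty open subset of the ball, which has positive
measure. -/
lemma eqOn_of_ae_eq_const (hν : (n : ℝ) < ν) (hφ : IsBoundedSpherical n φ) {c : ℂ}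
    (h : ∀ᵐ z ∂(bergmanMeasure n ν), φ z = c) {z : Cn n} (hz : z ∈ unitBall n) : φ z = c := by
  by_contra hne
  have ho : IsOpen (unitBall n ∩ φ ⁻¹' {c}ᶜ) :=
    hφ.continuousOn.isOpen_inter_preimage isOpen_unitBall isOpen_compl_singleton
  refine bergmanMeasure_pos hν ho ⟨z, ⟨hz, hne⟩, hz⟩ (measure_mono_null ?_ h)
  exact fun w hw => hw.2

/-- The Bergman space class of an entire function. -/
lemma exists_bergmanSpace_of_differentiable (hn : 0 < n) (hν : (n : ℝ) < ν) {p : Cn n → ℂ}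
    (hp : Differentiable ℂ p) : ∃ f : bergmanSpace n ν, f.1 =ᵐ[bergmanMeasure n ν] p :=
  ⟨⟨(memLp_of_continuous hn hν hp.continuous 2).toLp, p, hp.differentiableOn,
    MemLp.coeFn_toLp _⟩, MemLp.coeFn_toLp (memLp_of_continuous hn hν hp.continuous 2)⟩

/-- If the transform vanished, the norm bound would give T_φ = 0, making φ orthogonal to every p ·
conj q with p, q entire. By density φ would vanish almost everywhere, hence everywhere on the ball,
although φ(0) = 1. -/
lemma hHat_ne_zero (hn : 0 < n) (hν : (n : ℝ) < ν) (hφ : IsBoundedSpherical n φ) :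
    hHat n ν φ ≠ 0 := by
  intro hH
  have := isProbabilityMeasure_bergmanMeasure hn hν
  have hL := hφ.memLp_top hn hν
  have hT := norm_toeplitz_le hn hν hφ
  rw [hH, norm_zero, Real.sqrt_zero] at hT
  have hT0 : ∀ f, toeplitz hn hν hL.toLp f = 0 := fun f =>
    norm_le_zero_iff.1 (((toeplitz hn hν hL.toLp).le_of_opNorm_le hT f).trans (zero_mul _).le)
  have h0 : ∀ p q : Cn n → ℂ, Differentiable ℂ p → Differentiable ℂ q →
      ∫ z, φ z * (p z * conj (q z)) ∂(bergmanMeasure n ν) = 0 := by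
    intro p q hp hq
    obtain ⟨f, hf⟩ := exists_bergmanSpace_of_differentiable hn hν hp
    obtain ⟨g, hg⟩ := exists_bergmanSpace_of_differentiable hn hν hq
    have h := inner_toeplitz hn hν hL f g
    rw [hT0, inner_zero_right (E := bergmanSpace n ν)] at h
    rw [h]
    refine integral_congr_ae ?_
    filter_upwards [hf, hg] with z h1 h2
    rw [h1, h2, mul_assoc]
  have h1 : ∀ᵐ z ∂(bergmanMeasure n ν), φ z = 0 := by
    refine ae_eq_zero_of_integral_contDiff_smul_eq_zero
      (hL.integrable le_top).locallyIntegrable fun g hg _ => ?_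
    rw [← integral_mul_eq_zero_of_continuous hn hν hL
      (fun z hz => hφ.norm_le_one (mem_unitBall.1 hz)) h0
      (G := fun z => (g z : ℂ)) (Complex.continuous_ofReal.comp hg.continuous)]
    refine integral_congr_ae (Filter.Eventually.of_forall fun z => ?_)
    simp only [Complex.real_smul, mul_comm]
  have h2 := eqOn_of_ae_eq_const hν hφ h1 (z := 0) (mem_unitBall.2 (by simp))
  rw [hφ.apply_zero] at h2
  exact one_ne_zero h2

lemma norm_hHat_le_one (hn : 0 < n) (hν : (n : ℝ) < ν) (hφ : IsBoundedSpherical n φ) :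
    ‖hHat n ν φ‖ ≤ 1 := by
  have := isProbabilityMeasure_bergmanMeasure hn hν
  rw [hHat_eq_integral hν]
  refine (norm_integral_le_of_norm_le_const (C := 1) ?_).trans (by simp)
  exact (ae_mem_unitBall ν).mono fun z hz => hφ.norm_le_one (mem_unitBall.1 hz)

/-- If the mean H of φ had modulus one, the nonnegative function 1 - Re(φ conj H) would have
integral zero. Together with |φ conj H| ≤ 1 this gives φ = H almost everywhere, hence everywhere on
the ball, and the constant is φ(0) = 1. -/
lemma norm_hHat_lt_one (hn : 0 < n) (hν : (n : ℝ) < ν) (hφ : IsBoundedSpherical n φ)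
    (hne : ∃ z ∈ unitBall n, φ z ≠ 1) : ‖hHat n ν φ‖ < 1 := by
  refine lt_of_le_of_ne (norm_hHat_le_one hn hν hφ) fun h1 => ?_
  have := isProbabilityMeasure_bergmanMeasure hn hν
  set H := hHat n ν φ with hH
  have hi : Integrable φ (bergmanMeasure n ν) := (hφ.memLp_top hn hν).integrable le_top
  have hHH : H * conj H = 1 := by
    rw [Complex.mul_conj, Complex.normSq_eq_norm_sq, h1]; simp
  have hic : Integrable (fun z => 1 - (φ z * conj H).re) (bergmanMeasure n ν) :=
    (integrable_const 1).sub (hi.mul_const (conj H)).re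
  have hle : ∀ z ∈ unitBall n, ‖φ z * conj H‖ ≤ 1 := by
    intro z hz
    rw [norm_mul, RCLike.norm_conj, h1, mul_one]
    exact hφ.norm_le_one (mem_unitBall.1 hz)
  have hint : ∫ z, (1 - (φ z * conj H).re) ∂(bergmanMeasure n ν) = 0 := by
    have h3 : Integrable (fun z => (φ z * conj H).re) (bergmanMeasure n ν) :=
      (hi.mul_const (conj H)).re
    rw [integral_sub (integrable_const 1) h3]
    have h2 := integral_re (hi.mul_const (conj H))
    rw [integral_mul_const, ← hHat_eq_integral hν, ← hH, hHH] at h2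
    simp only [RCLike.re_to_complex, Complex.one_re] at h2
    rw [h2]; simp
  rw [integral_eq_zero_iff_of_nonneg_ae _ hic] at hint
  · have h3 : ∀ᵐ z ∂(bergmanMeasure n ν), φ z = H := by
      filter_upwards [hint, ae_mem_unitBall ν] with z h4 hz
      have h5 : (φ z * conj H).re = 1 := by
        have : 1 - (φ z * conj H).re = 0 := h4
        linarith
      have h6 : φ z * conj H = 1 := by
        have h7 := hle z hz
        have h8 : ‖φ z * conj H‖ ^ 2 ≤ 1 := pow_le_one₀ (norm_nonneg _) h7
        rw [← Complex.normSq_eq_norm_sq, Complex.normSq_apply, h5] at h8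
        apply Complex.ext
        · exact h5
        · have : (φ z * conj H).im ^ 2 = 0 := le_antisymm (by nlinarith) (sq_nonneg _)
          simpa using this
      calc φ z = φ z * (H * conj H) := by rw [hHH, mul_one]
        _ = H * (φ z * conj H) := by ring
        _ = H := by rw [h6, mul_one]
    have h4 := eqOn_of_ae_eq_const hν hφ h3 (z := 0) (mem_unitBall.2 (by simp))
    rw [hφ.apply_zero] at h4
    obtain ⟨z, hz, hne⟩ := hne
    exact hne ((eqOn_of_ae_eq_const hν hφ h3 hz).trans h4.symm)
  · filter_upwards [ae_mem_unitBall ν] with z hz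
    have := (Complex.re_le_norm _).trans (hle z hz)
    simpa using this

theorem exists_toeplitz (hn : 0 < n) (hν : (n : ℝ) < ν) (hφ : IsBoundedSpherical n φ) :
    hHat n ν φ ≠ 0 ∧
      ∃ T : bergmanSpace n ν →L[ℂ] bergmanSpace n ν,
        IsToeplitz n ν φ T ∧
        (∀ s : ℂ, s ^ 2 = hHat n ν φ → ‖s⁻¹ • T‖ ≤ 1) ∧
        ‖T‖ ≤ ‖hHat n ν φ‖ ^ (1 / 2 : ℝ) ∧
        ‖hHat n ν φ‖ ^ (1 / 2 : ℝ) ≤ 1 ∧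
        ((∃ z ∈ unitBall n, φ z ≠ 1) → ‖hHat n ν φ‖ ^ (1 / 2 : ℝ) < 1) := by
  have hT := norm_toeplitz_le hn hν hφ
  have h0 := hHat_ne_zero hn hν hφ
  refine ⟨h0, _, isToeplitz_toeplitz hn hν (hφ.memLp_top hn hν), ?_, ?_, ?_, ?_⟩
  · intro s hs
    have h1 : ‖s‖ = √‖hHat n ν φ‖ := by
      rw [← hs, norm_pow, Real.sqrt_sq (norm_nonneg _)]
    have hs0 : s ≠ 0 := by rintro rfl; apply h0; rw [← hs]; simp
    refine (ContinuousLinearMap.opNorm_smul_le _ _).trans ?_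
    rw [norm_inv, h1]
    have h2 : 0 < √‖hHat n ν φ‖ := by rw [← h1]; exact norm_pos_iff.2 hs0
    exact (mul_le_mul_of_nonneg_left hT (inv_nonneg.2 h2.le)).trans (inv_mul_cancel₀ h2.ne').le
  · rwa [← Real.sqrt_eq_rpow]
  · exact Real.rpow_le_one (norm_nonneg _) (norm_hHat_le_one hn hν hφ) (by norm_num)
  · exact fun h => Real.rpow_lt_one (norm_nonneg _) (norm_hHat_lt_one hn hν hφ h) (by norm_num)

end BallQHA
end

noncomputable section
namespace BallQHA

variable {n : ℕ} {ν : ℝ} {φ : Cn n → ℂ}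

/-! ### The binomial series -/

/-- The coefficient `(s)_j / j!` of the binomial series of `(1 - w)^(-s)`. -/
def binomCoeff (s : ℂ) (j : ℕ) : ℂ := (ascPochhammer ℂ j).eval s / j.factorial

lemma hasSum_binomCoeff (s : ℂ) {w : ℂ} (hw : ‖w‖ < 1) :
    HasSum (fun j => binomCoeff s j * w ^ j) ((1 - w) ^ (-s)) := by
  have h := (Complex.one_div_one_sub_cpow_hasFPowerSeriesOnBall_zero s).hasSum (y := w) (by
    rw [Metric.mem_eball, edist_zero_right, enorm_eq_nnnorm]
    exact_mod_cast hw)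
  simp only [FormalMultilinearSeries.ofScalars_apply_eq, zero_add, smul_eq_mul] at h
  rw [Complex.cpow_neg, ← one_div]
  have e : ∀ j : ℕ, binomCoeff s j = Ring.choose (s + j - 1) j := by
    intro j
    rw [binomCoeff, div_eq_iff (by exact_mod_cast j.factorial_ne_zero), Ring.choose]
    have := Ring.factorial_nsmul_multichoose_eq_ascPochhammer s j
    rw [Polynomial.ascPochhammer_smeval_eq_eval, nsmul_eq_mul] at this
    rw [← this, mul_comm]
    congr 2
    ring
  simp only [e]
  exact h

lemma summable_norm_binomCoeff (s : ℂ) {ρ : ℝ} (h0 : 0 ≤ ρ) (h1 : ρ < 1) :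
    Summable fun j => ‖binomCoeff s j‖ * ρ ^ j := by
  have h := (hasSum_binomCoeff s (w := (ρ : ℂ)) (by
    rwa [Complex.norm_real, Real.norm_of_nonneg h0])).summable.norm
  simpa only [norm_mul, norm_pow, Complex.norm_real, Real.norm_of_nonneg h0] using h

/-! ### Moments of the coordinates on the sphere -/

lemma exists_pow_mul_conj_pow_eq_neg_one {j l : ℕ} (h : j ≠ l) :
    ∃ c : ℂ, ‖c‖ = 1 ∧ c ^ j * conj c ^ l = -1 := by
  -- For c = exp(iθ) the product is exp(i(j-l)θ), so θ = π/(j-l) gives -1.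
  refine ⟨Complex.exp ((Real.pi / ((j : ℝ) - l) : ℝ) * Complex.I),
    Complex.norm_exp_ofReal_mul_I _, ?_⟩
  have h0 : (j : ℂ) - l ≠ 0 := sub_ne_zero.2 (by exact_mod_cast h)
  rw [← Complex.exp_conj, ← Complex.exp_nat_mul, ← Complex.exp_nat_mul, ← Complex.exp_add,
    ← Complex.exp_pi_mul_I]
  congr 1
  simp only [map_mul, Complex.conj_ofReal, Complex.conj_I]
  push_cast
  field_simp
  ring

lemma eq_zero_of_forall_smul {I : ℂ} {j l : ℕ} (h : j ≠ l)
    (hI : ∀ c : ℂ, ‖c‖ = 1 → I = c ^ j * conj c ^ l * I) : I = 0 := by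
  obtain ⟨c, hc, h1⟩ := exists_pow_mul_conj_pow_eq_neg_one h
  have := hI c hc
  rw [h1] at this
  linear_combination this / 2

lemma integral_rot_inner_pow_mul_eq_zero (hn : 0 < n) {j l : ℕ} (h : j ≠ l) (e z : Cn n) :
    ∫ k, inner ℂ e (rot k z) ^ j * conj (inner ℂ e (rot k z)) ^ l ∂(haarU n) = 0 := by
  refine eq_zero_of_forall_smul h fun c hc => ?_
  rw [← integral_const_mul, integral_rot_congr hn
    (fun w => inner ℂ e w ^ j * conj (inner ℂ e w) ^ l) (z := z) (w := c • z)
    (by rw [norm_smul, hc, one_mul])]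
  refine integral_congr_ae (Filter.Eventually.of_forall fun k => ?_)
  simp only [rot_smul, inner_smul_right, map_mul, mul_pow]
  ring

lemma integral_inner_pow_mul_eq_zero (hν : (n : ℝ) < ν) {j l : ℕ} (h : j ≠ l) (e : Cn n) :
    ∫ w, inner ℂ e w ^ j * conj (inner ℂ e w) ^ l ∂(bergmanMeasure n ν) = 0 := by
  refine eq_zero_of_forall_smul h fun c hc => ?_
  obtain ⟨k, hk⟩ := exists_rot_eq_smul (n := n) hc
  rw [← integral_const_mul, ← integral_comp_rot hν k]
  refine integral_congr_ae (Filter.Eventually.of_forall fun w => ?_)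
  simp only [hk, inner_smul_right, map_mul, mul_pow]
  ring

lemma pow_mul_conj_pow_self (x : ℂ) (j : ℕ) : x ^ j * conj x ^ j = ((‖x‖ ^ (2 * j) : ℝ) : ℂ) := by
  rw [← mul_pow, Complex.mul_conj, Complex.normSq_eq_norm_sq, pow_mul]
  push_cast; rfl

lemma norm_inner_le_one {e w : Cn n} (he : ‖e‖ = 1) (hw : ‖w‖ ≤ 1) : ‖(inner ℂ e w : ℂ)‖ ≤ 1 :=
  (norm_inner_le_norm e w).trans (by rw [he, one_mul]; exact hw)

lemma natCast_lt_add_one : (n : ℝ) < (n : ℝ) + 1 := lt_add_one _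

/-- The reproducing property for the monomial ⟨w,e⟩^j at the point e/2, with the kernel expanded in
its binomial series. Rotation by scalars kills every term except l = j, and comparison with the
value 2^(-j) yields the moment. -/
lemma binomCoeff_mul_integral (hn : 0 < n) (hν : (n : ℝ) < ν) {e : Cn n} (he : ‖e‖ = 1) (j : ℕ) :
    binomCoeff ν j * ∫ w, ((‖(inner ℂ e w : ℂ)‖ ^ (2 * j) : ℝ) : ℂ) ∂(bergmanMeasure n ν) = 1 := by
  have := isProbabilityMeasure_bergmanMeasure hn hν
  set a : Cn n := ((2⁻¹ : ℝ) : ℂ) • e with ha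
  have ha1 : ‖a‖ < 1 := by
    rw [ha, norm_smul, he, Complex.norm_real]; norm_num
  have hd : Differentiable ℂ fun w : Cn n => (inner ℂ e w : ℂ) ^ j :=
    ((innerSL ℂ e).differentiable).pow j
  have hrep := (integral_mul_bergmanKernel hn hν hd.differentiableOn
    ((memLp_of_continuous hn hν hd.continuous 1).integrable le_rfl) ha1).2
  have hea : inner ℂ e a = ((2⁻¹ : ℝ) : ℂ) := by
    rw [ha, inner_smul_right, inner_self_eq_ofReal, he]; simp
  have hwa : ∀ w, inner ℂ w a = ((2⁻¹ : ℝ) : ℂ) * conj (inner ℂ e w) := fun w => by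
    rw [ha, inner_smul_right, inner_conj_symm]
  have hs := hasSum_integral_of_dominated_convergence (μ := bergmanMeasure n ν)
    (F := fun l w => (inner ℂ e w : ℂ) ^ j * (binomCoeff ν l * inner ℂ w a ^ l))
    (f := fun w => (inner ℂ e w : ℂ) ^ j * bergmanKernel n ν a w)
    (fun l _ => ‖binomCoeff ν l‖ * (2⁻¹ : ℝ) ^ l) (fun l => ?_) (fun l => ?_) ?_ ?_ ?_
  · rw [hrep, hea] at hs
    have hterm : ∀ l, ∫ w, (inner ℂ e w : ℂ) ^ j * (binomCoeff ν l * inner ℂ w a ^ l)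
        ∂(bergmanMeasure n ν) = (binomCoeff ν l * ((2⁻¹ : ℝ) : ℂ) ^ l) *
        ∫ w, (inner ℂ e w : ℂ) ^ j * conj (inner ℂ e w) ^ l ∂(bergmanMeasure n ν) := by
      intro l
      rw [← integral_const_mul]
      refine integral_congr_ae (Filter.Eventually.of_forall fun w => ?_)
      simp only [hwa]; ring
    simp only [hterm] at hs
    have hs' := hasSum_single j (f := fun l => (binomCoeff ν l * ((2⁻¹ : ℝ) : ℂ) ^ l) *
        ∫ w, (inner ℂ e w : ℂ) ^ j * conj (inner ℂ e w) ^ l ∂(bergmanMeasure n ν)) (by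
      intro l hl
      rw [integral_inner_pow_mul_eq_zero hν hl.symm, mul_zero])
    have h := hs.unique hs'
    simp only [pow_mul_conj_pow_self] at h
    have h2 : ((2⁻¹ : ℝ) : ℂ) ^ j ≠ 0 := pow_ne_zero _ (by norm_num)
    refine mul_left_cancel₀ h2 ?_
    rw [mul_one]
    conv_rhs => rw [h]
    ring
  · refine (Continuous.aestronglyMeasurable ?_)
    exact hd.continuous.mul (continuous_const.mul ((continuous_id.inner continuous_const).pow l))
  · filter_upwards [ae_mem_unitBall ν] with w hw
    have h1 := norm_inner_le_one he (mem_unitBall.1 hw).le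
    rw [hwa, norm_mul, norm_mul, norm_pow, norm_pow, norm_mul, RCLike.norm_conj, Complex.norm_real,
      mul_pow]
    have h2 : ‖(inner ℂ e w : ℂ)‖ ^ j ≤ 1 := pow_le_one₀ (norm_nonneg _) h1
    have h3 : ‖(inner ℂ e w : ℂ)‖ ^ l ≤ 1 := pow_le_one₀ (norm_nonneg _) h1
    have h4 : ‖(2⁻¹ : ℝ)‖ = 2⁻¹ := by norm_num
    rw [h4]
    calc _ ≤ 1 * (‖binomCoeff ν l‖ * ((2⁻¹ : ℝ) ^ l * 1)) := by gcongr
      _ = _ := by ring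
  · exact Filter.Eventually.of_forall fun _ =>
      summable_norm_binomCoeff _ (by norm_num) (by norm_num)
  · exact integrable_const _
  · filter_upwards [ae_mem_unitBall ν] with w hw
    have h1 := norm_inner_le_one he (mem_unitBall.1 hw).le
    rw [bergmanKernel_eq, Complex.ofReal_neg]
    refine (hasSum_binomCoeff _ ?_).mul_left _
    rw [hwa, norm_mul, RCLike.norm_conj, Complex.norm_real]
    have h4 : ‖(2⁻¹ : ℝ)‖ = 2⁻¹ := by norm_num
    rw [h4]; linarith

/-- At ν = n + 1 the weight is constant, so polar coordinates leave a power of r on (0,1); the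
exponent 0, where the integral is 1, fixes the constant. -/
lemma integral_norm_pow (hn : 0 < n) (j : ℕ) :
    ∫ w, ‖w‖ ^ (2 * j) ∂(bergmanMeasure n ((n : ℝ) + 1)) = n / (n + j) := by
  have : Nonempty (Fin n) := ⟨⟨0, hn⟩⟩
  have hn' : (0 : ℝ) < n := by exact_mod_cast hn
  have hrad : ∀ i : ℕ, ∫ w in unitBall n, dens n ((n : ℝ) + 1) w • ‖w‖ ^ (2 * i) =
      2 * n * (volume (unitBall n)).toReal * (cConst n ((n : ℝ) + 1) * (1 / (2 * (n + i)))) := by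
    intro i
    have h := integral_fun_norm_addHaar (volume : Measure (Cn n))
      (fun r : ℝ => cConst n ((n : ℝ) + 1) * (if r < 1 then r ^ (2 * i) else 0))
    have h1 : ∫ w in unitBall n, dens n ((n : ℝ) + 1) w • ‖w‖ ^ (2 * i) =
        ∫ w : Cn n, cConst n ((n : ℝ) + 1) * (if ‖w‖ < 1 then ‖w‖ ^ (2 * i) else 0) := by
      rw [← integral_indicator measurableSet_unitBall]
      congr 1
      funext w
      by_cases hw : ‖w‖ < 1
      · rw [indicator_of_mem (mem_unitBall.2 hw), if_pos hw, dens, sub_self, Real.rpow_zero,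
          mul_one, smul_eq_mul]
      · rw [indicator_of_notMem (fun h => hw (mem_unitBall.1 h)), if_neg hw, mul_zero]
    rw [h1, h]
    have hf : Module.finrank ℝ (Cn n) = 2 * n := by
      rw [finrank_real_of_complex]; simp
    have h3 : ∫ y in Ioi (0 : ℝ), y ^ (Module.finrank ℝ (Cn n) - 1) •
        (cConst n ((n : ℝ) + 1) * (if y < 1 then y ^ (2 * i) else 0)) =
        cConst n ((n : ℝ) + 1) * (1 / (2 * (n + i))) := by
      have e1 : ∀ y ∈ Ioi (0 : ℝ), y ^ (Module.finrank ℝ (Cn n) - 1) •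
        (cConst n ((n : ℝ) + 1) * (if y < 1 then y ^ (2 * i) else 0)) =
        cConst n ((n : ℝ) + 1) * (Iio (1 : ℝ)).indicator (fun y => y ^ (2 * n - 1 + 2 * i)) y := by
        intro y _
        rw [hf]
        by_cases hy : y < 1
        · rw [if_pos hy, indicator_of_mem (show y ∈ Iio (1 : ℝ) from hy), smul_eq_mul, pow_add]
          ring
        · rw [if_neg hy, indicator_of_notMem (show y ∉ Iio (1 : ℝ) from hy)]; simp
      rw [setIntegral_congr_fun measurableSet_Ioi e1, integral_const_mul,
        setIntegral_indicator measurableSet_Iio, Ioi_inter_Iio, ← integral_Ioc_eq_integral_Ioo,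
        ← intervalIntegral.integral_of_le zero_le_one, integral_pow]
      congr 1
      have : ((2 * n - 1 + 2 * i : ℕ) : ℝ) + 1 = 2 * (n + i) := by
        have : 2 * n - 1 + 2 * i + 1 = 2 * (n + i) := by omega
        exact_mod_cast this
      rw [this]; simp
    rw [h3, hf]
    simp only [nsmul_eq_mul, smul_eq_mul]
    push_cast
    change 2 * (n : ℝ) * ((volume (unitBall n)).toReal * _) = _
    ring
  have h0 := integral_bergmanMeasure (ν := (n : ℝ) + 1) natCast_lt_add_one
    fun w : Cn n => ‖w‖ ^ (2 * 0)
  have hj := integral_bergmanMeasure (ν := (n : ℝ) + 1) natCast_lt_add_one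
    fun w : Cn n => ‖w‖ ^ (2 * j)
  have := isProbabilityMeasure_bergmanMeasure hn (natCast_lt_add_one (n := n))
  rw [hrad] at h0 hj
  simp only [mul_zero, pow_zero, integral_const, probReal_univ, smul_eq_mul, mul_one,
    Nat.cast_zero, add_zero] at h0
  rw [hj, smul_eq_mul]
  have hj' : (0 : ℝ) < n + j := by positivity
  have hv := volume_unitBall_toReal_pos (n := n)
  field_simp at h0 ⊢
  linear_combination -h0

lemma integral_rot_norm_inner_pow (hn : 0 < n) {e : Cn n} (he : ‖e‖ = 1) (j : ℕ) (z : Cn n) :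
    ∫ k, ‖(inner ℂ e (rot k z) : ℂ)‖ ^ (2 * j) ∂(haarU n) =
      ‖z‖ ^ (2 * j) * ∫ k, ‖(inner ℂ e (rot k e) : ℂ)‖ ^ (2 * j) ∂(haarU n) := by
  rw [integral_rot_congr hn (fun w => ‖(inner ℂ e w : ℂ)‖ ^ (2 * j)) (z := z)
    (w := ((‖z‖ : ℝ) : ℂ) • e) (by rw [norm_smul, he]; simp), ← integral_const_mul]
  refine integral_congr_ae (Filter.Eventually.of_forall fun k => ?_)
  simp only [rot_smul, inner_smul_right, norm_mul, mul_pow, Complex.norm_real, norm_norm]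

lemma continuous_rot_swap :
    Continuous fun p : Cn n × Matrix.unitaryGroup (Fin n) ℂ => rot p.2 p.1 :=
  Continuous.comp (g := fun q : Matrix.unitaryGroup (Fin n) ℂ × Cn n => rot q.1 q.2)
    (f := fun p : Cn n × Matrix.unitaryGroup (Fin n) ℂ => (p.2, p.1)) continuous_rot
    continuous_swap

lemma continuous_inner_rot (e z : Cn n) :
    Continuous fun k : Matrix.unitaryGroup (Fin n) ℂ => (inner ℂ e (rot k z) : ℂ) :=
  Continuous.inner (𝕜 := ℂ) continuous_const (continuous_rot_left z)

lemma continuous_inner_rot_swap (e : Cn n) :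
    Continuous fun p : Cn n × Matrix.unitaryGroup (Fin n) ℂ => (inner ℂ e (rot p.2 p.1) : ℂ) :=
  Continuous.inner (𝕜 := ℂ) continuous_const continuous_rot_swap

/-- Inserting an average over K, which does not change the integral, separates the radial part of
the moment from its spherical part. -/
lemma integral_norm_inner_pow (hn : 0 < n) (hν : (n : ℝ) < ν) {e : Cn n} (he : ‖e‖ = 1) (j : ℕ) :
    ∫ w, ‖(inner ℂ e w : ℂ)‖ ^ (2 * j) ∂(bergmanMeasure n ν) =
      (∫ w, ‖w‖ ^ (2 * j) ∂(bergmanMeasure n ν)) *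
        ∫ k, ‖(inner ℂ e (rot k e) : ℂ)‖ ^ (2 * j) ∂(haarU n) := by
  have := isProbabilityMeasure_bergmanMeasure hn hν
  have hc : Continuous fun p : Cn n × Matrix.unitaryGroup (Fin n) ℂ =>
      ‖(inner ℂ e (rot p.2 p.1) : ℂ)‖ ^ (2 * j) := by
    exact Continuous.pow (Continuous.norm (continuous_inner_rot_swap e)) (2 * j)
  have hi : Integrable (fun p : Cn n × Matrix.unitaryGroup (Fin n) ℂ =>
      ‖(inner ℂ e (rot p.2 p.1) : ℂ)‖ ^ (2 * j)) ((bergmanMeasure n ν).prod (haarU n)) := by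
    refine Integrable.of_bound hc.aestronglyMeasurable 1 ?_
    filter_upwards [ae_prod_mem hn hν] with p hp
    rw [norm_pow, norm_norm]
    exact pow_le_one₀ (norm_nonneg _)
      (norm_inner_le_one he ((norm_rot _ _).trans_le (mem_unitBall.1 hp).le))
  calc ∫ w, ‖(inner ℂ e w : ℂ)‖ ^ (2 * j) ∂(bergmanMeasure n ν)
      = ∫ k, ∫ w, ‖(inner ℂ e (rot k w) : ℂ)‖ ^ (2 * j) ∂(bergmanMeasure n ν) ∂(haarU n) := by
        rw [show (fun k : Matrix.unitaryGroup (Fin n) ℂ =>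
            ∫ w, ‖(inner ℂ e (rot k w) : ℂ)‖ ^ (2 * j) ∂(bergmanMeasure n ν)) =
          fun _ => ∫ w, ‖(inner ℂ e w : ℂ)‖ ^ (2 * j) ∂(bergmanMeasure n ν) from
            funext fun k => integral_comp_rot hν k fun w => ‖(inner ℂ e w : ℂ)‖ ^ (2 * j),
          integral_const, probReal_univ, one_smul]
    _ = ∫ w, ∫ k, ‖(inner ℂ e (rot k w) : ℂ)‖ ^ (2 * j) ∂(haarU n) ∂(bergmanMeasure n ν) :=
        (integral_integral_swap hi).symm
    _ = _ := by
        rw [← integral_mul_const]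
        exact integral_congr_ae (Filter.Eventually.of_forall
          fun w => integral_rot_norm_inner_pow hn he j w)

/-- The moment j!/(n+1)_j on the ball is divided by the radial moment n/(n+j), using n (n+1)_j =
(n+j) (n)_j. This is how the third parameter n of the hypergeometric function arises. -/
lemma ascPochhammer_mul_integral (hn : 0 < n) {e : Cn n} (he : ‖e‖ = 1) (j : ℕ) :
    (ascPochhammer ℂ j).eval (n : ℂ) *
      ((∫ k, ‖(inner ℂ e (rot k e) : ℂ)‖ ^ (2 * j) ∂(haarU n) : ℝ) : ℂ) = j.factorial := by
  have h := binomCoeff_mul_integral hn natCast_lt_add_one he j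
  rw [integral_complex_ofReal, integral_norm_inner_pow hn natCast_lt_add_one he,
    integral_norm_pow hn, binomCoeff] at h
  have h1 : (n : ℂ) * (ascPochhammer ℂ j).eval (n + 1 : ℂ) =
      (n + j) * (ascPochhammer ℂ j).eval (n : ℂ) := ascPochhammer_eval_succ ℂ j n
  have hn0 : (n : ℂ) + j ≠ 0 := by exact_mod_cast (by omega : n + j ≠ 0)
  have hj0 : (j.factorial : ℂ) ≠ 0 := by exact_mod_cast j.factorial_ne_zero
  push_cast at h
  field_simp at h
  set m : ℂ := ((∫ k, ‖(inner ℂ e (rot k e) : ℂ)‖ ^ (2 * j) ∂(haarU n) : ℝ) : ℂ)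
  refine mul_left_cancel₀ hn0 ?_
  linear_combination h - m * h1

/-- The spherical integral representation of the hypergeometric function. -/
lemma hasSum_integral_rot (hn : 0 < n) {e : Cn n} (he : ‖e‖ = 1) (s : ℂ) {z : Cn n}
    (hz : ‖z‖ < 1) :
    HasSum (fun j : ℕ => ((j.factorial : ℂ)⁻¹ * (ascPochhammer ℂ j).eval s *
        (ascPochhammer ℂ j).eval s * ((ascPochhammer ℂ j).eval (n : ℂ))⁻¹) •
        ((‖z‖ ^ 2 : ℝ) : ℂ) ^ j)
      (∫ k, (1 - inner ℂ e (rot k z)) ^ (-s) * (1 - conj (inner ℂ e (rot k z))) ^ (-s)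
        ∂(haarU n)) := by
  have hx : ∀ k, ‖(inner ℂ e (rot k z) : ℂ)‖ ≤ ‖z‖ := fun k =>
    (norm_inner_le_norm _ _).trans (by rw [he, one_mul, norm_rot])
  have hsum := summable_norm_binomCoeff s (norm_nonneg z) hz
  have hs2 : Summable fun p : ℕ × ℕ => (‖binomCoeff s p.1‖ * ‖z‖ ^ p.1) *
      (‖binomCoeff s p.2‖ * ‖z‖ ^ p.2) :=
    hsum.mul_of_nonneg hsum (fun _ => by positivity) (fun _ => by positivity)
  have hs := hasSum_integral_of_dominated_convergence (μ := haarU n)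
    (F := fun (p : ℕ × ℕ) k => (binomCoeff s p.1 * inner ℂ e (rot k z) ^ p.1) *
      (binomCoeff s p.2 * conj (inner ℂ e (rot k z)) ^ p.2))
    (f := fun k => (1 - inner ℂ e (rot k z)) ^ (-s) * (1 - conj (inner ℂ e (rot k z))) ^ (-s))
    (fun p _ => (‖binomCoeff s p.1‖ * ‖z‖ ^ p.1) * (‖binomCoeff s p.2‖ * ‖z‖ ^ p.2))
    (fun p => ?_) (fun p => ?_) ?_ ?_ ?_
  · have hterm : ∀ p : ℕ × ℕ, ∫ k, (binomCoeff s p.1 * inner ℂ e (rot k z) ^ p.1) *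
      (binomCoeff s p.2 * conj (inner ℂ e (rot k z)) ^ p.2) ∂(haarU n) =
        binomCoeff s p.1 * binomCoeff s p.2 *
        ∫ k, inner ℂ e (rot k z) ^ p.1 * conj (inner ℂ e (rot k z)) ^ p.2 ∂(haarU n) := by
      intro p
      rw [← integral_const_mul]
      refine integral_congr_ae (Filter.Eventually.of_forall fun k => ?_)
      ring
    simp only [hterm] at hs
    -- The off-diagonal terms of the double series integrate to zero, so the sum collapses to the
    -- diagonal.
    have hinj : Function.Injective fun j : ℕ => (j, j) := fun a b h => congrArg Prod.fst h
    rw [← hinj.hasSum_iff] at hs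
    · refine hs.congr_fun fun j => ?_
      simp only [Function.comp, pow_mul_conj_pow_self]
      rw [integral_complex_ofReal, integral_rot_norm_inner_pow hn he]
      have h := ascPochhammer_mul_integral hn he j
      set m : ℝ := ∫ k, ‖(inner ℂ e (rot k e) : ℂ)‖ ^ (2 * j) ∂(haarU n)
      have hj0 : (j.factorial : ℂ) ≠ 0 := by exact_mod_cast j.factorial_ne_zero
      have hp0 : (ascPochhammer ℂ j).eval (n : ℂ) ≠ 0 := by
        intro h0; rw [h0, zero_mul] at h; exact hj0 h.symm
      rw [binomCoeff, smul_eq_mul]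
      have hm : (m : ℂ) = j.factorial / (ascPochhammer ℂ j).eval (n : ℂ) := by
        rw [eq_div_iff hp0, mul_comm, h]
      push_cast
      rw [hm]
      field_simp
      rw [← pow_mul]
    · rintro ⟨j, l⟩ h
      have : j ≠ l := by
        rintro rfl; exact h ⟨j, rfl⟩
      rw [integral_rot_inner_pow_mul_eq_zero hn this, mul_zero]
  · have hc := continuous_inner_rot e z
    have hc' : Continuous fun k : Matrix.unitaryGroup (Fin n) ℂ =>
        conj (inner ℂ e (rot k z) : ℂ) := Complex.continuous_conj.comp hc
    have h1 := (Continuous.pow hc p.1).const_mul (binomCoeff s p.1)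
    have h2 := (Continuous.pow hc' p.2).const_mul (binomCoeff s p.2)
    exact (Continuous.mul h1 h2).aestronglyMeasurable
  · refine Filter.Eventually.of_forall fun k => ?_
    simp only [norm_mul, norm_pow, RCLike.norm_conj]
    have := hx k
    gcongr
  · exact Filter.Eventually.of_forall fun _ => hs2
  · exact integrable_const _
  · refine Filter.Eventually.of_forall fun k => ?_
    have h1 := hasSum_binomCoeff s ((hx k).trans_lt hz)
    have h2 := hasSum_binomCoeff s (w := conj (inner ℂ e (rot k z)))
      (by rw [RCLike.norm_conj]; exact (hx k).trans_lt hz)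
    have h3 := summable_mul_of_summable_norm h1.summable.norm h2.summable.norm
    have h4 := HasSum.mul h1 h2 h3
    exact h4

end BallQHA
end

noncomputable section
namespace BallQHA

variable {n : ℕ} {ν : ℝ} {φ : Cn n → ℂ}

/-! ### Spherical functions as averages of powers of the Poisson kernel -/

/-- The (normalized) Poisson kernel `(1 - |z|²) / |1 - ⟨z, u⟩|²`, `u` on the sphere. -/
def pois (u z : Cn n) : ℝ := (1 - ‖z‖ ^ 2) / ‖(1 - inner ℂ u z : ℂ)‖ ^ 2

lemma norm_one_sub_inner_pos {u z : Cn n} (hu : ‖u‖ = 1) (hz : ‖z‖ < 1) :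
    0 < ‖(1 - inner ℂ u z : ℂ)‖ :=
  (re_one_sub_inner_pos hz hu.le).trans_le (Complex.re_le_norm _)

lemma pois_pos {u z : Cn n} (hu : ‖u‖ = 1) (hz : ‖z‖ < 1) : 0 < pois u z := by
  have h1 := norm_one_sub_inner_pos hu hz
  have h2 := one_sub_normSq_pos hz
  unfold pois
  positivity

lemma pois_rot_left (l : Matrix.unitaryGroup (Fin n) ℂ) (u z : Cn n) :
    pois (rot l u) z = pois u (rot l⁻¹ z) := by
  rw [pois, pois, inner_rot_left, norm_rot]

/-- The factors of den x z cancel between numerator and denominator, leaving pois u z · |den x u|².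
The remaining factor does not depend on z and is identified by z = 0, where pois u 0 = 1. -/
lemma pois_moebius (x : SU1 n) {u z : Cn n} (hu : ‖u‖ = 1) (hz : ‖z‖ < 1) :
    pois (moebius x u) (moebius x z) = pois u z * pois (moebius x u) (moebius x 0) := by
  have key : ∀ w : Cn n, ‖w‖ < 1 →
      pois (moebius x u) (moebius x w) = pois u w * ‖den x u‖ ^ 2 := by
    intro w hw
    have h1 : ‖den x w‖ ≠ 0 := norm_ne_zero_iff.2 (den_ne_zero x hw.le)
    have h2 : ‖den x u‖ ≠ 0 := norm_ne_zero_iff.2 (den_ne_zero x hu.le)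
    have h3 := (norm_one_sub_inner_pos hu hw).ne'
    rw [pois, pois, one_sub_normSq_moebius x hw.le, one_sub_inner_moebius x hw.le hu.le,
      norm_div, norm_mul, RCLike.norm_conj]
    field_simp
  rw [key z hz, key 0 (by simp)]
  simp [pois]

lemma continuousOn_pois_cpow {u : Cn n} (hu : ‖u‖ = 1) (s : ℂ) :
    ContinuousOn (fun z => (pois u z : ℂ) ^ s) (unitBall n) := by
  have hc : ContinuousOn (pois u) (unitBall n) := by
    unfold pois
    refine ContinuousOn.div (by fun_prop) ?_ fun z hz =>
      (pow_pos (norm_one_sub_inner_pos hu (mem_unitBall.1 hz)) 2).ne'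
    have : Continuous fun z : Cn n => (inner ℂ u z : ℂ) := (innerSL ℂ u).continuous
    exact ((continuous_const.sub this).norm.pow 2).continuousOn
  refine (Complex.continuous_ofReal.comp_continuousOn hc).cpow_const fun z hz => Or.inl ?_
  simpa using pois_pos hu (mem_unitBall.1 hz)

lemma ofReal_pois_mul_cpow {u v z w : Cn n} (hu : ‖u‖ = 1) (hz : ‖z‖ < 1) (hv : ‖v‖ = 1)
    (hw : ‖w‖ < 1) (s : ℂ) :
    ((pois u z * pois v w : ℝ) : ℂ) ^ s = (pois u z : ℂ) ^ s * (pois v w : ℂ) ^ s := by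
  rw [Complex.ofReal_mul, Complex.mul_cpow_ofReal_nonneg (pois_pos hu hz).le (pois_pos hv hw).le]

/-- Both 1 - ⟨z,u⟩ and its conjugate lie in the right half plane, so the power splits into the two
factors that have binomial expansions. -/
lemma pois_cpow_eq {u z : Cn n} (hu : ‖u‖ = 1) (hz : ‖z‖ < 1) (s : ℂ) :
    (pois u z : ℂ) ^ s = ((1 - ‖z‖ ^ 2 : ℝ) : ℂ) ^ s *
      ((1 - inner ℂ u z) ^ (-s) * (1 - conj (inner ℂ u z)) ^ (-s)) := by
  have h1 := norm_one_sub_inner_pos hu hz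
  have h2 := one_sub_normSq_pos hz
  have h3 := re_one_sub_inner_pos hz hu.le
  have h4 : 0 < (1 - conj (inner ℂ u z) : ℂ).re := by
    simpa only [Complex.sub_re, Complex.one_re, Complex.conj_re] using h3
  rw [pois, div_eq_mul_inv, Complex.ofReal_mul,
    Complex.mul_cpow_ofReal_nonneg h2.le (inv_nonneg.2 (by positivity)), ← mul_cpow_of_re_pos h3 h4]
  congr 1
  have e : (1 - inner ℂ u z) * (1 - conj (inner ℂ u z)) =
      ((‖(1 - inner ℂ u z : ℂ)‖ ^ 2 : ℝ) : ℂ) := by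
    rw [← Complex.normSq_eq_norm_sq, ← Complex.mul_conj, map_sub, map_one]
  rw [e, Complex.ofReal_inv, Complex.cpow_neg, Complex.inv_cpow]
  rw [Complex.arg_ofReal_of_nonneg (by positivity)]
  exact Real.pi_pos.ne

/-- The average over `K` of a power of the Poisson kernel. -/
def poisAvg (u : Cn n) (s : ℂ) (z : Cn n) : ℂ :=
  ∫ k, (pois u (rot k z) : ℂ) ^ s ∂(haarU n)

/-- Moving the boundary point by K only translates the variable of the Haar integral. -/
lemma poisAvg_congr (hn : 0 < n) {u v : Cn n} (h : ‖u‖ = ‖v‖) (s : ℂ) (z : Cn n) :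
    poisAvg v s z = poisAvg u s z := by
  obtain ⟨l, rfl⟩ := exists_rot_eq hn h
  simp only [poisAvg, pois_rot_left, ← rot_mul]
  exact integral_mul_left_eq_self (fun k => (pois u (rot k z) : ℂ) ^ s) l⁻¹

lemma hasSum_poisAvg (hn : 0 < n) {u : Cn n} (hu : ‖u‖ = 1) (s : ℂ) {z : Cn n} (hz : ‖z‖ < 1) :
    HasSum (fun j : ℕ => ((1 - ‖z‖ ^ 2 : ℝ) : ℂ) ^ s *
        (((j.factorial : ℂ)⁻¹ * (ascPochhammer ℂ j).eval s *
        (ascPochhammer ℂ j).eval s * ((ascPochhammer ℂ j).eval (n : ℂ))⁻¹) •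
        ((‖z‖ ^ 2 : ℝ) : ℂ) ^ j)) (poisAvg u s z) := by
  have h := (hasSum_integral_rot hn hu s hz).mul_left (((1 - ‖z‖ ^ 2 : ℝ) : ℂ) ^ s)
  rw [← integral_const_mul] at h
  have e : poisAvg u s z = ∫ k, ((1 - ‖z‖ ^ 2 : ℝ) : ℂ) ^ s * ((1 - inner ℂ u (rot k z)) ^ (-s) *
      (1 - conj (inner ℂ u (rot k z))) ^ (-s)) ∂(haarU n) := by
    refine integral_congr_ae (Filter.Eventually.of_forall fun k => ?_)
    change (pois u (rot k z) : ℂ) ^ s = _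
    rw [pois_cpow_eq hu (by rwa [norm_rot]), norm_rot]
  rw [e]
  exact h

lemma sphericalFun_eq_poisAvg (hn : 0 < n) {u : Cn n} (hu : ‖u‖ = 1) (lam : ℂ) {z : Cn n}
    (hz : ‖z‖ < 1) :
    sphericalFun n lam z = poisAvg u (((n : ℂ) + Complex.I * lam) / 2) z := by
  rw [sphericalFun, ordinaryHypergeometric_eq_tsum, ← tsum_mul_left]
  exact (hasSum_poisAvg hn hu _ hz).tsum_eq

/-- For s = n one factor (n)_j cancels the denominator, and what remains is the binomial series of
(1-|z|²)^(-n). -/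
lemma poisAvg_natCast (hn : 0 < n) {u : Cn n} (hu : ‖u‖ = 1) {z : Cn n} (hz : ‖z‖ < 1) :
    poisAvg u n z = 1 := by
  have h2 := one_sub_normSq_pos hz
  have h := hasSum_poisAvg hn hu n hz
  have h1 := (hasSum_binomCoeff n (w := ((‖z‖ ^ 2 : ℝ) : ℂ)) (by
    rw [Complex.norm_real, Real.norm_of_nonneg (by positivity)]
    linarith)).mul_left (((1 - ‖z‖ ^ 2 : ℝ) : ℂ) ^ (n : ℂ))
  have e : ∀ j : ℕ, ((j.factorial : ℂ)⁻¹ * (ascPochhammer ℂ j).eval (n : ℂ) *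
        (ascPochhammer ℂ j).eval (n : ℂ) * ((ascPochhammer ℂ j).eval (n : ℂ))⁻¹) •
        ((‖z‖ ^ 2 : ℝ) : ℂ) ^ j = binomCoeff n j * ((‖z‖ ^ 2 : ℝ) : ℂ) ^ j := by
    intro j
    have hp0 : (ascPochhammer ℂ j).eval (n : ℂ) ≠ 0 := by
      intro h0
      have := ascPochhammer_mul_integral hn hu j
      rw [h0, zero_mul] at this
      exact j.factorial_ne_zero (by exact_mod_cast this.symm)
    rw [mul_inv_cancel_right₀ hp0, binomCoeff, smul_eq_mul]
    ring
  simp only [e] at h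
  rw [h.unique h1, ← Complex.ofReal_one, ← Complex.ofReal_sub, ← Complex.cpow_add _ _
    (by exact_mod_cast h2.ne')]
  simp

/-! ### Continuity, boundedness and the functional equation of the Poisson averages. -/

lemma continuous_pois_cpow_rot {u : Cn n} (hu : ‖u‖ = 1) (s : ℂ) {X : Type*} [TopologicalSpace X]
    {f : X → Matrix.unitaryGroup (Fin n) ℂ} {g : X → Cn n} (hf : Continuous f) (hg : Continuous g)
    (h : ∀ x, ‖g x‖ < 1) : Continuous fun x => (pois u (rot (f x) (g x)) : ℂ) ^ s := by
  have h1 : Continuous fun x => rot (f x) (g x) :=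
    Continuous.comp (g := fun q : Matrix.unitaryGroup (Fin n) ℂ × Cn n => rot q.1 q.2)
      (f := fun x => (f x, g x)) continuous_rot (hf.prodMk hg)
  exact (continuousOn_pois_cpow hu s).comp_continuous h1 fun x =>
    mem_unitBall.2 (by rw [norm_rot]; exact h x)

lemma continuousOn_poisAvg {u : Cn n} (hu : ‖u‖ = 1) (s : ℂ) :
    ContinuousOn (poisAvg u s) (unitBall n) := by
  have := isOpen_unitBall (n := n).locallyCompactSpace
  rw [continuousOn_iff_continuous_domRestrict]
  have h := continuous_parametric_integral_of_continuous (μ := haarU n)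
    (f := fun (z : unitBall n) k => (pois u (rot k z.1) : ℂ) ^ s)
    (continuous_pois_cpow_rot hu s continuous_snd (continuous_subtype_val.comp continuous_fst)
      fun p => mem_unitBall.1 p.1.2) isCompact_univ
  simp only [Measure.restrict_univ] at h
  exact h

lemma integrable_pois_cpow {u : Cn n} (hu : ‖u‖ = 1) (s : ℂ) {z : Cn n} (hz : ‖z‖ < 1) :
    Integrable (fun k => (pois u (rot k z) : ℂ) ^ s) (haarU n) :=
  (continuous_pois_cpow_rot hu s continuous_id continuous_const fun _ => hz).integrable_of_hasCompactSupport
    (HasCompactSupport.of_compactSpace _)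

/-- For 0 ≤ Re s ≤ n and P > 0 one has P^(Re s) ≤ 1 + P^n, and both summands have mean one over K.
-/
lemma norm_poisAvg_le (hn : 0 < n) {u : Cn n} (hu : ‖u‖ = 1) {s : ℂ} (h0 : 0 ≤ s.re)
    (h1 : s.re ≤ n) {z : Cn n} (hz : ‖z‖ < 1) : ‖poisAvg u s z‖ ≤ 2 := by
  have hp : ∀ k, 0 < pois u (rot k z) := fun k => pois_pos hu (by rwa [norm_rot])
  have e : (fun k => (pois u (rot k z) : ℂ) ^ (n : ℂ)) =
      fun k => ((pois u (rot k z) ^ n : ℝ) : ℂ) := by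
    funext k; rw [Complex.cpow_natCast]; push_cast; rfl
  have hi : Integrable (fun k => pois u (rot k z) ^ n) (haarU n) := by
    have := integrable_pois_cpow hu n hz
    rw [e] at this
    simpa only [RCLike.re_to_complex, Complex.ofReal_re] using this.re
  have hI : ∫ k, pois u (rot k z) ^ n ∂(haarU n) = 1 := by
    have := poisAvg_natCast hn hu hz
    rw [poisAvg, e, integral_complex_ofReal] at this
    exact_mod_cast this
  refine (norm_integral_le_of_norm_le ((integrable_const (1 : ℝ)).add hi)
    (Filter.Eventually.of_forall fun k => ?_)).trans ?_
  · rw [Complex.norm_cpow_eq_rpow_re_of_pos (hp k), Pi.add_apply]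
    rcases le_total (pois u (rot k z)) 1 with h | h
    · have := Real.rpow_le_one (hp k).le h h0
      have := pow_nonneg (hp k).le n
      linarith
    · have := Real.rpow_le_rpow_of_exponent_le h h1
      rw [Real.rpow_natCast] at this
      linarith
  · rw [integral_add' (integrable_const _) hi, hI, integral_const, probReal_univ]
    norm_num

lemma rot_moebius (k : Matrix.unitaryGroup (Fin n) ℂ) (x : SU1 n) {z : Cn n} (hz : ‖z‖ < 1) :
    rot k (moebius x z) = moebius (embK k * x) z := by
  rw [moebius_mul _ _ hz.le, rot]

/-- For fixed k put X = k x and u = X · ζ with ζ on the sphere. The cocycle relation factors P(u, X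
k' z) as P(ζ, k' z) P(u, X · 0), and averaging over k' removes ζ because the mean does not depend on
the boundary point. -/
lemma integral_poisAvg (hn : 0 < n) {u : Cn n} (hu : ‖u‖ = 1) (s : ℂ) (x : SU1 n) {z : Cn n}
    (hz : ‖z‖ < 1) :
    ∫ k, poisAvg u s (moebius x (rot k z)) ∂(haarU n) =
      poisAvg u s (moebius x 0) * poisAvg u s z := by
  have hrz : ∀ k, ‖rot k z‖ < 1 := fun k => by rwa [norm_rot]
  have hm : Continuous fun k : Matrix.unitaryGroup (Fin n) ℂ => moebius x (rot k z) :=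
    (continuousOn_moebius x).comp_continuous (continuous_rot_left z) fun k =>
      mem_unitBall.2 (hrz k)
  have hi : Integrable (fun p : Matrix.unitaryGroup (Fin n) ℂ × Matrix.unitaryGroup (Fin n) ℂ =>
      (pois u (rot p.2 (moebius x (rot p.1 z))) : ℂ) ^ s) ((haarU n).prod (haarU n)) :=
    (continuous_pois_cpow_rot hu s continuous_snd (hm.comp continuous_fst) fun p =>
      norm_moebius_lt_one x (hrz p.1)).integrable_of_hasCompactSupport
        (HasCompactSupport.of_compactSpace _)
  have hswap := integral_integral_swap
    (f := fun k' k => (pois u (rot k (moebius x (rot k' z))) : ℂ) ^ s) hi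
  change ∫ k', ∫ k, (pois u (rot k (moebius x (rot k' z))) : ℂ) ^ s ∂(haarU n) ∂(haarU n) = _
  rw [hswap, poisAvg, ← integral_mul_const]
  refine integral_congr_ae (Filter.Eventually.of_forall fun k => ?_)
  set X : SU1 n := embK k * x
  set ζ : Cn n := moebius X⁻¹ u
  have hζ : ‖ζ‖ = 1 := norm_moebius_eq_one X⁻¹ hu
  have hXζ : moebius X ζ = u := moebius_moebius_inv X hu.le
  change ∫ k', (pois u (rot k (moebius x (rot k' z))) : ℂ) ^ s ∂(haarU n) =
    (pois u (rot k (moebius x 0)) : ℂ) ^ s * poisAvg u s z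
  rw [← poisAvg_congr hn (hu.trans hζ.symm), poisAvg, ← integral_const_mul]
  refine integral_congr_ae (Filter.Eventually.of_forall fun k' => ?_)
  have h0 : ‖(0 : Cn n)‖ < 1 := by simp
  change (pois u (rot k (moebius x (rot k' z))) : ℂ) ^ s =
    (pois u (rot k (moebius x 0)) : ℂ) ^ s * (pois ζ (rot k' z) : ℂ) ^ s
  rw [rot_moebius k x (hrz k'), rot_moebius k x h0]
  have h := pois_moebius X hζ (hrz k')
  rw [hXζ] at h
  rw [h, ofReal_pois_mul_cpow hζ (hrz k') hu (norm_moebius_lt_one X h0), mul_comm]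

lemma continuous_moebius_zero : Continuous fun x : SU1 n => moebius x 0 := by
  have h1 : Continuous fun A : Matrix.SpecialLinearGroup (Fin n ⊕ Unit) ℂ => A.1 :=
    continuous_induced_dom
  have h2 : Continuous fun x : SU1 n => x.1.1 := h1.comp continuous_subtype_val
  have hx : ∀ i j, Continuous fun x : SU1 n => x.1.1 i j := fun i j => h2.matrix_elem i j
  simp only [moebius_eq]
  refine Continuous.smul (Continuous.inv₀ ?_ fun x => den_ne_zero x (by simp)) ?_
  · simp only [den_zero]
    exact hx _ _
  · refine (PiLp.continuous_toLp 2 _).comp (continuous_pi fun i => ?_)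
    simpa using hx (Sum.inl i) (Sum.inr ())

/-- The exponent s = (n+iλ)/2 has real part (n - Im λ)/2, so |Im λ| ≤ n says exactly that 0 ≤ Re s ≤
n, the range where the Poisson averages are bounded by comparison with P^n. -/
theorem isBoundedSpherical_sphericalFun (hn : 0 < n) {lam : ℂ} (hlam : |lam.im| ≤ (n : ℝ)) :
    IsBoundedSpherical n (sphericalFun n lam) := by
  set u : Cn n := EuclideanSpace.single ⟨0, hn⟩ 1
  have hu : ‖u‖ = 1 := by simp [u]
  set s : ℂ := ((n : ℂ) + Complex.I * lam) / 2 with hs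
  have hre : s.re = (n - lam.im) / 2 := by
    rw [hs, show ((n : ℂ) + Complex.I * lam) / 2 = ((2⁻¹ : ℝ) : ℂ) * ((n : ℂ) + Complex.I * lam) by
      push_cast; ring, Complex.re_ofReal_mul]
    simp
    ring
  have h0 : ‖(0 : Cn n)‖ < 1 := by simp
  have hx : ∀ x : SU1 n, ‖moebius x 0‖ < 1 := fun x => norm_moebius_lt_one x h0
  have e : ∀ x : SU1 n, sphericalFun n lam (moebius x 0) = poisAvg u s (moebius x 0) := fun x =>
    sphericalFun_eq_poisAvg hn hu lam (hx x)
  rw [abs_le] at hlam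
  refine ⟨?_, ⟨1, ?_⟩, ⟨2, fun x => ?_⟩, fun x y => ?_⟩
  · simp only [e]
    exact (continuousOn_poisAvg hu s).comp_continuous continuous_moebius_zero fun x =>
      mem_unitBall.2 (hx x)
  · simp [sphericalFun]
  · rw [e]
    exact norm_poisAvg_le hn hu (by rw [hre]; linarith) (by rw [hre]; linarith) (hx x)
  · simp only [e]
    rw [← integral_poisAvg hn hu s x (hx y)]
    refine integral_congr_ae (Filter.Eventually.of_forall fun k => ?_)
    change poisAvg u s (moebius (x * embK k * y) 0) = poisAvg u s (moebius x (rot k (moebius y 0)))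
    rw [moebius_mul _ _ h0.le, moebius_mul _ _ (hx y).le, rot]

end BallQHA
end

theorem mainTheorem11 (n : ℕ) (hn : 0 < n) (ν : ℝ) (hν : (n : ℝ) < ν) :
    (∀ lam : ℂ, |lam.im| ≤ (n : ℝ) →
      BallQHA.IsBoundedSpherical n (BallQHA.sphericalFun n lam)) ∧
    (∀ φ : BallQHA.Cn n → ℂ, BallQHA.IsBoundedSpherical n φ →
      BallQHA.hHat n ν φ ≠ 0 ∧
      ∃ T : BallQHA.bergmanSpace n ν →L[ℂ] BallQHA.bergmanSpace n ν,
        BallQHA.IsToeplitz n ν φ T ∧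
        (∀ s : ℂ, s ^ 2 = BallQHA.hHat n ν φ → ‖s⁻¹ • T‖ ≤ 1) ∧
        ‖T‖ ≤ ‖BallQHA.hHat n ν φ‖ ^ (1 / 2 : ℝ) ∧
        ‖BallQHA.hHat n ν φ‖ ^ (1 / 2 : ℝ) ≤ 1 ∧
        ((∃ z ∈ BallQHA.unitBall n, φ z ≠ 1) →
          ‖BallQHA.hHat n ν φ‖ ^ (1 / 2 : ℝ) < 1)) :=
  ⟨fun _ hlam => BallQHA.isBoundedSpherical_sphericalFun hn hlam,
    fun _ hφ => BallQHA.exists_toeplitz hn hν hφ⟩
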